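/- Fix $s\in\mathbb{R}$ and $1\le\alpha<2$. Let $E^s$ be the space of real-valued tempered distributions $f$ on $\mathbb{R}^2$ whose Fourier transform $\hat f(\xi,\mu)$ is a function, with the norm $$\|f\|_{E^s}=\big\|\langle|\xi|^\alpha+\mu^2\rangle^s\hat f(\xi,\mu)\big\|_{L^2(\mathbb{R}^2)}<\infty,\qquad \langle r\rangle=(1+r^2)^{1/2},$$ and consider the generalized Benjamin-Ono-Zakharov-Kuznetsov equation $$u_t-D_x^\alpha u_x+u_{xyy}=uu_x=\tfrac12\partial_x(u^2),\qquad (\mathrm{g\text{-}BOZK})$$ where $D_x^\alpha$ is the Fourier multiplier by $|\xi|^\alpha$. A solution on $[-T,T]$ is a function $u\in C([-T,T];E^s)$ that satisfies the equation in the sense of distributions on $(-T,T)\times\mathbb{R}^2$ (tested against products $\theta(t)\varphi(x,y)$ with $\theta\in C_c^\infty((-T,T))$ and $\varphi\in\mathcal{S}(\mathbb{R}^2)$). Here $\partial_x(u^2)$ is the limit, in the sense of these test functions, of $\partial_x\big((m_n(D)u)^2\big)$, which is required to exist and to be the same for every sequence of even functions $m_n\in C_c^\infty(\mathbb{R}^2;\mathbb{R})$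 that is uniformly bounded and tends to $1$ pointwise; for $u\in C([-T,T];L^2)$ this is the usual $\partial_x(u^2)$. A smooth solution is a solution in $C([-T,T];E^\sigma)$ for all $\sigma\in\mathbb{R}$. Then there does not exist a $T>0$ such that (g-BOZK) admits, for all initial data $u_0$ in some neighbourhood of the origin of $E^s$, a unique solution $u$ on $[-T,T]$ with $u(0)=u_0$, and such that for every $t\in[-T,T]$ the flow map $u_0\mapsto u(t)$ is $C^2$-differentiable at the origin from $E^s$ to $E^s$. This holds whatever the class in which uniqueness is meant: all solutions, or any class of functions $[-T,T]\to E^s$ that contains all smooth solutions on $[-T,T]$, existence and uniqueness then being meant for the solutions that belong to the class. -/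

import Mathlib

open MeasureTheory Set Filter Topology
open scoped SchwartzMap FourierTransform LineDeriv ContDiff

noncomputable section

namespace BOZK

/-- The plane of the space variables `(x, y)`, and of the frequency variables. -/
abbrev Plane : Type := EuclideanSpace ℝ (Fin 2)

/-- The unit vector of the `x` direction. -/
def ex : Plane := EuclideanSpace.single 0 1

/-- The first frequency variable `ξ` (dual to `x`). Mathlib's Fourier transform is
`∫ exp (-2 π i ⟨x, ζ⟩) f x dx`, so that `∂_x` has the symbol `i ξ` with `ξ = 2 π ζ₀`. -/
def xi (ζ : Plane) : ℝ := 2 * Real.pi * ζ 0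

/-- The second frequency variable `μ` (dual to `y`): `∂_y` has the symbol `i μ`. -/
def mu (ζ : Plane) : ℝ := 2 * Real.pi * ζ 1

/-- The weight `⟨|ξ|^α + μ²⟩^s`, where `⟨r⟩ = (1 + r²)^(1/2)`. -/
def weight (α s : ℝ) (ζ : Plane) : ℝ :=
  (Real.sqrt (1 + (|xi ζ| ^ α + mu ζ ^ 2) ^ 2)) ^ s

/-- The Fourier transform of the tempered distribution `f` is the function `g`. -/
def HasFourierFun (f : 𝓢'(Plane, ℂ)) (g : Plane → ℂ) : Prop :=
  ∀ φ : 𝓢(Plane, ℂ), Integrable (fun ζ => φ ζ * g ζ) ∧ (𝓕 f) φ = ∫ ζ, φ ζ * g ζ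

/-- The tempered distribution `f` is real-valued. -/
def IsRealDistribution (f : 𝓢'(Plane, ℂ)) : Prop :=
  ∀ φ : 𝓢(Plane, ℂ), (∀ x, (φ x).im = 0) → (f φ).im = 0

theorem HasFourierFun.locallyIntegrable {f : 𝓢'(Plane, ℂ)} {g : Plane → ℂ}
    (h : HasFourierFun f g) : LocallyIntegrable g := by
  intro x
  let b : ContDiffBump x := ⟨1, 2, one_pos, one_lt_two⟩
  have hc : HasCompactSupport (fun ζ => (b ζ : ℂ)) :=
    b.hasCompactSupport.comp_left (g := fun r : ℝ => (r : ℂ)) rfl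
  have hs : ContDiff ℝ ∞ (fun ζ => (b ζ : ℂ)) := Complex.ofRealCLM.contDiff.comp b.contDiff
  refine ⟨Metric.closedBall x 1, Metric.closedBall_mem_nhds x one_pos, ?_⟩
  refine ((h (hc.toSchwartzMap hs)).1.integrableOn (s := Metric.closedBall x 1)).congr_fun ?_
    Metric.isClosed_closedBall.measurableSet
  intro ζ hζ
  have : b ζ = 1 := b.one_of_mem_closedBall hζ
  simp [this]

theorem HasFourierFun.ae_eq {f : 𝓢'(Plane, ℂ)} {g₁ g₂ : Plane → ℂ}
    (h₁ : HasFourierFun f g₁) (h₂ : HasFourierFun f g₂) : g₁ =ᵐ[volume] g₂ := by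
  refine ae_eq_of_integral_contDiff_smul_eq h₁.locallyIntegrable h₂.locallyIntegrable ?_
  intro η hη hηc
  have hc : HasCompactSupport (fun ζ => (η ζ : ℂ)) := hηc.comp_left (g := fun r : ℝ => (r : ℂ)) rfl
  have hs : ContDiff ℝ ∞ (fun ζ => (η ζ : ℂ)) := Complex.ofRealCLM.contDiff.comp hη
  have e := ((h₁ (hc.toSchwartzMap hs)).2.symm.trans (h₂ (hc.toSchwartzMap hs)).2)
  simpa [Complex.real_smul] using e

theorem HasFourierFun.add {f₁ f₂ : 𝓢'(Plane, ℂ)} {g₁ g₂ : Plane → ℂ}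
    (h₁ : HasFourierFun f₁ g₁) (h₂ : HasFourierFun f₂ g₂) :
    HasFourierFun (f₁ + f₂) (g₁ + g₂) := by
  intro φ
  have e : (fun ζ => φ ζ * (g₁ + g₂) ζ) = fun ζ => φ ζ * g₁ ζ + φ ζ * g₂ ζ := by
    funext ζ; simp [mul_add]
  refine ⟨by rw [e]; exact (h₁ φ).1.add (h₂ φ).1, ?_⟩
  rw [e, integral_add (h₁ φ).1 (h₂ φ).1, ← (h₁ φ).2, ← (h₂ φ).2]
  rfl

theorem HasFourierFun.smul {f : 𝓢'(Plane, ℂ)} {g : Plane → ℂ} (c : ℝ)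
    (h : HasFourierFun f g) : HasFourierFun (c • f) (c • g) := by
  intro φ
  have e : (fun ζ => φ ζ * (c • g) ζ) = fun ζ => (c : ℂ) * (φ ζ * g ζ) := by
    funext ζ; simp; ring
  refine ⟨by rw [e]; exact (h φ).1.const_mul _, ?_⟩
  rw [e, integral_const_mul, ← (h φ).2]
  simp [TemperedDistribution.fourier_apply]

theorem HasFourierFun.zero : HasFourierFun 0 0 := by
  intro φ
  simp

/-- The real vector space of the real-valued tempered distributions `f` on the plane whose
Fourier transform is a function with `⟨|ξ|^α + μ²⟩^s f̂` in `L²`. -/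
def espaceSubmodule (α s : ℝ) : Submodule ℝ 𝓢'(Plane, ℂ) where
  carrier := {f | IsRealDistribution f ∧
    ∃ g : Plane → ℂ, HasFourierFun f g ∧ MemLp (fun ζ => weight α s ζ • g ζ) 2 volume}
  zero_mem' := ⟨fun _ _ => by simp, 0, HasFourierFun.zero, by simp⟩
  add_mem' := by
    rintro f₁ f₂ ⟨r₁, g₁, h₁, m₁⟩ ⟨r₂, g₂, h₂, m₂⟩
    refine ⟨fun φ hφ => ?_, g₁ + g₂, h₁.add h₂, ?_⟩
    · have := r₁ φ hφ
      have := r₂ φ hφ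
      simp_all
    · convert m₁.add m₂ using 1
      funext ζ; simp
  smul_mem' := by
    rintro c f ⟨r, g, h, m⟩
    refine ⟨fun φ hφ => ?_, c • g, h.smul c, ?_⟩
    · have := r φ hφ
      simp_all
    · convert m.const_smul c using 1
      funext ζ; simp; ring

/-- The space `E^s`; its topology is that of the norm below, not that of distributions. -/
def ESpace (α s : ℝ) : Type := ↥(espaceSubmodule α s)

namespace ESpace

variable {α s : ℝ}

instance : AddCommGroup (ESpace α s) := inferInstanceAs (AddCommGroup ↥(espaceSubmodule α s))

instance : Module ℝ (ESpace α s) := inferInstanceAs (Module ℝ ↥(espaceSubmodule α s))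

/-- An element of `E^s` as a tempered distribution. -/
def toDistribution : ESpace α s →ₗ[ℝ] 𝓢'(Plane, ℂ) := (espaceSubmodule α s).subtype

/-- The Fourier transform of an element of `E^s`, as a function (unique almost everywhere). -/
def hat (f : ESpace α s) : Plane → ℂ := f.2.2.choose

theorem hasFourierFun_hat (f : ESpace α s) : HasFourierFun f.toDistribution f.hat :=
  f.2.2.choose_spec.1

theorem memLp_hat (f : ESpace α s) : MemLp (fun ζ => weight α s ζ • f.hat ζ) 2 volume :=
  f.2.2.choose_spec.2

/-- The map `f ↦ ⟨|ξ|^α + μ²⟩^s f̂` from `E^s` to `L²`. -/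
def toL2 : ESpace α s →ₗ[ℝ] Lp ℂ 2 (volume : Measure Plane) where
  toFun f := f.memLp_hat.toLp
  map_add' f g := by
    rw [← MemLp.toLp_add, MemLp.toLp_eq_toLp_iff]
    have h : (f + g).hat =ᵐ[volume] f.hat + g.hat :=
      (hasFourierFun_hat (f + g)).ae_eq (by
        rw [map_add]; exact (hasFourierFun_hat f).add (hasFourierFun_hat g))
    filter_upwards [h] with ζ hζ
    simp [hζ]
  map_smul' c f := by
    rw [RingHom.id_apply, ← MemLp.toLp_const_smul, MemLp.toLp_eq_toLp_iff]
    have h : (c • f).hat =ᵐ[volume] c • f.hat :=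
      (hasFourierFun_hat (c • f)).ae_eq (by
        rw [map_smul]; exact (hasFourierFun_hat f).smul c)
    filter_upwards [h] with ζ hζ
    simp [hζ]; ring

theorem weight_pos (α s : ℝ) (ζ : Plane) : 0 < weight α s ζ := by
  unfold weight; positivity

theorem toL2_injective : Function.Injective (toL2 : ESpace α s →ₗ[ℝ] _) := by
  rw [← LinearMap.ker_eq_bot, LinearMap.ker_eq_bot']
  intro f hf
  have h0 : (fun ζ => weight α s ζ • f.hat ζ) =ᵐ[volume] 0 := by
    have := f.memLp_hat.coeFn_toLp
    have e : f.memLp_hat.toLp = 0 := hf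
    rw [e] at this
    exact this.symm.trans (Lp.coeFn_zero _ _ _)
  have h1 : f.hat =ᵐ[volume] 0 := by
    filter_upwards [h0] with ζ hζ
    simpa [(weight_pos α s ζ).ne'] using hζ
  have h2 : f.toDistribution = 0 := by
    have h3 : 𝓕 f.toDistribution = 0 := by
      ext φ
      rw [(hasFourierFun_hat f φ).2]
      refine (integral_eq_zero_of_ae ?_).trans rfl
      filter_upwards [h1] with ζ hζ
      simp [hζ]
    have h4 : 𝓕⁻ (𝓕 f.toDistribution) = f.toDistribution := by simp
    rw [← h4, h3]
    ext φ
    simp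
  exact Subtype.ext h2

/-- The norm `‖f‖ = ‖⟨|ξ|^α + μ²⟩^s f̂‖_{L²}` of `E^s`. -/
instance : NormedAddCommGroup (ESpace α s) :=
  NormedAddCommGroup.induced (ESpace α s) (Lp ℂ 2 (volume : Measure Plane)) toL2 toL2_injective

instance : NormedSpace ℝ (ESpace α s) :=
  NormedSpace.induced ℝ (ESpace α s) (Lp ℂ 2 (volume : Measure Plane)) toL2

theorem norm_eq (f : ESpace α s) {g : Plane → ℂ} (h : HasFourierFun f.toDistribution g) :
    ‖f‖ = (eLpNorm (fun ζ => weight α s ζ • g ζ) 2 volume).toReal := by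
  have e : ‖f‖ = ‖f.memLp_hat.toLp‖ := rfl
  rw [e, Lp.norm_toLp]
  congr 1
  apply eLpNorm_congr_ae
  filter_upwards [(hasFourierFun_hat f).ae_eq h] with ζ hζ
  simp [hζ]

/-- The value at the test function `φ` of `p(D) f`, the distribution whose Fourier transform is
`p f̂`. -/
def multiplier (p : Plane → ℂ) (f : ESpace α s) (φ : 𝓢(Plane, ℂ)) : ℂ :=
  ∫ ζ, p ζ * f.hat ζ * (𝓕⁻ φ) ζ

/-- The function `m(D) f`, for a compactly supported `m`: the inverse Fourier transform of
`m f̂`. -/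
def cutoff (m : Plane → ℝ) (f : ESpace α s) : Plane → ℂ :=
  𝓕⁻ (fun ζ => (m ζ : ℂ) * f.hat ζ)

end ESpace

/-- The symbol of the operator `D_x^α ∂_x - ∂_x ∂_y²`, where `D_x^α` has the symbol `|ξ|^α`. -/
def linearSymbol (α : ℝ) (ζ : Plane) : ℂ :=
  ((|xi ζ| ^ α : ℝ) : ℂ) * (Complex.I * xi ζ) - (Complex.I * xi ζ) * (Complex.I * mu ζ) ^ 2

/-- A sequence of smooth frequency cutoffs: even, smooth and compactly supported symbols, bounded
uniformly and converging to `1` pointwise. -/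
structure IsCutoffSeq (m : ℕ → Plane → ℝ) : Prop where
  smooth : ∀ n, ContDiff ℝ ∞ (m n)
  compact : ∀ n, HasCompactSupport (m n)
  even : ∀ n ζ, m n (-ζ) = m n ζ
  bounded : ∃ C : ℝ, ∀ n ζ, |m n ζ| ≤ C
  tendsto_one : ∀ ζ, Tendsto (fun n => m n ζ) atTop (𝓝 1)

/-- `u` is a solution on `[-T, T]` in `C([-T, T]; E^s)` of
`u_t - D_x^α u_x + u_{xyy} = ∂_x (u²) / 2`.

The equation holds in the sense of distributions on `(-T, T) × ℝ²`, tested on the products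
`θ(t) φ(x, y)`. Since `u(t)` need not be a function when `s < 0`, the product `u²` is the
distributional limit of `(m_n(D) u)²` along frequency cutoffs `m_n`, and this limit is required
to exist and to be the same for all sequences of cutoffs. When `u` is in `C([-T, T]; L²)`, the
limit is the usual `u²`. -/
structure IsSolution (α s T : ℝ) (u : ℝ → ESpace α s) : Prop where
  continuousOn : ContinuousOn u (Icc (-T) T)
  equation : ∀ m : ℕ → Plane → ℝ, IsCutoffSeq m →
    ∀ θ : ℝ → ℝ, ContDiff ℝ ∞ θ → HasCompactSupport θ → tsupport θ ⊆ Ioo (-T) T →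
    ∀ φ : 𝓢(Plane, ℂ),
      Tendsto
        (fun n => ∫ t in (-T)..T, (θ t : ℂ) *
          -((1 / 2 : ℂ) * ∫ z, ((u t).cutoff (m n) z) ^ 2 * (∂_{ex} φ) z))
        atTop
        (𝓝 (-(∫ t in (-T)..T, ((deriv θ t : ℝ) : ℂ) * (u t).toDistribution φ)
          - ∫ t in (-T)..T, (θ t : ℂ) * (u t).multiplier (linearSymbol α) φ))

/-- `u` is a solution on `[-T, T]` in `C([-T, T]; E^∞)`, where `E^∞` is the intersection of all
the spaces `E^σ`. -/
def IsSmoothSolution (α s T : ℝ) (u : ℝ → ESpace α s) : Prop :=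
  IsSolution α s T u ∧ ∀ σ : ℝ, ∃ v : ℝ → ESpace α σ, ContinuousOn v (Icc (-T) T) ∧
    ∀ t ∈ Icc (-T) T, (v t).toDistribution = (u t).toDistribution

end BOZK

end

/-! If the flow map is twice differentiable at the origin, its second order Taylor term is
controlled by the square of the norm of the datum. On the Fourier side the equation is `û_t = i ω û
+ (1/2) i ξ (û * û)` with `ω = ξ (|ξ|^α + μ²)`, so this quadratic term is the Duhamel integral of
the free evolution of the datum interacting with itself. The theorem fails because no bound `‖b‖ ≤ C
‖f‖²` can hold for this term, whatever `s` is.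

To identify the quadratic term without knowing anything about the flow except uniqueness, true
smooth solutions are needed. For a datum whose Fourier transform is continuous with bounded support,
the formal power series in the datum is summed explicitly. The term of index `n` has Fourier support
in a ball of radius `(n + 1) R`; the derivative in the nonlinearity costs a factor of order `n`, the
time integration gives back `1 / (n + 1)`, and the remaining combinatorics is that of the Catalan
numbers. Hence the series is geometric, and for a datum multiplied by a small `ε` it converges on
any prescribed time interval (`NiceDatum.fourierSolution`), with a remainder `O(ε³)` after the
quadratic term (`NiceDatum.decay_remainder`). The sum is a smooth solution in the sense of
distributions (`FourierSolution.exists_isSmoothSolution`), so it lies in the uniqueness class and is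
the flow. Comparing powers of `ε` gives `exists_norm_picard_one_le`.

For the contradiction, the datum is a low frequency bump plus bumps near `±(N, (m + l) P - l P)`,
with `P² = N^α`, all supported on thin parallelograms in one common direction. The slope of this
direction and the ratio `m` are chosen so that along it the linear and quadratic terms of `ω` at the
high frequency cancel (`exists_slopes`). The cubic term is `O((P / N)²)`, small because `α < 2`;
across the direction `ω` has derivative of order `N P`, so a width of order `1 / (N P)` is allowed.
Then `ω(ζ) - ω(η) - ω(ζ - η)` stays below `1` for the low-high interactions (`Packet.resonance`) and
nothing oscillates up to time `1`. With `q` of order `1 / (N P)` for the area of the support, `‖f‖²`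
is at most of order `q`, while `‖b‖²` is at least of order `t² N² q³`. The quotient `‖b‖² / ‖f‖⁴` is
thus at least of order `t² N² q`, that is `t² N / P = t² N^(1 - α/2)`, which is unbounded. The high
bumps are scaled by `P^(-2s)`, so that the weight disappears from both estimates. -/

noncomputable section

namespace BOZK

/-! ### The majorant and its convolution square -/

/-- An integrable majorant which is stable under convolution. -/
def maj (ζ : Plane) : ℝ := ((1 + ‖ζ‖) ^ 4)⁻¹

theorem maj_pos (ζ : Plane) : 0 < maj ζ := by unfold maj; positivity

theorem maj_nonneg (ζ : Plane) : 0 ≤ maj ζ := (maj_pos ζ).le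

theorem maj_le_one (ζ : Plane) : maj ζ ≤ 1 := by
  unfold maj
  exact inv_le_one_of_one_le₀ (one_le_pow₀ (by linarith [norm_nonneg ζ]))

theorem continuous_maj : Continuous maj := by
  unfold maj
  exact Continuous.inv₀ (by fun_prop) (fun ζ => by positivity)

theorem integrable_maj : Integrable maj := by
  have h : Integrable (fun ζ : Plane => (1 + ‖ζ‖) ^ (-(4 : ℝ))) :=
    integrable_one_add_norm (by simp; norm_num)
  refine h.congr (Eventually.of_forall fun ζ => ?_)
  have : (0 : ℝ) ≤ 1 + ‖ζ‖ := by positivity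
  simp only [maj]
  rw [Real.rpow_neg this]
  norm_cast

theorem memLp_maj : MemLp maj 2 := by
  rw [memLp_two_iff_integrable_sq continuous_maj.aestronglyMeasurable]
  refine integrable_maj.mono' (by have := continuous_maj; fun_prop)
    (Eventually.of_forall fun ζ => ?_)
  rw [Real.norm_eq_abs, abs_of_nonneg (sq_nonneg _)]
  nlinarith [maj_nonneg ζ, maj_le_one ζ]

theorem maj_le_of_norm_le {ζ η : Plane} (h : ‖ζ‖ ≤ 2 * ‖η‖) : maj η ≤ 16 * maj ζ := by
  unfold maj
  rw [inv_le_iff_one_le_mul₀ (by positivity)]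
  have h1 : 1 + ‖ζ‖ ≤ 2 * (1 + ‖η‖) := by linarith
  have h2 : (1 + ‖ζ‖) ^ 4 ≤ (2 * (1 + ‖η‖)) ^ 4 := pow_le_pow_left₀ (by positivity) h1 4
  rw [mul_right_comm, ← div_eq_mul_inv, le_div_iff₀ (by positivity)]
  linarith [mul_pow 2 (1 + ‖η‖) 4]

/-- One of `η`, `ζ - η` has at least half the norm of `ζ`, and there the majorant is at most `2⁴`
times its value at `ζ`. The other factor is kept for integration. -/
theorem maj_mul_le (ζ η : Plane) :
    maj η * maj (ζ - η) ≤ 16 * maj ζ * (maj η + maj (ζ - η)) := by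
  have h0 := maj_nonneg ζ
  have h1 := maj_nonneg η
  have h2 := maj_nonneg (ζ - η)
  have h3 : ‖ζ‖ ≤ ‖η‖ + ‖ζ - η‖ := by
    calc ‖ζ‖ = ‖η + (ζ - η)‖ := by congr 1; abel
      _ ≤ _ := norm_add_le _ _
  rcases le_total ‖η‖ ‖ζ - η‖ with h | h
  · have := maj_le_of_norm_le (ζ := ζ) (η := ζ - η) (by linarith)
    nlinarith [mul_nonneg h0 h2]
  · have := maj_le_of_norm_le (ζ := ζ) (η := η) (by linarith)
    nlinarith [mul_nonneg h0 h1]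

theorem integrable_maj_mul (ζ : Plane) : Integrable (fun η => maj η * maj (ζ - η)) := by
  have hc := continuous_maj
  refine integrable_maj.mono' (by fun_prop) (Eventually.of_forall fun η => ?_)
  rw [Real.norm_eq_abs, abs_of_nonneg (mul_nonneg (maj_nonneg _) (maj_nonneg _))]
  exact mul_le_of_le_one_right (maj_nonneg _) (maj_le_one _)

/-- The constant in `maj * maj ≤ convConst • maj`. -/
def convConst : ℝ := 32 * ∫ ζ, maj ζ

theorem convConst_nonneg : 0 ≤ convConst := by
  have := integral_nonneg (μ := volume) (f := maj) maj_nonneg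
  unfold convConst; positivity

theorem integral_maj_mul_le (ζ : Plane) :
    ∫ η, maj η * maj (ζ - η) ≤ convConst * maj ζ := by
  have hi : Integrable (fun η => maj (ζ - η)) := integrable_maj.comp_sub_left ζ
  calc ∫ η, maj η * maj (ζ - η)
      ≤ ∫ η, 16 * maj ζ * (maj η + maj (ζ - η)) :=
        integral_mono (integrable_maj_mul ζ) ((integrable_maj.add hi).const_mul _)
          (fun η => maj_mul_le ζ η)
    _ = convConst * maj ζ := by
        rw [integral_const_mul, integral_add integrable_maj hi,
          integral_sub_left_eq_self (fun η => maj η) volume ζ]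
        unfold convConst; ring

/-! ### Convolution and weighted decay -/

/-- The convolution of two functions on the frequency plane. -/
def conv (f g : Plane → ℂ) (ζ : Plane) : ℂ := ∫ η, f η * g (ζ - η)

/-- The bound `(1 + |ζ|)^k |f ζ| ≤ A maj ζ`. -/
def Decay (k : ℕ) (A : ℝ) (f : Plane → ℂ) : Prop := ∀ ζ, (1 + ‖ζ‖) ^ k * ‖f ζ‖ ≤ A * maj ζ

namespace Decay

variable {k : ℕ} {A B : ℝ} {f g : Plane → ℂ}

theorem nonneg (h : Decay k A f) : 0 ≤ A := by
  have h1 := h 0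
  have h2 : 0 ≤ (1 + ‖(0 : Plane)‖) ^ k * ‖f 0‖ := by positivity
  by_contra hA
  push Not at hA
  nlinarith [maj_pos 0]

theorem norm_le (h : Decay k A f) (ζ : Plane) : ‖f ζ‖ ≤ A * maj ζ := by
  refine le_trans ?_ (h ζ)
  exact le_mul_of_one_le_left (norm_nonneg _) (one_le_pow₀ (by linarith [norm_nonneg ζ]))

theorem norm_le_const (h : Decay k A f) (ζ : Plane) : ‖f ζ‖ ≤ A :=
  (h.norm_le ζ).trans (mul_le_of_le_one_right h.nonneg (maj_le_one ζ))

theorem of_le (h : Decay k A f) {l : ℕ} (hl : l ≤ k) : Decay l A f := fun ζ =>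
  (mul_le_mul_of_nonneg_right (pow_le_pow_right₀ (by linarith [norm_nonneg ζ]) hl)
    (norm_nonneg _)).trans (h ζ)

theorem mono (h : Decay k A f) (hB : A ≤ B) : Decay k B f := fun ζ =>
  (h ζ).trans (mul_le_mul_of_nonneg_right hB (maj_nonneg ζ))

theorem integrable (h : Decay k A f) (hf : Continuous f) : Integrable f :=
  (integrable_maj.const_mul A).mono' hf.aestronglyMeasurable (Eventually.of_forall h.norm_le)

theorem add (h : Decay k A f) (h' : Decay k B g) : Decay k (A + B) (fun ζ => f ζ + g ζ) := by
  intro ζ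
  have h1 := h ζ
  have h2 := h' ζ
  have h3 := norm_add_le (f ζ) (g ζ)
  have h4 : (0 : ℝ) ≤ (1 + ‖ζ‖) ^ k := by positivity
  nlinarith [mul_le_mul_of_nonneg_left h3 h4]

theorem const_mul (h : Decay k A f) (c : ℂ) : Decay k (‖c‖ * A) (fun ζ => c * f ζ) := by
  intro ζ
  have h1 := mul_le_mul_of_nonneg_left (h ζ) (norm_nonneg c)
  rw [norm_mul]
  linarith

/-- A symbol of polynomial growth is paid for by lowering the order of decay; this is how the
unbounded factors `ξ`, `ω` and the weight are absorbed. -/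
theorem mul_poly (h : Decay (k + l) A f) {p : Plane → ℂ} {C : ℝ}
    (hp : ∀ ζ, ‖p ζ‖ ≤ C * (1 + ‖ζ‖) ^ l) : Decay k (C * A) (fun ζ => p ζ * f ζ) := by
  intro ζ
  have hC : 0 ≤ C := by
    have := (norm_nonneg _).trans (hp 0)
    simpa using this
  rw [norm_mul]
  calc (1 + ‖ζ‖) ^ k * (‖p ζ‖ * ‖f ζ‖)
      ≤ (1 + ‖ζ‖) ^ k * ((C * (1 + ‖ζ‖) ^ l) * ‖f ζ‖) := by gcongr; exact hp ζ
    _ = C * ((1 + ‖ζ‖) ^ (k + l) * ‖f ζ‖) := by ring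
    _ ≤ C * (A * maj ζ) := mul_le_mul_of_nonneg_left (h ζ) hC
    _ = _ := by ring

theorem conv_integrable (h : Decay k A f) (h' : Decay k B g) (hf : Continuous f)
    (hg : Continuous g) (ζ : Plane) : Integrable (fun η => f η * g (ζ - η)) := by
  refine ((integrable_maj_mul ζ).const_mul (A * B)).mono' (by fun_prop)
    (Eventually.of_forall fun η => ?_)
  rw [norm_mul]
  calc ‖f η‖ * ‖g (ζ - η)‖ ≤ (A * maj η) * (B * maj (ζ - η)) :=
        mul_le_mul (h.norm_le _) (h'.norm_le _) (norm_nonneg _)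
          (mul_nonneg h.nonneg (maj_nonneg _))
    _ = _ := by ring

/-- The polynomial weight is submultiplicative, `1 + |ζ| ≤ (1 + |η|)(1 + |ζ - η|)`, so it
distributes over the two factors, and what remains is the convolution of the majorant with itself.
Each class `Decay k` is thus an algebra. -/
theorem conv (h : Decay k A f) (h' : Decay k B g) : Decay k (A * B * convConst) (conv f g) := by
  intro ζ
  have hA := h.nonneg
  have hB := h'.nonneg
  have key : ∀ η, ‖(1 + ‖ζ‖) ^ k * (f η * g (ζ - η))‖ ≤ A * B * (maj η * maj (ζ - η)) := by
    intro η
    have h3 : 1 + ‖ζ‖ ≤ (1 + ‖η‖) * (1 + ‖ζ - η‖) := by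
      have : ‖ζ‖ ≤ ‖η‖ + ‖ζ - η‖ := by
        calc ‖ζ‖ = ‖η + (ζ - η)‖ := by congr 1; abel
          _ ≤ _ := norm_add_le _ _
      nlinarith [mul_nonneg (norm_nonneg η) (norm_nonneg (ζ - η))]
    have h4 : (1 + ‖ζ‖) ^ k ≤ (1 + ‖η‖) ^ k * (1 + ‖ζ - η‖) ^ k := by
      rw [← mul_pow]; exact pow_le_pow_left₀ (by positivity) h3 k
    have e : ‖(1 + (‖ζ‖ : ℂ)) ^ k‖ = (1 + ‖ζ‖) ^ k := by
      rw [norm_pow]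
      congr 1
      have : ((1 + ‖ζ‖ : ℝ) : ℂ) = 1 + (‖ζ‖ : ℂ) := by push_cast; rfl
      rw [← this, Complex.norm_real, Real.norm_eq_abs, abs_of_nonneg (by positivity)]
    rw [norm_mul, norm_mul, e]
    calc (1 + ‖ζ‖) ^ k * (‖f η‖ * ‖g (ζ - η)‖)
        ≤ ((1 + ‖η‖) ^ k * (1 + ‖ζ - η‖) ^ k) * (‖f η‖ * ‖g (ζ - η)‖) := by gcongr
      _ = ((1 + ‖η‖) ^ k * ‖f η‖) * ((1 + ‖ζ - η‖) ^ k * ‖g (ζ - η)‖) := by ring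
      _ ≤ (A * maj η) * (B * maj (ζ - η)) :=
        mul_le_mul (h _) (h' _) (by positivity) (mul_nonneg hA (maj_nonneg _))
      _ = _ := by ring
  have e2 : (1 + ‖ζ‖) ^ k * ‖BOZK.conv f g ζ‖ = ‖∫ η, (1 + (‖ζ‖ : ℂ)) ^ k * (f η * g (ζ - η))‖ := by
    rw [integral_const_mul, norm_mul]
    congr 1
    rw [norm_pow]
    congr 1
    have : ((1 + ‖ζ‖ : ℝ) : ℂ) = 1 + (‖ζ‖ : ℂ) := by push_cast; rfl
    rw [← this, Complex.norm_real, Real.norm_eq_abs, abs_of_nonneg (by positivity)]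
  rw [e2]
  refine (norm_integral_le_of_norm_le ((integrable_maj_mul ζ).const_mul (A * B))
    (Eventually.of_forall key)).trans ?_
  rw [integral_const_mul, mul_assoc (A * B)]
  exact mul_le_mul_of_nonneg_left (integral_maj_mul_le ζ) (mul_nonneg hA hB)

theorem continuous_conv (h : Decay k A f) (h' : Decay k B g) (hf : Continuous f)
    (hg : Continuous g) : Continuous (BOZK.conv f g) := by
  unfold BOZK.conv
  refine continuous_of_dominated (bound := fun η => (A * maj η) * B) (fun ζ => by fun_prop)
    (fun ζ => Eventually.of_forall fun η => ?_) ((integrable_maj.const_mul A).mul_const B)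
    (Eventually.of_forall fun η => by fun_prop)
  rw [norm_mul]
  exact mul_le_mul (h.norm_le _) (h'.norm_le_const _) (norm_nonneg _)
    (mul_nonneg h.nonneg (maj_nonneg _))

end Decay

theorem conv_conj_neg {f g : Plane → ℂ} (hf : ∀ ζ, f (-ζ) = starRingEnd ℂ (f ζ))
    (hg : ∀ ζ, g (-ζ) = starRingEnd ℂ (g ζ)) (ζ : Plane) :
    conv f g (-ζ) = starRingEnd ℂ (conv f g ζ) := by
  unfold conv
  rw [← integral_conj, ← integral_neg_eq_self]
  congr 1
  funext η
  rw [map_mul, ← hf, ← hg]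
  congr 2
  abel

/-! ### The symbols -/

theorem continuous_xi : Continuous xi := by unfold xi; fun_prop

theorem continuous_mu : Continuous mu := by unfold mu; fun_prop

theorem abs_coord_le (ζ : Plane) (i : Fin 2) : |ζ i| ≤ ‖ζ‖ := by
  simpa using PiLp.norm_apply_le ζ i

/-- The `7` is a round bound for `2π`; the later `98 = 2 · 7²` and `686 = 7 · 98` come from it. -/
theorem abs_xi_le (ζ : Plane) : |xi ζ| ≤ 7 * ‖ζ‖ := by
  unfold xi
  rw [abs_mul, abs_of_pos Real.two_pi_pos]
  have := abs_coord_le ζ 0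
  nlinarith [Real.pi_lt_d2, Real.pi_pos, abs_nonneg (ζ 0), norm_nonneg ζ]

theorem abs_mu_le (ζ : Plane) : |mu ζ| ≤ 7 * ‖ζ‖ := by
  unfold mu
  rw [abs_mul, abs_of_pos Real.two_pi_pos]
  have := abs_coord_le ζ 1
  nlinarith [Real.pi_lt_d2, Real.pi_pos, abs_nonneg (ζ 1), norm_nonneg ζ]

/-- The anisotropic size `|ξ|^α + μ²` of a frequency. -/
def rho (α : ℝ) (ζ : Plane) : ℝ := |xi ζ| ^ α + mu ζ ^ 2

/-- The dispersion relation: `linearSymbol = i omega`. -/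
def omega (α : ℝ) (ζ : Plane) : ℝ := xi ζ * rho α ζ

theorem linearSymbol_eq (α : ℝ) (ζ : Plane) : linearSymbol α ζ = Complex.I * (omega α ζ : ℂ) := by
  unfold linearSymbol omega rho
  have : Complex.I ^ 2 = -1 := Complex.I_sq
  push_cast
  linear_combination (-Complex.I * (xi ζ : ℂ) * (mu ζ : ℂ) ^ 2) * this

theorem rho_nonneg (α : ℝ) (ζ : Plane) : 0 ≤ rho α ζ := by unfold rho; positivity

theorem continuous_rho {α : ℝ} (hα : 0 ≤ α) : Continuous (rho α) := by
  unfold rho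
  exact ((continuous_xi.abs).rpow_const fun _ => Or.inr hα).add (continuous_mu.pow 2)

theorem continuous_omega {α : ℝ} (hα : 0 ≤ α) : Continuous (omega α) :=
  continuous_xi.mul (continuous_rho hα)

theorem rho_le {α : ℝ} (hα : 0 ≤ α) (hα' : α ≤ 2) (ζ : Plane) :
    rho α ζ ≤ 98 * (1 + ‖ζ‖) ^ 2 := by
  have h1 : |xi ζ| ^ α ≤ (1 + |xi ζ|) ^ (2 : ℝ) :=
    (Real.rpow_le_rpow (abs_nonneg _) (by linarith) hα).trans
      (Real.rpow_le_rpow_of_exponent_le (by linarith [abs_nonneg (xi ζ)]) hα')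
  rw [Real.rpow_two] at h1
  have h2 := abs_xi_le ζ
  have h3 := abs_mu_le ζ
  have h4 := norm_nonneg ζ
  have h5 : (1 + |xi ζ|) ^ 2 ≤ (7 * (1 + ‖ζ‖)) ^ 2 :=
    pow_le_pow_left₀ (by positivity) (by linarith) 2
  have h6 : mu ζ ^ 2 ≤ (7 * (1 + ‖ζ‖)) ^ 2 := by
    rw [← sq_abs]; exact pow_le_pow_left₀ (by positivity) (by linarith) 2
  unfold rho
  nlinarith

theorem abs_omega_le {α : ℝ} (hα : 0 ≤ α) (hα' : α ≤ 2) (ζ : Plane) :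
    |omega α ζ| ≤ 686 * (1 + ‖ζ‖) ^ 3 := by
  unfold omega
  rw [abs_mul, abs_of_nonneg (rho_nonneg α ζ)]
  have h1 : |xi ζ| ≤ 7 * (1 + ‖ζ‖) := by linarith [abs_xi_le ζ]
  calc |xi ζ| * rho α ζ ≤ (7 * (1 + ‖ζ‖)) * (98 * (1 + ‖ζ‖) ^ 2) :=
        mul_le_mul h1 (rho_le hα hα' ζ) (rho_nonneg _ _) (by positivity)
    _ = _ := by ring

theorem omega_neg (α : ℝ) (ζ : Plane) : omega α (-ζ) = -omega α ζ := by
  unfold omega rho xi mu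
  simp

theorem xi_neg (ζ : Plane) : xi (-ζ) = -xi ζ := by simp [xi]

theorem weight_eq (α s : ℝ) (ζ : Plane) : weight α s ζ = (Real.sqrt (1 + rho α ζ ^ 2)) ^ s := rfl

theorem continuous_weight {α : ℝ} (hα : 0 ≤ α) (s : ℝ) : Continuous (weight α s) := by
  have h := continuous_rho hα
  have : weight α s = fun ζ => (Real.sqrt (1 + rho α ζ ^ 2)) ^ s := rfl
  rw [this]
  refine Continuous.rpow_const (by fun_prop) fun ζ => Or.inl ?_
  positivity

theorem sqrt_one_add_sq_le {r : ℝ} (hr : 0 ≤ r) : Real.sqrt (1 + r ^ 2) ≤ 1 + r := by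
  rw [Real.sqrt_le_left (by positivity)]
  nlinarith

theorem exists_weight_le {α : ℝ} (hα : 0 ≤ α) (hα' : α ≤ 2) (s : ℝ) :
    ∃ C : ℝ, ∃ k : ℕ, 0 ≤ C ∧ ∀ ζ, weight α s ζ ≤ C * (1 + ‖ζ‖) ^ k := by
  obtain ⟨k, hk⟩ := exists_nat_ge |s|
  refine ⟨99 ^ k, 2 * k, by positivity, fun ζ => ?_⟩
  have h1 : 1 ≤ Real.sqrt (1 + rho α ζ ^ 2) := by
    rw [Real.one_le_sqrt]; nlinarith [sq_nonneg (rho α ζ)]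
  have h2 : Real.sqrt (1 + rho α ζ ^ 2) ≤ 99 * (1 + ‖ζ‖) ^ 2 := by
    have := sqrt_one_add_sq_le (rho_nonneg α ζ)
    have := rho_le hα hα' ζ
    have : (1 : ℝ) ≤ (1 + ‖ζ‖) ^ 2 := one_le_pow₀ (by linarith [norm_nonneg ζ])
    linarith
  calc weight α s ζ ≤ (Real.sqrt (1 + rho α ζ ^ 2)) ^ (k : ℝ) :=
        Real.rpow_le_rpow_of_exponent_le h1 ((le_abs_self s).trans hk)
    _ = (Real.sqrt (1 + rho α ζ ^ 2)) ^ k := Real.rpow_natCast _ _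
    _ ≤ (99 * (1 + ‖ζ‖) ^ 2) ^ k := pow_le_pow_left₀ (by positivity) h2 k
    _ = _ := by rw [mul_pow, pow_mul]

/-! ### Elements of `E^s` with a given Fourier transform -/

theorem HasFourierFun.apply_eq {f : 𝓢'(Plane, ℂ)} {g : Plane → ℂ} (h : HasFourierFun f g)
    (φ : 𝓢(Plane, ℂ)) : f φ = ∫ ζ, (𝓕⁻ φ) ζ * g ζ := by
  rw [← (h (𝓕⁻ φ)).2, TemperedDistribution.fourier_apply]
  simp

theorem memLp_of_decay {k : ℕ} {A : ℝ} {f : Plane → ℂ} (h : Decay k A f) (hf : Continuous f) :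
    MemLp f 2 :=
  (memLp_maj.const_mul A).mono' hf.aestronglyMeasurable (Eventually.of_forall h.norm_le)

theorem fourierInv_conj_of_real {φ : 𝓢(Plane, ℂ)} (hφ : ∀ x, (φ x).im = 0) (ζ : Plane) :
    (𝓕⁻ φ) (-ζ) = starRingEnd ℂ ((𝓕⁻ φ) ζ) := by
  rw [SchwartzMap.fourierInv_coe, Real.fourierInv_eq, Real.fourierInv_eq, ← integral_conj]
  congr 1
  funext v
  have : starRingEnd ℂ (φ v) = φ v := Complex.conj_eq_iff_im.mpr (hφ v)
  rw [Circle.smul_def, Circle.smul_def, smul_eq_mul, smul_eq_mul, map_mul, this]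
  congr 1
  rw [inner_neg_right, AddChar.map_neg_eq_inv, Circle.coe_inv_eq_conj]

/-- Conjugate symmetry of `g` is reality of the distribution. Decay of every order is asked for
because the polynomial growth of the weight depends on `s`. -/
theorem exists_hasFourierFun {α : ℝ} (hα : 0 ≤ α) (hα' : α ≤ 2) (s : ℝ) {g : Plane → ℂ}
    (hg : Continuous g) (hconj : ∀ ζ, g (-ζ) = starRingEnd ℂ (g ζ))
    (hdec : ∀ k, ∃ A, Decay k A g) : ∃ f : ESpace α s, HasFourierFun f.toDistribution g := by
  obtain ⟨A, hA⟩ := hdec 0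
  let F : 𝓢'(Plane, ℂ) := Lp.toTemperedDistribution (memLp_of_decay hA hg).toLp
  have hF : HasFourierFun (𝓕⁻ F) g := by
    intro φ
    refine ⟨φ.integrable.mul_bdd (c := A) hg.aestronglyMeasurable
      (Eventually.of_forall hA.norm_le_const), ?_⟩
    rw [FourierTransform.fourier_fourierInv_eq]
    simp only [F, Lp.toTemperedDistribution_apply, smul_eq_mul]
    refine integral_congr_ae ?_
    filter_upwards [(memLp_of_decay hA hg).coeFn_toLp] with ζ hζ
    rw [hζ]
  have hreal : IsRealDistribution (𝓕⁻ F) := by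
    intro φ hφ
    rw [← Complex.conj_eq_iff_im, hF.apply_eq, ← integral_conj, ← integral_neg_eq_self]
    congr 1
    funext ζ
    rw [map_mul, ← hconj, ← fourierInv_conj_of_real hφ, neg_neg]
  obtain ⟨C, k, hC, hw⟩ := exists_weight_le hα hα' s
  obtain ⟨A', hA'⟩ := hdec k
  refine ⟨⟨𝓕⁻ F, hreal, g, hF, ?_⟩, hF⟩
  have hA'' : Decay (0 + k) A' g := by simpa using hA'
  have hwC := continuous_weight hα s
  refine memLp_of_decay (k := 0) (A := C * A') ?_ (by fun_prop)
  have := hA''.mul_poly (p := fun ζ => (weight α s ζ : ℂ)) (C := C) (fun ζ => by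
    rw [Complex.norm_real, Real.norm_eq_abs, abs_of_pos (ESpace.weight_pos α s ζ)]
    exact hw ζ)
  simpa [Complex.real_smul] using this

/-- The `L²` norm of the majorant. -/
def majNorm : ℝ := (eLpNorm maj 2 (volume : Measure Plane)).toReal

theorem norm_le_of_decay {α s : ℝ} {C : ℝ} {k : ℕ} (hC : 0 ≤ C)
    (hw : ∀ ζ, weight α s ζ ≤ C * (1 + ‖ζ‖) ^ k)
    {f : ESpace α s} {g : Plane → ℂ} (hf : HasFourierFun f.toDistribution g) {A : ℝ}
    (hA : Decay k A g) : ‖f‖ ≤ C * A * majNorm := by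
  rw [ESpace.norm_eq f hf]
  have h1 : ∀ ζ, ‖weight α s ζ • g ζ‖ ≤ C * A * ‖maj ζ‖ := by
    intro ζ
    rw [norm_smul, Real.norm_eq_abs, abs_of_pos (ESpace.weight_pos α s ζ), Real.norm_eq_abs,
      abs_of_nonneg (maj_nonneg ζ)]
    calc weight α s ζ * ‖g ζ‖ ≤ (C * (1 + ‖ζ‖) ^ k) * ‖g ζ‖ := by gcongr; exact hw ζ
      _ = C * ((1 + ‖ζ‖) ^ k * ‖g ζ‖) := by ring
      _ ≤ C * (A * maj ζ) := mul_le_mul_of_nonneg_left (hA ζ) hC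
      _ = _ := by ring
  have h2 := eLpNorm_le_mul_eLpNorm_of_ae_le_mul (p := 2) (Eventually.of_forall h1)
    (μ := (volume : Measure Plane))
  have h3 : ENNReal.ofReal (C * A) * eLpNorm maj 2 (volume : Measure Plane) ≠ ⊤ :=
    ENNReal.mul_ne_top ENNReal.ofReal_ne_top memLp_maj.2.ne
  refine (ENNReal.toReal_mono h3 h2).trans_eq ?_
  rw [ENNReal.toReal_mul, ENNReal.toReal_ofReal (mul_nonneg hC hA.nonneg)]
  rfl

/-! ### The equation on the Fourier side -/

/-- The right hand side of the equation on the Fourier side. -/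
def rhs (α : ℝ) (f : Plane → ℂ) (ζ : Plane) : ℂ :=
  Complex.I * omega α ζ * f ζ + (1 / 2) * (Complex.I * xi ζ * conv f f ζ)

/-- `U` solves the Fourier transformed equation on `(-T, T)`, with rapid decay. -/
structure FourierSolution (α T : ℝ) (U : ℝ → Plane → ℂ) : Prop where
  cont : ∀ t ∈ Ioo (-T) T, Continuous (U t)
  conj_neg : ∀ t ∈ Ioo (-T) T, ∀ ζ, U t (-ζ) = starRingEnd ℂ (U t ζ)
  decay : ∀ k, ∃ A, ∀ t ∈ Ioo (-T) T, Decay k A (U t)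
  hasDerivAt : ∀ t ∈ Ioo (-T) T, ∀ ζ, HasDerivAt (fun t => U t ζ) (rhs α (U t) ζ) t

theorem norm_I_mul_xi_le (ζ : Plane) : ‖Complex.I * (xi ζ : ℂ)‖ ≤ 7 * (1 + ‖ζ‖) ^ 1 := by
  rw [norm_mul, Complex.norm_I, one_mul, Complex.norm_real, Real.norm_eq_abs]
  linarith [abs_xi_le ζ]

theorem norm_I_mul_omega_le {α : ℝ} (hα : 0 ≤ α) (hα' : α ≤ 2) (ζ : Plane) :
    ‖Complex.I * (omega α ζ : ℂ)‖ ≤ 686 * (1 + ‖ζ‖) ^ 3 := by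
  rw [norm_mul, Complex.norm_I, one_mul, Complex.norm_real, Real.norm_eq_abs]
  exact abs_omega_le hα hα' ζ

/-- Dominated convergence. The filter is kept general because the limit is taken both in time and
along sequences of frequency cutoffs. -/
theorem tendsto_conv {ι : Type*} {l : Filter ι} [l.IsCountablyGenerated] {V : ι → Plane → ℂ}
    {V₀ : Plane → ℂ} {k : ℕ} {A : ℝ} (hc : ∀ᶠ i in l, Continuous (V i))
    (hd : ∀ᶠ i in l, Decay k A (V i)) (hV : ∀ ζ, Tendsto (fun i => V i ζ) l (𝓝 (V₀ ζ)))
    (ζ : Plane) : Tendsto (fun i => conv (V i) (V i) ζ) l (𝓝 (conv V₀ V₀ ζ)) := by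
  unfold conv
  refine tendsto_integral_filter_of_dominated_convergence (fun η => (A * maj η) * A) ?_ ?_
    ((integrable_maj.const_mul A).mul_const A)
    (Eventually.of_forall fun η => (hV η).mul (hV (ζ - η)))
  · filter_upwards [hc] with i hi
    exact (by fun_prop : Continuous fun η => V i η * V i (ζ - η)).aestronglyMeasurable
  · filter_upwards [hd] with i hi
    refine Eventually.of_forall fun η => ?_
    rw [norm_mul]
    exact mul_le_mul (hi.norm_le _) (hi.norm_le_const _) (norm_nonneg _)
      (mul_nonneg hi.nonneg (maj_nonneg _))

theorem tendsto_pairing {ι : Type*} {l : Filter ι} [l.IsCountablyGenerated] {V : ι → Plane → ℂ}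
    {V₀ q : Plane → ℂ} {k : ℕ} {A Q : ℝ} (hq : Continuous q) (hQ : ∀ ζ, ‖q ζ‖ ≤ Q)
    (hc : ∀ᶠ i in l, Continuous (V i))
    (hd : ∀ᶠ i in l, Decay k A (V i)) (hV : ∀ ζ, Tendsto (fun i => V i ζ) l (𝓝 (V₀ ζ))) :
    Tendsto (fun i => ∫ ζ, q ζ * V i ζ) l (𝓝 (∫ ζ, q ζ * V₀ ζ)) := by
  refine tendsto_integral_filter_of_dominated_convergence (fun η => Q * (A * maj η)) ?_ ?_
    ((integrable_maj.const_mul A).const_mul Q)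
    (Eventually.of_forall fun η => (hV η).const_mul _)
  · filter_upwards [hc] with i hi
    exact (hq.mul hi).aestronglyMeasurable
  · filter_upwards [hd] with i hi
    refine Eventually.of_forall fun η => ?_
    rw [norm_mul]
    exact mul_le_mul (hQ _) (hi.norm_le _) (norm_nonneg _) ((norm_nonneg _).trans (hQ η))

theorem norm_pairing_le {V q : Plane → ℂ} {k : ℕ} {A Q : ℝ} (hQ : ∀ ζ, ‖q ζ‖ ≤ Q)
    (hd : Decay k A V) : ‖∫ ζ, q ζ * V ζ‖ ≤ Q * A * ∫ ζ, maj ζ := by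
  rw [← integral_const_mul]
  refine norm_integral_le_of_norm_le (integrable_maj.const_mul _)
    (Eventually.of_forall fun η => ?_)
  rw [norm_mul, mul_assoc]
  exact mul_le_mul (hQ _) (hd.norm_le _) (norm_nonneg _) ((norm_nonneg _).trans (hQ η))

/-- The Fourier transform of `∂_x (v²)`, where `V` is the Fourier transform of `v`. -/
def dxSq (V : Plane → ℂ) (ζ : Plane) : ℂ := Complex.I * xi ζ * conv V V ζ

theorem decay_dxSq {k : ℕ} {A : ℝ} {V : Plane → ℂ} (h : Decay (k + 1) A V) :
    Decay k (7 * (A * A * convConst)) (dxSq V) :=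
  (h.conv h).mul_poly norm_I_mul_xi_le

theorem continuous_dxSq {k : ℕ} {A : ℝ} {V : Plane → ℂ} (h : Decay k A V) (hV : Continuous V) :
    Continuous (dxSq V) := by
  have h1 := h.continuous_conv h hV hV
  have h2 := continuous_xi
  unfold dxSq
  fun_prop

theorem tendsto_dxSq {ι : Type*} {l : Filter ι} [l.IsCountablyGenerated] {V : ι → Plane → ℂ}
    {V₀ : Plane → ℂ} {k : ℕ} {A : ℝ} (hc : ∀ᶠ i in l, Continuous (V i))
    (hd : ∀ᶠ i in l, Decay k A (V i)) (hV : ∀ ζ, Tendsto (fun i => V i ζ) l (𝓝 (V₀ ζ)))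
    (ζ : Plane) : Tendsto (fun i => dxSq (V i) ζ) l (𝓝 (dxSq V₀ ζ)) :=
  (tendsto_conv hc hd hV ζ).const_mul _

theorem exists_norm_le_schwartz (φ : 𝓢(Plane, ℂ)) : ∃ Q : ℝ, ∀ ζ, ‖φ ζ‖ ≤ Q := by
  obtain ⟨Q, -, hQ⟩ := φ.decay 0 0
  exact ⟨Q, fun ζ => by simpa using hQ ζ⟩

theorem fourierInv_lineDeriv_ex (φ : 𝓢(Plane, ℂ)) (ζ : Plane) :
    (𝓕⁻ (∂_{ex} φ)) ζ = -(Complex.I * xi ζ * (𝓕⁻ φ) ζ) := by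
  rw [SchwartzMap.fourierInv_lineDerivOp_eq, _root_.smul_apply,
    SchwartzMap.smulLeftCLM_apply_apply (by fun_prop)]
  have : inner ℝ ζ ex = ζ 0 := by
    simp [ex, EuclideanSpace.inner_single_right]
  rw [this]
  simp [xi]
  ring

/-- This is the multiplication formula for `𝓕`, applied after the reflection `z ↦ -z`. Only
integrability of `c` is needed since the other factor is Schwartz. -/
theorem integral_fourierInv_mul_schwartz {c : Plane → ℂ} (hc : Integrable c)
    (φ : 𝓢(Plane, ℂ)) : ∫ z, (𝓕⁻ c) z * φ z = ∫ ζ, (𝓕⁻ φ) ζ * c ζ := by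
  have h := VectorFourier.integral_fourierIntegral_smul_eq_flip (μ := volume) (ν := volume)
    (L := innerₗ Plane) (e := Real.fourierChar) (f := c) (g := fun z => φ (-z))
    Real.continuous_fourierChar (by simpa using continuous_inner) hc
    (φ.integrable.comp_neg)
  have e1 : ∫ z, (𝓕⁻ c) z * φ z = ∫ z, (𝓕 c) z * φ (-z) := by
    rw [← integral_neg_eq_self]
    congr 1
    funext z
    rw [Real.fourierInv_eq_fourier_neg, neg_neg]
  rw [e1]
  refine (Eq.trans ?_ h).trans ?_
  · rfl
  · congr 1
    funext ζ
    rw [smul_eq_mul, mul_comm, flip_innerₗ, SchwartzMap.fourierInv_coe,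
      Real.fourierInv_eq_fourier_comp_neg]
    rfl

theorem fourierInv_sq {a : Plane → ℂ} (ha : Integrable a) (z : Plane) :
    (𝓕⁻ a z) ^ 2 = 𝓕⁻ (conv a a) z := by
  rw [Real.fourierInv_eq_fourier_neg, Real.fourierInv_eq_fourier_neg, sq,
    ← Real.fourier_mul_convolution_eq ha ha]
  rfl

/-- Squaring in space is convolution in frequency, and the derivative on the test function turns
into `-i ξ`. This rewrites the regularized nonlinear term of `IsSolution` as a frequency pairing in
which limits are dominated. -/
theorem integral_cutoff_sq {α s : ℝ} {f : ESpace α s} {g : Plane → ℂ}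
    (hf : HasFourierFun f.toDistribution g) {m : Plane → ℝ} {A : ℝ}
    (hc : Continuous fun ζ => (m ζ : ℂ) * g ζ)
    (hd : Decay 0 A fun ζ => (m ζ : ℂ) * g ζ) (φ : 𝓢(Plane, ℂ)) :
    -((1 / 2 : ℂ) * ∫ z, (f.cutoff m z) ^ 2 * (∂_{ex} φ) z) =
      (1 / 2) * ∫ ζ, (𝓕⁻ φ) ζ * dxSq (fun ζ => (m ζ : ℂ) * g ζ) ζ := by
  have e : f.cutoff m = 𝓕⁻ (fun ζ => (m ζ : ℂ) * g ζ) := by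
    funext z
    unfold ESpace.cutoff
    rw [Real.fourierInv_eq, Real.fourierInv_eq]
    refine integral_congr_ae ?_
    filter_upwards [f.hasFourierFun_hat.ae_eq hf] with ζ hζ
    rw [hζ]
  rw [e]
  have hi := hd.integrable hc
  simp_rw [fourierInv_sq hi]
  rw [integral_fourierInv_mul_schwartz ((hd.conv hd).integrable (hd.continuous_conv hd hc hc)),
    ← mul_neg, ← integral_neg]
  congr 2
  funext ζ
  rw [fourierInv_lineDeriv_ex]
  unfold dxSq
  ring

theorem decay_mul_bounded {k : ℕ} {A C : ℝ} {g : Plane → ℂ} (h : Decay k A g) {m : Plane → ℝ}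
    (hm : ∀ ζ, |m ζ| ≤ C) : Decay k (C * A) fun ζ => (m ζ : ℂ) * g ζ :=
  (show Decay (k + 0) A g from h).mul_poly fun ζ => by simpa using hm ζ

/-! ### From Fourier solutions to solutions in the sense of distributions -/

namespace FourierSolution

variable {α T : ℝ} {U : ℝ → Plane → ℂ}

theorem rhs_eq (t : ℝ) (ζ : Plane) :
    rhs α (U t) ζ = Complex.I * omega α ζ * U t ζ + (1 / 2) * dxSq (U t) ζ := rfl

theorem continuous_rhs (h : FourierSolution α T U) (hα : 0 ≤ α) {t : ℝ}
    (ht : t ∈ Ioo (-T) T) : Continuous (rhs α (U t)) := by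
  obtain ⟨A, hA⟩ := h.decay 0
  have h1 := continuous_dxSq (hA t ht) (h.cont t ht)
  have h2 := continuous_omega hα
  have h3 := h.cont t ht
  have : rhs α (U t) = fun ζ => Complex.I * omega α ζ * U t ζ + (1 / 2) * dxSq (U t) ζ := rfl
  rw [this]
  fun_prop

theorem exists_decay_rhs (h : FourierSolution α T U) (hα : 0 ≤ α) (hα' : α ≤ 2) (k : ℕ) :
    ∃ A, 0 ≤ A ∧ ∀ t ∈ Ioo (-T) T, Decay k A (rhs α (U t)) := by
  obtain ⟨A, hA⟩ := h.decay (k + 3)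
  obtain ⟨B, hB⟩ := h.decay (k + 1)
  rcases (Ioo (-T) T).eq_empty_or_nonempty with he | ⟨t₀, ht₀⟩
  · exact ⟨0, le_rfl, by simp [he]⟩
  have key : ∀ t ∈ Ioo (-T) T, Decay k _ (rhs α (U t)) := fun t ht =>
    ((hA t ht).mul_poly (norm_I_mul_omega_le hα hα')).add ((decay_dxSq (hB t ht)).const_mul (1 / 2))
  exact ⟨_, (key t₀ ht₀).nonneg, key⟩

/-- The right hand side of the equation decays to order `k` uniformly in time, and the mean value
inequality is applied at each frequency. It yields Lipschitz continuity in time with values in every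
`E^σ`. -/
theorem exists_lipschitz (h : FourierSolution α T U) (hα : 0 ≤ α) (hα' : α ≤ 2) (k : ℕ) :
    ∃ A, 0 ≤ A ∧ ∀ t ∈ Ioo (-T) T, ∀ t' ∈ Ioo (-T) T,
      Decay k (A * |t - t'|) (fun ζ => U t ζ - U t' ζ) := by
  obtain ⟨A, hA0, hA⟩ := h.exists_decay_rhs hα hα' k
  refine ⟨A, hA0, fun t ht t' ht' ζ => ?_⟩
  have hp : (0 : ℝ) < (1 + ‖ζ‖) ^ k := by positivity
  have := (convex_Ioo (-T) T).norm_image_sub_le_of_norm_hasDerivWithin_le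
    (f := fun t => U t ζ) (C := A * maj ζ / (1 + ‖ζ‖) ^ k)
    (fun x hx => (h.hasDerivAt x hx ζ).hasDerivWithinAt)
    (fun x hx => by
      rw [le_div_iff₀ hp, mul_comm]
      exact hA x hx ζ) ht' ht
  rw [Real.norm_eq_abs, div_mul_eq_mul_div, le_div_iff₀ hp] at this
  calc _ = ‖U t ζ - U t' ζ‖ * (1 + ‖ζ‖) ^ k := mul_comm _ _
    _ ≤ A * maj ζ * |t - t'| := this
    _ = _ := by ring

theorem continuousOn_espace (h : FourierSolution α T U) (hα : 0 ≤ α) (hα' : α ≤ 2) {σ : ℝ}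
    {u : ℝ → ESpace α σ}
    {S : Set ℝ} (hS : S ⊆ Ioo (-T) T) (hu : ∀ t ∈ S, HasFourierFun (u t).toDistribution (U t)) :
    ContinuousOn u S := by
  obtain ⟨C, k, hC, hw⟩ := exists_weight_le hα hα' σ
  obtain ⟨A, hA0, hA⟩ := h.exists_lipschitz hα hα' k
  have hM : 0 ≤ majNorm := ENNReal.toReal_nonneg
  refine LipschitzOnWith.continuousOn (K := (C * A * majNorm).toNNReal)
    (LipschitzOnWith.of_dist_le_mul fun t ht t' ht' => ?_)
  rw [Real.coe_toNNReal _ (by positivity), dist_eq_norm, Real.dist_eq]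
  have h1 : HasFourierFun (u t - u t').toDistribution (fun ζ => U t ζ - U t' ζ) := by
    have := (hu t ht).add ((hu t' ht').smul (-1))
    have e : (u t - u t').toDistribution = (u t).toDistribution + (-1 : ℝ) • (u t').toDistribution := by
      rw [← map_smul, ← map_add, sub_eq_add_neg, neg_one_smul]
    rw [e]
    convert this using 1
    funext ζ
    simp [sub_eq_add_neg]
  refine (norm_le_of_decay hC hw h1 (hA t (hS ht) t' (hS ht'))).trans_eq (by ring)

theorem continuousAt_time (h : FourierSolution α T U) {t : ℝ} (ht : t ∈ Ioo (-T) T) (ζ : Plane) :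
    Tendsto (fun t => U t ζ) (𝓝 t) (𝓝 (U t ζ)) := (h.hasDerivAt t ht ζ).continuousAt

theorem hasDerivAt_pairing (h : FourierSolution α T U) (hα : 0 ≤ α) (hα' : α ≤ 2)
    {q : Plane → ℂ} {Q : ℝ} (hq : Continuous q) (hQ : ∀ ζ, ‖q ζ‖ ≤ Q) {t : ℝ}
    (ht : t ∈ Ioo (-T) T) :
    HasDerivAt (fun t => ∫ ζ, q ζ * U t ζ) (∫ ζ, q ζ * rhs α (U t) ζ) t := by
  obtain ⟨A, hA0, hA⟩ := h.exists_decay_rhs hα hα' 0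
  obtain ⟨B, hB⟩ := h.decay 0
  have hmem : Ioo (-T) T ∈ 𝓝 t := isOpen_Ioo.mem_nhds ht
  refine (hasDerivAt_integral_of_dominated_loc_of_deriv_le (𝕜 := ℝ)
    (F := fun t ζ => q ζ * U t ζ) (F' := fun t ζ => q ζ * rhs α (U t) ζ)
    (bound := fun ζ => Q * (A * maj ζ)) hmem ?_ ?_ ?_ ?_ ?_ ?_).2
  · filter_upwards [hmem] with x hx
    exact (hq.mul (h.cont x hx)).aestronglyMeasurable
  · exact (((hB t ht).integrable (h.cont t ht)).bdd_mul hq.aestronglyMeasurable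
      (Eventually.of_forall hQ))
  · exact (hq.mul (h.continuous_rhs hα ht)).aestronglyMeasurable
  · refine Eventually.of_forall fun ζ x hx => ?_
    rw [norm_mul]
    exact mul_le_mul (hQ _) ((hA x hx).norm_le _) (norm_nonneg _) ((norm_nonneg _).trans (hQ ζ))
  · exact (integrable_maj.const_mul _).const_mul _
  · exact Eventually.of_forall fun ζ x hx => (h.hasDerivAt x hx ζ).const_mul _

theorem continuousOn_pairing_dxSq (h : FourierSolution α T U)
    {q : Plane → ℂ} {Q : ℝ} (hq : Continuous q) (hQ : ∀ ζ, ‖q ζ‖ ≤ Q) {m : Plane → ℝ} {C : ℝ}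
    (hm : Continuous m) (hC : ∀ ζ, |m ζ| ≤ C) :
    ContinuousOn (fun t => ∫ ζ, q ζ * dxSq (fun ζ => (m ζ : ℂ) * U t ζ) ζ) (Ioo (-T) T) := by
  obtain ⟨A, hA⟩ := h.decay 1
  intro t ht
  have hmem : ∀ᶠ x in 𝓝 t, x ∈ Ioo (-T) T := isOpen_Ioo.mem_nhds ht
  have hd : ∀ᶠ x in 𝓝 t, Decay (0 + 1) (C * A) (fun ζ => (m ζ : ℂ) * U x ζ) :=
    hmem.mono fun x hx => decay_mul_bounded (hA x hx) hC
  have hc : ∀ᶠ x in 𝓝 t, Continuous (fun ζ => (m ζ : ℂ) * U x ζ) :=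
    hmem.mono fun x hx => by have := h.cont x hx; fun_prop
  refine ContinuousAt.continuousWithinAt (tendsto_pairing (k := 0)
    (A := 7 * (C * A * (C * A) * convConst)) hq hQ ?_ ?_
    (tendsto_dxSq hc hd fun ζ => (h.continuousAt_time ht ζ).const_mul _))
  · filter_upwards [hd, hc] with x h1 h2 using continuous_dxSq h1 h2
  · filter_upwards [hd] with x h1 using decay_dxSq h1

theorem continuousOn_pairing_symbol (h : FourierSolution α T U) (hα : 0 ≤ α) (hα' : α ≤ 2)
    {q : Plane → ℂ} {Q : ℝ} (hq : Continuous q) (hQ : ∀ ζ, ‖q ζ‖ ≤ Q) :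
    ContinuousOn (fun t => ∫ ζ, q ζ * (Complex.I * omega α ζ * U t ζ)) (Ioo (-T) T) := by
  obtain ⟨A, hA⟩ := h.decay (0 + 3)
  intro t ht
  have hmem : ∀ᶠ x in 𝓝 t, x ∈ Ioo (-T) T := isOpen_Ioo.mem_nhds ht
  have := continuous_omega hα
  refine ContinuousAt.continuousWithinAt (tendsto_pairing (k := 0) (A := 686 * A) hq hQ ?_ ?_
    fun ζ => (h.continuousAt_time ht ζ).const_mul _)
  · filter_upwards [hmem] with x hx
    have := h.cont x hx
    fun_prop
  · filter_upwards [hmem] with x hx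
    exact (hA x hx).mul_poly (norm_I_mul_omega_le hα hα')

theorem tendsto_pairing_cutoff (h : FourierSolution α T U)
    {q : Plane → ℂ} {Q : ℝ} (hq : Continuous q) (hQ : ∀ ζ, ‖q ζ‖ ≤ Q) {m : ℕ → Plane → ℝ}
    (hm : IsCutoffSeq m) {t : ℝ} (ht : t ∈ Ioo (-T) T) :
    Tendsto (fun n => ∫ ζ, q ζ * dxSq (fun ζ => (m n ζ : ℂ) * U t ζ) ζ) atTop
      (𝓝 (∫ ζ, q ζ * dxSq (U t) ζ)) := by
  obtain ⟨A, hA⟩ := h.decay 1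
  obtain ⟨C, hC⟩ := hm.bounded
  have hd : ∀ n, Decay (0 + 1) (C * A) (fun ζ => (m n ζ : ℂ) * U t ζ) :=
    fun n => decay_mul_bounded (hA t ht) (hC n)
  have hc : ∀ n, Continuous (fun ζ => (m n ζ : ℂ) * U t ζ) := fun n => by
    have := h.cont t ht
    have := (hm.smooth n).continuous
    fun_prop
  refine tendsto_pairing hq hQ (Eventually.of_forall fun n => continuous_dxSq (hd n) (hc n))
    (Eventually.of_forall fun n => decay_dxSq (hd n))
    (tendsto_dxSq (Eventually.of_forall hc) (Eventually.of_forall hd) fun ζ => ?_)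
  have := ((Complex.continuous_ofReal.tendsto 1).comp (hm.tendsto_one ζ)).mul_const (U t ζ)
  simpa using this

/-- Integration by parts in time against the pairing `G`, which is differentiable with derivative `L
+ N / 2`. The strict inequality `T₀ < T` puts the closed time interval inside the open one where the
Fourier equation is known. -/
theorem isSolution (h : FourierSolution α T U) (hα : 0 ≤ α) (hα' : α ≤ 2) {s T₀ : ℝ}
    (hT₀ : 0 < T₀) (hT : T₀ < T) {u : ℝ → ESpace α s}
    (hu : ∀ t ∈ Icc (-T₀) T₀, HasFourierFun (u t).toDistribution (U t)) :
    IsSolution α s T₀ u := by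
  have hsub : Icc (-T₀) T₀ ⊆ Ioo (-T) T := fun t ht => ⟨by linarith [ht.1], by linarith [ht.2]⟩
  refine ⟨h.continuousOn_espace hα hα' hsub hu, fun m hm θ hθ _ hθs φ => ?_⟩
  obtain ⟨Q, hQ⟩ := exists_norm_le_schwartz (𝓕⁻ φ)
  have hq : Continuous (𝓕⁻ φ : 𝓢(Plane, ℂ)) := (𝓕⁻ φ).continuous
  obtain ⟨C, hC⟩ := hm.bounded
  obtain ⟨A, hA⟩ := h.decay 1
  have hle : -T₀ ≤ T₀ := by linarith
  have hmem : ∀ t ∈ uIoc (-T₀) T₀, t ∈ Icc (-T₀) T₀ := fun t ht => by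
    rw [uIoc_of_le hle] at ht
    exact ⟨ht.1.le, ht.2⟩
  have hmem' : ∀ t ∈ uIcc (-T₀) T₀, t ∈ Icc (-T₀) T₀ := fun t ht => by
    rwa [uIcc_of_le hle] at ht
  set L : ℝ → ℂ := fun t => ∫ ζ, (𝓕⁻ φ) ζ * (Complex.I * omega α ζ * U t ζ) with hL
  set N : ℝ → ℂ := fun t => ∫ ζ, (𝓕⁻ φ) ζ * dxSq (U t) ζ with hN
  set G : ℝ → ℂ := fun t => ∫ ζ, (𝓕⁻ φ) ζ * U t ζ with hG
  have hθc : Continuous θ := hθ.continuous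
  have hθ' : Continuous (deriv θ) := hθ.continuous_deriv (by simp)
  have hLc : ContinuousOn L (Ioo (-T) T) := h.continuousOn_pairing_symbol hα hα' hq hQ
  have hNc : ContinuousOn N (Ioo (-T) T) := by
    have := h.continuousOn_pairing_dxSq hq hQ (m := fun _ => 1) (C := 1) continuous_const
      (fun ζ => by simp)
    simpa using this
  have hG' : ∀ t ∈ Ioo (-T) T, HasDerivAt G (L t + (1 / 2) * N t) t := by
    intro t ht
    have := h.hasDerivAt_pairing hα hα' hq hQ ht
    convert this using 1
    obtain ⟨A3, hA3⟩ := h.decay (0 + 3)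
    have i1 : Integrable (fun ζ => (𝓕⁻ φ) ζ * (Complex.I * omega α ζ * U t ζ)) := by
      have hco := continuous_omega hα
      have hcU := h.cont t ht
      refine (((hA3 t ht).mul_poly (norm_I_mul_omega_le hα hα')).integrable
        (by fun_prop)).bdd_mul hq.aestronglyMeasurable (Eventually.of_forall hQ)
    have i2 : Integrable (fun ζ => (𝓕⁻ φ) ζ * dxSq (U t) ζ) :=
      ((decay_dxSq (k := 0) (hA t ht)).integrable
        (continuous_dxSq (hA t ht) (h.cont t ht))).bdd_mul hq.aestronglyMeasurable
        (Eventually.of_forall hQ)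
    rw [hL, hN]
    simp only
    rw [← integral_const_mul, ← integral_add i1 (i2.const_mul _)]
    congr 1
    funext ζ
    rw [rhs_eq]
    ring
  -- The support of `θ` lies in the open interval, so there are no boundary terms.
  have hθ0 : θ T₀ = 0 ∧ θ (-T₀) = 0 := by
    constructor <;> refine image_eq_zero_of_notMem_tsupport fun hmem => ?_
    · exact absurd (hθs hmem).2 (lt_irrefl _)
    · exact absurd (hθs hmem).1 (lt_irrefl _)
  have hθd : ∀ t, HasDerivAt (fun t => (θ t : ℂ)) ((deriv θ t : ℝ) : ℂ) t := fun t =>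
    ((hθ.differentiable (by simp) t).hasDerivAt).ofReal_comp
  have iL : IntervalIntegrable (fun t => (θ t : ℂ) * L t) volume (-T₀) T₀ :=
    ContinuousOn.intervalIntegrable_of_Icc hle
      (((Complex.continuous_ofReal.comp hθc).continuousOn).mul (hLc.mono hsub))
  have iN : IntervalIntegrable (fun t => (θ t : ℂ) * ((1 / 2) * N t)) volume (-T₀) T₀ :=
    ContinuousOn.intervalIntegrable_of_Icc hle
      (((Complex.continuous_ofReal.comp hθc).continuousOn).mul
        (continuousOn_const.mul (hNc.mono hsub)))
  have iLN : IntervalIntegrable (fun t => L t + (1 / 2) * N t) volume (-T₀) T₀ :=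
    ContinuousOn.intervalIntegrable_of_Icc hle
      ((hLc.mono hsub).add (continuousOn_const.mul (hNc.mono hsub)))
  have iθ : IntervalIntegrable (fun t => ((deriv θ t : ℝ) : ℂ)) volume (-T₀) T₀ :=
    (Complex.continuous_ofReal.comp hθ').intervalIntegrable _ _
  have hparts := intervalIntegral.integral_mul_deriv_eq_deriv_mul
    (fun t _ => hθd t) (fun t ht => hG' t (hsub (hmem' t ht))) iθ iLN
  rw [hθ0.1, hθ0.2] at hparts
  have e1 : ∫ t in (-T₀)..T₀, ((deriv θ t : ℝ) : ℂ) * (u t).toDistribution φ =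
      ∫ t in (-T₀)..T₀, ((deriv θ t : ℝ) : ℂ) * G t := by
    refine intervalIntegral.integral_congr fun t ht => ?_
    rw [(hu t (hmem' t ht)).apply_eq]
  have e2 : ∫ t in (-T₀)..T₀, (θ t : ℂ) * (u t).multiplier (linearSymbol α) φ =
      ∫ t in (-T₀)..T₀, (θ t : ℂ) * L t := by
    refine intervalIntegral.integral_congr fun t ht => ?_
    simp only [ESpace.multiplier, hL]
    congr 1
    refine integral_congr_ae ?_
    filter_upwards [(u t).hasFourierFun_hat.ae_eq (hu t (hmem' t ht))] with ζ hζ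
    rw [hζ, linearSymbol_eq]
    ring
  have e3 : -(∫ t in (-T₀)..T₀, ((deriv θ t : ℝ) : ℂ) * (u t).toDistribution φ)
      - ∫ t in (-T₀)..T₀, (θ t : ℂ) * (u t).multiplier (linearSymbol α) φ
      = ∫ t in (-T₀)..T₀, (θ t : ℂ) * ((1 / 2) * N t) := by
    rw [e1, e2]
    have e : ∫ t in (-T₀)..T₀, (θ t : ℂ) * (L t + (1 / 2) * N t) =
        (∫ t in (-T₀)..T₀, (θ t : ℂ) * L t) + ∫ t in (-T₀)..T₀, (θ t : ℂ) * ((1 / 2) * N t) := by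
      rw [← intervalIntegral.integral_add iL iN]
      simp only [mul_add]
    rw [e, Complex.ofReal_zero] at hparts
    linear_combination (-1 : ℂ) * hparts
  rw [e3]
  have hAnn : Decay 1 A (U 0) := hA 0 (hsub ⟨by linarith, by linarith⟩)
  -- A bound for the regularized nonlinear pairing that is uniform in both `n` and `t`, since the
  -- cutoffs are uniformly bounded by `C`.
  set K : ℝ := Q * (7 * (C * A * (C * A) * convConst)) * ∫ ζ, maj ζ
  refine intervalIntegral.tendsto_integral_filter_of_dominated_convergence
    (fun t => |θ t| * ((1 / 2) * K)) ?_ ?_ ?_ ?_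
  · refine Eventually.of_forall fun n => ?_
    have hmn : Continuous (m n) := (hm.smooth n).continuous
    have hco : ContinuousOn (fun t => (θ t : ℂ) *
        ((1 / 2) * ∫ ζ, (𝓕⁻ φ) ζ * dxSq (fun ζ => (m n ζ : ℂ) * U t ζ) ζ)) (Icc (-T₀) T₀) :=
      ((Complex.continuous_ofReal.comp hθc).continuousOn).mul
        (continuousOn_const.mul ((h.continuousOn_pairing_dxSq hq hQ hmn (hC n)).mono hsub))
    rw [uIoc_of_le hle]
    refine AEStronglyMeasurable.congr
      ((hco.mono Ioc_subset_Icc_self).aestronglyMeasurable measurableSet_Ioc) ?_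
    filter_upwards [ae_restrict_mem measurableSet_Ioc] with t ht
    have ht' : t ∈ Icc (-T₀) T₀ := Ioc_subset_Icc_self ht
    have hcU := h.cont t (hsub ht')
    rw [integral_cutoff_sq (hu t ht') (by fun_prop)
      ((decay_mul_bounded (hA t (hsub ht')) (hC n)).of_le (Nat.zero_le 1))]
  · refine Eventually.of_forall fun n => Eventually.of_forall fun t ht => ?_
    have ht' := hmem t ht
    have hcU := h.cont t (hsub ht')
    have hmn : Continuous (m n) := (hm.smooth n).continuous
    rw [integral_cutoff_sq (hu t ht') (by fun_prop)
      ((decay_mul_bounded (hA t (hsub ht')) (hC n)).of_le (Nat.zero_le 1)), norm_mul, norm_mul,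
      Complex.norm_real, Real.norm_eq_abs]
    have := norm_pairing_le hQ (decay_dxSq (k := 0) (decay_mul_bounded (hA t (hsub ht')) (hC n)))
    have e : ‖(1 / 2 : ℂ)‖ = 1 / 2 := by norm_num
    rw [e]
    gcongr
  · exact (hθc.abs.mul continuous_const).intervalIntegrable _ _
  · refine Eventually.of_forall fun t ht => ?_
    have ht' := hmem t ht
    have hcU := h.cont t (hsub ht')
    refine Tendsto.const_mul _ ?_
    refine ((h.tendsto_pairing_cutoff hq hQ hm (hsub ht')).const_mul (1 / 2)).congr fun n => ?_
    have hmn : Continuous (m n) := (hm.smooth n).continuous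
    rw [integral_cutoff_sq (hu t ht') (by fun_prop)
      ((decay_mul_bounded (hA t (hsub ht')) (hC n)).of_le (Nat.zero_le 1))]

theorem exists_lift (h : FourierSolution α T U) (hα : 0 ≤ α) (hα' : α ≤ 2) (σ : ℝ) :
    ∃ u : ℝ → ESpace α σ, ∀ t ∈ Ioo (-T) T, HasFourierFun (u t).toDistribution (U t) := by
  have : ∀ t, ∃ f : ESpace α σ, t ∈ Ioo (-T) T → HasFourierFun f.toDistribution (U t) := by
    intro t
    by_cases ht : t ∈ Ioo (-T) T
    · obtain ⟨f, hf⟩ := exists_hasFourierFun hα hα' σ (h.cont t ht) (h.conj_neg t ht)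
        (fun k => (h.decay k).imp fun A hA => hA t ht)
      exact ⟨f, fun _ => hf⟩
    · exact ⟨0, fun ht' => absurd ht' ht⟩
  choose u hu using this
  exact ⟨u, hu⟩

theorem _root_.BOZK.HasFourierFun.eq_of_eq {f₁ f₂ : 𝓢'(Plane, ℂ)} {g : Plane → ℂ}
    (h₁ : HasFourierFun f₁ g) (h₂ : HasFourierFun f₂ g) : f₁ = f₂ := by
  ext φ
  rw [h₁.apply_eq, h₂.apply_eq]

theorem exists_isSmoothSolution (h : FourierSolution α T U) (hα : 0 ≤ α) (hα' : α ≤ 2) (s : ℝ)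
    {T₀ : ℝ} (hT₀ : 0 < T₀) (hT : T₀ < T) :
    ∃ u : ℝ → ESpace α s, IsSmoothSolution α s T₀ u ∧
      ∀ t ∈ Icc (-T₀) T₀, HasFourierFun (u t).toDistribution (U t) := by
  have hsub : Icc (-T₀) T₀ ⊆ Ioo (-T) T := fun t ht => ⟨by linarith [ht.1], by linarith [ht.2]⟩
  obtain ⟨u, hu⟩ := h.exists_lift hα hα' s
  refine ⟨u, ⟨h.isSolution hα hα' hT₀ hT fun t ht => hu t (hsub ht), fun σ => ?_⟩,
    fun t ht => hu t (hsub ht)⟩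
  obtain ⟨v, hv⟩ := h.exists_lift hα hα' σ
  exact ⟨v, h.continuousOn_espace hα hα' hsub fun t ht => hv t (hsub ht),
    fun t ht => (hv t (hsub ht)).eq_of_eq (hu t (hsub ht))⟩

end FourierSolution

/-! ### The free evolution and the Duhamel formula -/

/-- The symbol `exp (i t omega)` of the free evolution. -/
def phase (α t : ℝ) (ζ : Plane) : ℂ := Complex.exp (((t * omega α ζ : ℝ) : ℂ) * Complex.I)

theorem norm_phase (α t : ℝ) (ζ : Plane) : ‖phase α t ζ‖ = 1 := Complex.norm_exp_ofReal_mul_I _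

theorem phase_zero (α : ℝ) (ζ : Plane) : phase α 0 ζ = 1 := by simp [phase]

theorem phase_mul (α t t' : ℝ) (ζ : Plane) :
    phase α t ζ * phase α t' ζ = phase α (t + t') ζ := by
  unfold phase
  rw [← Complex.exp_add]
  congr 1
  push_cast
  ring

theorem phase_neg_freq (α t : ℝ) (ζ : Plane) :
    phase α t (-ζ) = starRingEnd ℂ (phase α t ζ) := by
  unfold phase
  rw [← Complex.exp_conj, omega_neg, map_mul, Complex.conj_I, Complex.conj_ofReal]
  congr 1
  push_cast
  ring

theorem continuous_phase {α : ℝ} (hα : 0 ≤ α) {X : Type*} [TopologicalSpace X] {t : X → ℝ}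
    {z : X → Plane} (ht : Continuous t) (hz : Continuous z) :
    Continuous fun x => phase α (t x) (z x) := by
  have := (continuous_omega hα).comp hz
  unfold phase
  fun_prop

theorem hasDerivAt_phase (α t : ℝ) (ζ : Plane) :
    HasDerivAt (fun t => phase α t ζ) (Complex.I * omega α ζ * phase α t ζ) t := by
  have h1 : HasDerivAt (fun t : ℝ => (((t * omega α ζ : ℝ) : ℂ) * Complex.I))
      ((omega α ζ : ℂ) * Complex.I) t := by
    have := ((hasDerivAt_id t).mul_const (omega α ζ)).ofReal_comp.mul_const Complex.I
    simpa using this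
  have := h1.cexp
  unfold phase
  convert this using 1
  ring

/-- The solution of `v_t = i omega v + F`, `v(0) = 0`, on the Fourier side. -/
def duhamel (α : ℝ) (F : ℝ → Plane → ℂ) (t : ℝ) (ζ : Plane) : ℂ :=
  phase α t ζ * ∫ τ in (0 : ℝ)..t, phase α (-τ) ζ * F τ ζ

theorem continuous_duhamel {α : ℝ} (hα : 0 ≤ α) {F : ℝ → Plane → ℂ}
    (hF : Continuous (Function.uncurry F)) : Continuous (Function.uncurry (duhamel α F)) := by
  have h1 : Continuous fun p : ℝ × Plane => phase α p.1 p.2 :=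
    continuous_phase hα continuous_fst continuous_snd
  have h2 : Continuous (Function.uncurry
      fun (p : ℝ × Plane) (τ : ℝ) => phase α (-τ) p.2 * F τ p.2) := by
    have h3 : Continuous fun q : (ℝ × Plane) × ℝ => phase α (-q.2) q.1.2 :=
      continuous_phase hα continuous_snd.neg (continuous_snd.comp continuous_fst)
    have h4 : Continuous fun q : (ℝ × Plane) × ℝ => F q.2 q.1.2 :=
      hF.comp (continuous_snd.prodMk (continuous_snd.comp continuous_fst))
    exact h3.mul h4
  exact h1.mul
    (intervalIntegral.continuous_parametric_intervalIntegral_of_continuous h2 continuous_fst)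

theorem hasDerivAt_duhamel {α : ℝ} (hα : 0 ≤ α) {F : ℝ → Plane → ℂ}
    (hF : Continuous (Function.uncurry F)) (t : ℝ) (ζ : Plane) :
    HasDerivAt (fun t => duhamel α F t ζ)
      (Complex.I * omega α ζ * duhamel α F t ζ + F t ζ) t := by
  have hc : Continuous fun τ : ℝ => phase α (-τ) ζ * F τ ζ :=
    (continuous_phase hα continuous_neg continuous_const).mul
      (hF.comp (continuous_id.prodMk continuous_const))
  have := (hasDerivAt_phase α t ζ).mul (hc.integral_hasStrictDerivAt 0 t).hasDerivAt
  refine this.congr_deriv ?_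
  rw [← mul_assoc (phase α t ζ) (phase α (-t) ζ), phase_mul, add_neg_cancel, phase_zero, one_mul]
  unfold duhamel
  ring

theorem duhamel_neg_freq {α : ℝ} {F : ℝ → Plane → ℂ} {ζ : Plane}
    (hF : ∀ t, F t (-ζ) = starRingEnd ℂ (F t ζ)) (t : ℝ) :
    duhamel α F t (-ζ) = starRingEnd ℂ (duhamel α F t ζ) := by
  unfold duhamel
  rw [map_mul, ← intervalIntegral.intervalIntegral_conj, phase_neg_freq]
  simp_rw [map_mul, phase_neg_freq, hF]

/-- The phases are unimodular, so only the integral of `|τ|^n` remains. The gain `1 / (n + 1)` is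
what later compensates the derivative loss. -/
theorem norm_duhamel_le {α : ℝ} {F : ℝ → Plane → ℂ} {ζ : Plane} {C : ℝ} {n : ℕ}
    (hF : ∀ t, ‖F t ζ‖ ≤ C * |t| ^ n) (t : ℝ) :
    ‖duhamel α F t ζ‖ ≤ C * (|t| ^ (n + 1) / (n + 1)) := by
  unfold duhamel
  rw [norm_mul, norm_phase, one_mul]
  have hi : Continuous fun τ : ℝ => C * |τ| ^ n := by fun_prop
  refine intervalIntegral.norm_integral_le_integral_norm_uIoc.trans ?_
  have e : ∫ τ in uIoc 0 t, C * |τ| ^ n = C * (|t| ^ (n + 1) / (n + 1)) := by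
    rw [integral_const_mul]
    have := integral_pow_abs_sub_uIoc (a := 0) (b := t) n
    simp only [sub_zero] at this
    rw [this]
  rw [← e]
  refine integral_mono_of_nonneg (Eventually.of_forall fun _ => norm_nonneg _) ?_
    (Eventually.of_forall fun τ => ?_)
  · exact intervalIntegrable_iff.mp (hi.intervalIntegrable 0 t)
  · simp only [norm_mul, norm_phase, one_mul]
    exact hF τ

/-- Continuity of the decay constants `a` and `b` in time makes them locally bounded, which provides
the dominating function near each point. -/
theorem continuous_uncurry_conv {V W : ℝ → Plane → ℂ} (hV : Continuous (Function.uncurry V))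
    (hW : Continuous (Function.uncurry W)) {a b : ℝ → ℝ} (ha : Continuous a) (hb : Continuous b)
    (hdV : ∀ t, Decay 0 (a t) (V t)) (hdW : ∀ t, Decay 0 (b t) (W t)) :
    Continuous (Function.uncurry fun t ζ => conv (V t) (W t) ζ) := by
  rw [continuous_iff_continuousAt]
  rintro ⟨t₀, ζ₀⟩
  have hV' : ∀ t, Continuous (V t) := fun t => hV.comp (continuous_const.prodMk continuous_id)
  have hW' : ∀ t, Continuous (W t) := fun t => hW.comp (continuous_const.prodMk continuous_id)
  have e1 : ∀ᶠ p : ℝ × Plane in 𝓝 (t₀, ζ₀), a p.1 < a t₀ + 1 :=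
    (ha.comp continuous_fst).continuousAt.eventually_lt continuousAt_const (by simp)
  have e2 : ∀ᶠ p : ℝ × Plane in 𝓝 (t₀, ζ₀), b p.1 < b t₀ + 1 :=
    (hb.comp continuous_fst).continuousAt.eventually_lt continuousAt_const (by simp)
  refine continuousAt_of_dominated (bound := fun η => ((a t₀ + 1) * maj η) * (b t₀ + 1)) ?_ ?_
    ((integrable_maj.const_mul _).mul_const _) ?_
  · refine Eventually.of_forall fun p => ?_
    have h1 := hV' p.1
    have h2 := hW' p.1
    exact (by fun_prop : Continuous fun η => V p.1 η * W p.1 (p.2 - η)).aestronglyMeasurable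
  · filter_upwards [e1, e2] with p h1 h2
    refine Eventually.of_forall fun η => ?_
    have h3 := (hdV p.1).mono h1.le
    have h4 := (hdW p.1).mono h2.le
    rw [norm_mul]
    exact mul_le_mul (h3.norm_le _) (h4.norm_le_const _) (norm_nonneg _)
      (mul_nonneg h3.nonneg (maj_nonneg _))
  · refine Eventually.of_forall fun η => Continuous.continuousAt ?_
    have h1 : Continuous fun p : ℝ × Plane => V p.1 η :=
      hV.comp (continuous_fst.prodMk continuous_const)
    have h2 : Continuous fun p : ℝ × Plane => W p.1 (p.2 - η) :=
      hW.comp (continuous_fst.prodMk (continuous_snd.sub continuous_const))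
    exact h1.mul h2

theorem conv_eq_zero_of_lt {f g : Plane → ℂ} {a b : ℝ} (hf : ∀ ζ, a < ‖ζ‖ → f ζ = 0)
    (hg : ∀ ζ, b < ‖ζ‖ → g ζ = 0) {ζ : Plane} (hζ : a + b < ‖ζ‖) : conv f g ζ = 0 := by
  unfold conv
  refine integral_eq_zero_of_ae (Eventually.of_forall fun η => ?_)
  have h : ‖ζ‖ ≤ ‖η‖ + ‖ζ - η‖ := by
    calc ‖ζ‖ = ‖η + (ζ - η)‖ := by congr 1; abel
      _ ≤ _ := norm_add_le _ _
  rcases lt_or_ge a ‖η‖ with h1 | h1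
  · simp [hf η h1]
  · simp [hg (ζ - η) (by linarith)]

/-! ### The expansion in powers of the datum -/

/-- The homogeneous terms of the expansion of the solution in powers of the datum, whose Fourier
transform is `h`. -/
def picard (α : ℝ) (h : Plane → ℂ) : ℕ → ℝ → Plane → ℂ
  | 0 => fun t ζ => phase α t ζ * h ζ
  | n + 1 => duhamel α fun τ ζ => (1 / 2) * (Complex.I * xi ζ *
      ∑ i : Fin n.succ, conv (picard α h i τ) (picard α h (n - i) τ) ζ)

theorem picard_zero (α : ℝ) (h : Plane → ℂ) :
    picard α h 0 = fun t ζ => phase α t ζ * h ζ := by rw [picard]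

/-- The source of the equation for the `n + 1`-st term of the expansion. -/
def picardSource (α : ℝ) (h : Plane → ℂ) (n : ℕ) (t : ℝ) (ζ : Plane) : ℂ :=
  (1 / 2) * (Complex.I * xi ζ *
    ∑ p ∈ Finset.HasAntidiagonal.antidiagonal n, conv (picard α h p.1 t) (picard α h p.2 t) ζ)

theorem picard_succ (α : ℝ) (h : Plane → ℂ) (n : ℕ) :
    picard α h (n + 1) = duhamel α (picardSource α h n) := by
  rw [picard]
  congr 1
  funext t ζ
  unfold picardSource
  congr 2
  rw [Finset.Nat.sum_antidiagonal_eq_sum_range_succ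
    (fun x y => conv (picard α h x t) (picard α h y t) ζ) n, Finset.sum_range]

/-- An even, continuous datum of size `B` with Fourier support in the ball of radius `R`. -/
structure NiceDatum (B R : ℝ) (h : Plane → ℂ) : Prop where
  cont : Continuous h
  conj_neg : ∀ ζ, h (-ζ) = starRingEnd ℂ (h ζ)
  decay : Decay 0 B h
  supp : ∀ ζ, R < ‖ζ‖ → h ζ = 0
  nonneg : 0 ≤ R

/-- The growth rate of the terms of the expansion. -/
def growth (B R : ℝ) : ℝ := 7 * R * convConst * B

/-- The size of the `n`-th term of the expansion. -/
def picardBound (B R : ℝ) (n : ℕ) : ℝ := B * growth B R ^ n * catalan n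

/-- The Catalan recursion has exactly the quadratic structure of the nonlinearity. The term of index
`n` is homogeneous of degree `n + 1` in the datum, hence the `n + 1` factors of `B`. -/
theorem picardBound_succ (B R : ℝ) (n : ℕ) : picardBound B R (n + 1) = 7 * R * convConst *
    ∑ p ∈ Finset.HasAntidiagonal.antidiagonal n, picardBound B R p.1 * picardBound B R p.2 := by
  unfold picardBound
  rw [catalan_succ']
  push_cast
  rw [Finset.mul_sum, Finset.mul_sum]
  refine Finset.sum_congr rfl fun p hp => ?_
  have : p.1 + p.2 = n := Finset.HasAntidiagonal.mem_antidiagonal.mp hp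
  rw [← this]
  unfold growth
  ring

theorem catalan_le_four_pow (n : ℕ) : catalan n ≤ 4 ^ n := by
  rw [catalan_eq_centralBinom_div]
  refine (Nat.div_le_self _ _).trans ?_
  rcases Nat.eq_zero_or_pos n with rfl | hn
  · simp
  · exact (Nat.centralBinom_lt_four_pow hn.ne').le

/-- What is known of the `n`-th term of the expansion. -/
structure PicardTerm (α B R : ℝ) (h : Plane → ℂ) (n : ℕ) : Prop where
  cont : Continuous (Function.uncurry (picard α h n))
  conj_neg : ∀ t ζ, picard α h n t (-ζ) = starRingEnd ℂ (picard α h n t ζ)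
  decay : ∀ t, Decay 0 (picardBound B R n * |t| ^ n) (picard α h n t)
  supp : ∀ t ζ, (n + 1) * R < ‖ζ‖ → picard α h n t ζ = 0

theorem fst_le_of_mem_antidiagonal {n : ℕ} {p : ℕ × ℕ}
    (hp : p ∈ Finset.HasAntidiagonal.antidiagonal n) : p.1 ≤ n :=
  (Nat.le_add_right _ _).trans_eq (Finset.HasAntidiagonal.mem_antidiagonal.mp hp)

theorem snd_le_of_mem_antidiagonal {n : ℕ} {p : ℕ × ℕ}
    (hp : p ∈ Finset.HasAntidiagonal.antidiagonal n) : p.2 ≤ n :=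
  (Nat.le_add_left _ _).trans_eq (Finset.HasAntidiagonal.mem_antidiagonal.mp hp)

section Expansion

variable {α B R : ℝ} {h : Plane → ℂ}

theorem continuous_picardSource {n : ℕ} (hp : ∀ m ≤ n, PicardTerm α B R h m) :
    Continuous (Function.uncurry (picardSource α h n)) := by
  have h1 : Continuous fun p : ℝ × Plane => xi p.2 := continuous_xi.comp continuous_snd
  have h2 : Continuous fun q : ℝ × Plane =>
      ∑ p ∈ Finset.HasAntidiagonal.antidiagonal n, conv (picard α h p.1 q.1) (picard α h p.2 q.1) q.2 := by
    refine continuous_finsetSum _ fun p hpn => ?_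
    have h3 := hp p.1 (fst_le_of_mem_antidiagonal hpn)
    have h4 := hp p.2 (snd_le_of_mem_antidiagonal hpn)
    exact continuous_uncurry_conv h3.cont h4.cont (by fun_prop) (by fun_prop) h3.decay h4.decay
  have e : Function.uncurry (picardSource α h n) = fun q : ℝ × Plane => (1 / 2) *
      (Complex.I * xi q.2 *
      ∑ p ∈ Finset.HasAntidiagonal.antidiagonal n, conv (picard α h p.1 q.1) (picard α h p.2 q.1) q.2) := by
    funext q; rfl
  rw [e]
  fun_prop

theorem picardTerm_zero (hα : 0 ≤ α) (hh : NiceDatum B R h) : PicardTerm α B R h 0 := by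
  refine ⟨?_, ?_, ?_, ?_⟩
  · rw [picard_zero]
    exact (continuous_phase hα continuous_fst continuous_snd).mul (hh.cont.comp continuous_snd)
  · intro t ζ
    simp only [picard_zero, map_mul, phase_neg_freq, hh.conj_neg]
  · intro t ζ
    have := hh.decay ζ
    simpa [picard_zero, norm_phase, picardBound] using this
  · intro t ζ hζ
    simp [picard_zero, hh.supp ζ (by simpa using hζ)]

theorem picardSource_eq_zero {n : ℕ} (hp : ∀ m ≤ n, PicardTerm α B R h m) {t : ℝ} {ζ : Plane}
    (hζ : (n + 2) * R < ‖ζ‖) : picardSource α h n t ζ = 0 := by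
  unfold picardSource
  rw [Finset.sum_eq_zero, mul_zero, mul_zero]
  intro p hpn
  refine conv_eq_zero_of_lt ((hp p.1 (fst_le_of_mem_antidiagonal hpn)).supp t)
    ((hp p.2 (snd_le_of_mem_antidiagonal hpn)).supp t) ?_
  have e : p.1 + p.2 = n := Finset.HasAntidiagonal.mem_antidiagonal.mp hpn
  have e' : (p.1 : ℝ) + p.2 = n := by exact_mod_cast e
  calc ((p.1 : ℝ) + 1) * R + (p.2 + 1) * R = (p.1 + p.2 + 2) * R := by ring
    _ < _ := by rw [e']; exact hζ

theorem norm_sum_conv_le {n : ℕ} (hp : ∀ m ≤ n, PicardTerm α B R h m) (t : ℝ) (ζ : Plane) :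
    ‖∑ p ∈ Finset.HasAntidiagonal.antidiagonal n, conv (picard α h p.1 t) (picard α h p.2 t) ζ‖ ≤
      convConst * (∑ p ∈ Finset.HasAntidiagonal.antidiagonal n, picardBound B R p.1 * picardBound B R p.2) *
        |t| ^ n * maj ζ := by
  rw [Finset.mul_sum, Finset.sum_mul, Finset.sum_mul]
  refine norm_sum_le_of_le _ fun p hpn => ?_
  have e : p.1 + p.2 = n := Finset.HasAntidiagonal.mem_antidiagonal.mp hpn
  have := (((hp p.1 (fst_le_of_mem_antidiagonal hpn)).decay t).conv
    ((hp p.2 (snd_le_of_mem_antidiagonal hpn)).decay t)).norm_le ζ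
  refine this.trans_eq ?_
  rw [← e]
  ring

/-- No derivative is lost: the source lives in the ball of radius `(n + 2) R`, where `|ξ| ≤ 7 (n +
2) R`, and the time integral divides by `n + 1`. -/
theorem picardTerm_succ (hα : 0 ≤ α) (hh : NiceDatum B R h) {n : ℕ}
    (hp : ∀ m ≤ n, PicardTerm α B R h m) : PicardTerm α B R h (n + 1) := by
  have hB := hh.decay.nonneg
  have hR := hh.nonneg
  have hK := convConst_nonneg
  refine ⟨?_, ?_, ?_, ?_⟩
  · rw [picard_succ]
    exact continuous_duhamel hα (continuous_picardSource hp)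
  · intro t ζ
    rw [picard_succ]
    refine duhamel_neg_freq (fun τ => ?_) t
    unfold picardSource
    have e : ∀ p ∈ Finset.HasAntidiagonal.antidiagonal n, conv (picard α h p.1 τ) (picard α h p.2 τ) (-ζ) =
        starRingEnd ℂ (conv (picard α h p.1 τ) (picard α h p.2 τ) ζ) := fun p hpn =>
      conv_conj_neg ((hp p.1 (fst_le_of_mem_antidiagonal hpn)).conj_neg τ)
        ((hp p.2 (snd_le_of_mem_antidiagonal hpn)).conj_neg τ) ζ
    rw [Finset.sum_congr rfl e]
    have h2 : starRingEnd ℂ 2 = 2 := Complex.conj_ofNat 2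
    simp [xi_neg, h2]
  · intro t ζ
    set c : ℝ := ∑ p ∈ Finset.HasAntidiagonal.antidiagonal n, picardBound B R p.1 * picardBound B R p.2 with hc
    have hc0 : 0 ≤ c := Finset.sum_nonneg fun p _ => by
      unfold picardBound growth; positivity
    have key : ∀ τ, ‖picardSource α h n τ ζ‖ ≤
        (1 / 2 * (7 * ((n + 2) * R)) * (convConst * c * maj ζ)) * |τ| ^ n := by
      intro τ
      rcases lt_or_ge ((n + 2) * R) ‖ζ‖ with hζ | hζ
      · rw [picardSource_eq_zero hp hζ, norm_zero]
        have := maj_nonneg ζ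
        positivity
      · unfold picardSource
        rw [norm_mul, norm_mul, norm_mul, Complex.norm_I, one_mul, Complex.norm_real,
          Real.norm_eq_abs]
        have h1 : |xi ζ| ≤ 7 * ((n + 2) * R) := (abs_xi_le ζ).trans (by linarith)
        have h2 := norm_sum_conv_le hp τ ζ
        have h3 : ‖(1 / 2 : ℂ)‖ = 1 / 2 := by norm_num
        rw [h3]
        calc 1 / 2 * (|xi ζ| * _) ≤ 1 / 2 * ((7 * ((n + 2) * R)) *
              (convConst * c * |τ| ^ n * maj ζ)) := by gcongr
          _ = _ := by ring
    have := norm_duhamel_le (α := α) key t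
    rw [pow_zero, one_mul, picard_succ]
    refine this.trans ?_
    rw [picardBound_succ, ← hc]
    have hm := maj_nonneg ζ
    have hn : (0 : ℝ) < (n : ℝ) + 1 := by positivity
    -- The factor `2` is absorbed by the `1 / 2` in front of the nonlinearity.
    have h4 : ((n : ℝ) + 2) / (n + 1) ≤ 2 := by rw [div_le_iff₀ hn]; linarith [n.cast_nonneg (α := ℝ)]
    calc _ = ((n + 2) / (n + 1)) * (1 / 2 * (7 * R * convConst * c * |t| ^ (n + 1) * maj ζ)) := by
          ring
      _ ≤ 2 * (1 / 2 * (7 * R * convConst * c * |t| ^ (n + 1) * maj ζ)) := by gcongr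
      _ = _ := by ring
  · intro t ζ hζ
    rw [picard_succ]
    unfold duhamel
    have e : ∀ τ, picardSource α h n τ ζ = 0 := fun τ =>
      picardSource_eq_zero hp (by push_cast at hζ; linarith)
    simp [e]

theorem NiceDatum.picardTerm (hh : NiceDatum B R h) (hα : 0 ≤ α) (n : ℕ) :
    PicardTerm α B R h n := by
  induction n using Nat.strong_induction_on with
  | _ n ih =>
    cases n with
    | zero => exact picardTerm_zero hα hh
    | succ n => exact picardTerm_succ hα hh fun m hm => ih m (by omega)

theorem NiceDatum.hasDerivAt_picard_zero (t : ℝ) (ζ : Plane) :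
    HasDerivAt (fun t => picard α h 0 t ζ) (Complex.I * omega α ζ * picard α h 0 t ζ) t := by
  simp only [picard_zero]
  exact ((hasDerivAt_phase α t ζ).mul_const (h ζ)).congr_deriv (by ring)

theorem NiceDatum.hasDerivAt_picard_succ (hh : NiceDatum B R h) (hα : 0 ≤ α) (n : ℕ) (t : ℝ)
    (ζ : Plane) : HasDerivAt (fun t => picard α h (n + 1) t ζ)
      (Complex.I * omega α ζ * picard α h (n + 1) t ζ + picardSource α h n t ζ) t := by
  rw [picard_succ]
  exact hasDerivAt_duhamel hα (continuous_picardSource fun m _ => hh.picardTerm hα m) t ζ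

/-! ### Convergence of the expansion -/

/-- A summable bound for the terms of the expansion, where `ρ < 1` is the rate of convergence. -/
def termBound (B R ρ : ℝ) (k n : ℕ) : ℝ := B * (1 + (n + 1) * R) ^ k * ρ ^ n

theorem termBound_nonneg {B R ρ : ℝ} (hB : 0 ≤ B) (hR : 0 ≤ R) (hρ : 0 ≤ ρ) (k n : ℕ) :
    0 ≤ termBound B R ρ k n := by
  unfold termBound; positivity

/-- On the Fourier support the weight is at most `(1 + (n + 1) R)^k`, and Catalan numbers are at
most `4^n`; the latter gives the rate `4 * growth B R * T`. -/
theorem NiceDatum.decay_picard (hh : NiceDatum B R h) (hα : 0 ≤ α) {T : ℝ} {t : ℝ}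
    (ht : |t| ≤ T) (k n : ℕ) :
    Decay k (termBound B R (4 * growth B R * T) k n) (picard α h n t) := by
  intro ζ
  have hB := hh.decay.nonneg
  have hR := hh.nonneg
  have hK := convConst_nonneg
  have hT : 0 ≤ T := (abs_nonneg t).trans ht
  have hm := maj_nonneg ζ
  have hg : 0 ≤ growth B R := by unfold growth; positivity
  have hp := hh.picardTerm hα n
  rcases lt_or_ge ((n + 1) * R) ‖ζ‖ with hζ | hζ
  · rw [hp.supp t ζ hζ, norm_zero, mul_zero]
    exact mul_nonneg (termBound_nonneg hB hR (by positivity) _ _) hm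
  · have h1 := (hp.decay t).norm_le ζ
    have h2 : (catalan n : ℝ) ≤ 4 ^ n := by exact_mod_cast catalan_le_four_pow n
    calc (1 + ‖ζ‖) ^ k * ‖picard α h n t ζ‖
        ≤ (1 + (n + 1) * R) ^ k * ((B * growth B R ^ n * 4 ^ n) * T ^ n * maj ζ) := by
          refine mul_le_mul (by gcongr) (h1.trans ?_) (norm_nonneg _) (by positivity)
          unfold picardBound
          gcongr
      _ = _ := by unfold termBound; rw [mul_pow, mul_pow]; ring

theorem summable_poly_geometric (k : ℕ) : Summable fun n : ℕ => ((n : ℝ) + 1) ^ k * (1 / 2) ^ n := by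
  have h := summable_pow_mul_geometric_of_norm_lt_one (R := ℝ) k (r := 1 / 2) (by norm_num)
  have h' := ((summable_nat_add_iff 1).mpr h).mul_left 2
  refine h'.congr fun n => ?_
  push_cast
  rw [pow_succ]
  ring

/-- The first `m` powers of `ρ` are kept and the others are bounded by powers of `1 / 2`. The case
`m = 0` gives summability, and `m = 2` gives the size of the remainder. -/
theorem termBound_add_le {B R ρ : ℝ} (hB : 0 ≤ B) (hR : 0 ≤ R) (hρ : 0 ≤ ρ) (hρ' : ρ ≤ 1 / 2)
    (k m n : ℕ) : termBound B R ρ k (n + m) ≤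
      B * ρ ^ m * (1 + (m + 1) * R) ^ k * (((n : ℝ) + 1) ^ k * (1 / 2) ^ n) := by
  unfold termBound
  have h1 : 1 + (((n + m : ℕ) : ℝ) + 1) * R ≤ (1 + (m + 1) * R) * (n + 1) := by
    push_cast
    have : 0 ≤ (n : ℝ) := n.cast_nonneg
    have : 0 ≤ (n : ℝ) * m * R := by positivity
    nlinarith
  calc B * (1 + (((n + m : ℕ) : ℝ) + 1) * R) ^ k * ρ ^ (n + m)
      ≤ B * ((1 + (m + 1) * R) * (n + 1)) ^ k * ((1 / 2) ^ n * ρ ^ m) := by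
        rw [pow_add]
        gcongr
    _ = _ := by rw [mul_pow]; ring

theorem summable_termBound {B R ρ : ℝ} (hB : 0 ≤ B) (hR : 0 ≤ R) (hρ : 0 ≤ ρ) (hρ' : ρ ≤ 1 / 2)
    (k : ℕ) : Summable (termBound B R ρ k) := by
  refine Summable.of_nonneg_of_le (termBound_nonneg hB hR hρ k)
    (fun n => termBound_add_le hB hR hρ hρ' k 0 n) ((summable_poly_geometric k).mul_left _)

theorem decay_tsum {k : ℕ} {A : ℕ → ℝ} {a : ℕ → Plane → ℂ} (hA : Summable A)
    (ha : ∀ n, Decay k (A n) (a n)) : Decay k (∑' n, A n) (fun ζ => ∑' n, a n ζ) := by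
  intro ζ
  have hp : (0 : ℝ) < (1 + ‖ζ‖) ^ k := by positivity
  have h1 : HasSum (fun n => A n * maj ζ / (1 + ‖ζ‖) ^ k)
      ((∑' n, A n) * maj ζ / (1 + ‖ζ‖) ^ k) := (hA.hasSum.mul_right _).div_const _
  have := tsum_of_norm_bounded h1 (f := fun n => a n ζ) (fun n => by
    rw [le_div_iff₀ hp, mul_comm]; exact ha n ζ)
  rwa [le_div_iff₀ hp, mul_comm] at this

theorem summable_of_decay {k : ℕ} {A : ℕ → ℝ} {a : ℕ → Plane → ℂ} (hA : Summable A)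
    (ha : ∀ n, Decay k (A n) (a n)) (ζ : Plane) : Summable fun n => ‖a n ζ‖ :=
  Summable.of_nonneg_of_le (fun _ => norm_nonneg _) (fun n => (ha n).norm_le_const ζ) hA

/-- A Cauchy product under the integral: the series converge absolutely at each frequency, and a
summable multiple of the majorant allows sum and integral to be exchanged. -/
theorem conv_tsum {A : ℕ → ℝ} {a : ℕ → Plane → ℂ} (hA : Summable A)
    (ha : ∀ n, Decay 0 (A n) (a n)) (hc : ∀ n, Continuous (a n)) (ζ : Plane) :
    conv (fun ζ => ∑' n, a n ζ) (fun ζ => ∑' n, a n ζ) ζ =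
      ∑' n, ∑ p ∈ Finset.HasAntidiagonal.antidiagonal n, conv (a p.1) (a p.2) ζ := by
  have hA0 : ∀ n, 0 ≤ A n := fun n => (ha n).nonneg
  have hi : ∀ i j, Integrable (fun η => a i η * a j (ζ - η)) := fun i j =>
    (ha i).conv_integrable (ha j) (hc i) (hc j) ζ
  have e1 : ∀ η, (∑' n, a n η) * (∑' n, a n (ζ - η)) =
      ∑' n, ∑ p ∈ Finset.HasAntidiagonal.antidiagonal n, a p.1 η * a p.2 (ζ - η) := fun η =>
    tsum_mul_tsum_eq_tsum_sum_antidiagonal_of_summable_norm (summable_of_decay hA ha η)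
      (summable_of_decay hA ha (ζ - η))
  have hS : Summable fun n => ∑ p ∈ Finset.HasAntidiagonal.antidiagonal n, A p.1 * A p.2 :=
    summable_sum_mul_antidiagonal_of_summable_mul (hA.mul_of_nonneg hA hA0 hA0)
  have hb : ∀ n η, ‖∑ p ∈ Finset.HasAntidiagonal.antidiagonal n, a p.1 η * a p.2 (ζ - η)‖ ≤
      (∑ p ∈ Finset.HasAntidiagonal.antidiagonal n, A p.1 * A p.2) * maj η := by
    intro n η
    rw [Finset.sum_mul]
    refine norm_sum_le_of_le _ fun p _ => ?_
    rw [norm_mul]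
    calc ‖a p.1 η‖ * ‖a p.2 (ζ - η)‖ ≤ (A p.1 * maj η) * A p.2 :=
          mul_le_mul ((ha _).norm_le _) ((ha _).norm_le_const _) (norm_nonneg _)
            (mul_nonneg (hA0 _) (maj_nonneg _))
      _ = _ := by ring
  have hI : ∀ n, Integrable fun η => ∑ p ∈ Finset.HasAntidiagonal.antidiagonal n, a p.1 η * a p.2 (ζ - η) :=
    fun n => integrable_finsetSum _ fun p _ => hi _ _
  have hs := hasSum_integral_of_summable_integral_norm hI
    (Summable.of_nonneg_of_le (fun n => integral_nonneg fun _ => norm_nonneg _)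
      (fun n => (integral_mono (hI n).norm (integrable_maj.const_mul _) (hb n)).trans_eq
        (integral_const_mul _ _)) (hS.mul_right (∫ ζ, maj ζ)))
  have e2 : conv (fun ζ => ∑' n, a n ζ) (fun ζ => ∑' n, a n ζ) ζ =
      ∫ η, ∑' n, ∑ p ∈ Finset.HasAntidiagonal.antidiagonal n, a p.1 η * a p.2 (ζ - η) := by
    unfold conv
    exact integral_congr_ae (Eventually.of_forall e1)
  rw [e2, ← hs.tsum_eq]
  refine tsum_congr fun n => ?_
  rw [integral_finsetSum _ fun p _ => hi _ _]
  rfl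

/-- The sum of the expansion. -/
def series (α : ℝ) (h : Plane → ℂ) (t : ℝ) (ζ : Plane) : ℂ := ∑' n, picard α h n t ζ

theorem picard_succ_at_zero (n : ℕ) (ζ : Plane) : picard α h (n + 1) 0 ζ = 0 := by
  rw [picard_succ]; simp [duhamel]

theorem series_at_zero : series α h 0 = h := by
  funext ζ
  unfold series
  rw [tsum_eq_single 0]
  · simp [picard_zero, phase_zero]
  · intro n hn
    obtain ⟨m, rfl⟩ := Nat.exists_eq_succ_of_ne_zero hn
    exact picard_succ_at_zero m ζ

theorem NiceDatum.fourierSolution (hh : NiceDatum B R h) (hα : 0 ≤ α) {T : ℝ}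
    (hT : 0 ≤ T) (hρ' : 4 * growth B R * T ≤ 1 / 2) :
    FourierSolution α T (series α h) := by
  have hB := hh.decay.nonneg
  have hR := hh.nonneg
  have hK := convConst_nonneg
  have hg : 0 ≤ growth B R := by unfold growth; positivity
  set ρ := 4 * growth B R * T with hρdef
  have hρ : 0 ≤ ρ := by positivity
  have habs : ∀ t ∈ Ioo (-T) T, |t| ≤ T := fun t ht => (abs_lt.mpr ht).le
  have hd : ∀ k n, ∀ t ∈ Ioo (-T) T, Decay k (termBound B R ρ k n) (picard α h n t) :=
    fun k n t ht => hh.decay_picard hα (habs t ht) k n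
  have hs : ∀ k, Summable (termBound B R ρ k) := summable_termBound hB hR hρ hρ'
  have hc : ∀ n t, Continuous (picard α h n t) := fun n t =>
    (hh.picardTerm hα n).cont.comp (continuous_const.prodMk continuous_id)
  refine ⟨?_, ?_, ?_, ?_⟩
  · intro t ht
    exact continuous_tsum (fun n => hc n t) (hs 0) fun n ζ => (hd 0 n t ht).norm_le_const ζ
  · intro t ht ζ
    unfold series
    rw [Complex.conj_tsum]
    exact tsum_congr fun n => (hh.picardTerm hα n).conj_neg t ζ
  · intro k
    exact ⟨∑' n, termBound B R ρ k n, fun t ht => decay_tsum (hs k) fun n => hd k n t ht⟩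
  · intro t ht ζ
    set b : ℕ → ℝ := fun n => termBound B R ρ 0 n with hb
    -- The free term has no source, and the source of term `n + 1` has index `n`. Padding with zero
    -- lets one differentiation theorem treat the whole series.
    let src : ℕ → ℝ → ℂ := fun n t => Nat.casesOn n 0 fun m => picardSource α h m t ζ
    let sb : ℕ → ℝ := fun n => Nat.casesOn n 0 fun m =>
      |xi ζ| * (∑ p ∈ Finset.HasAntidiagonal.antidiagonal m, b p.1 * b p.2) * convConst
    have hb0 : ∀ n, 0 ≤ b n := termBound_nonneg hB hR hρ 0
    have hS : Summable fun n => ∑ p ∈ Finset.HasAntidiagonal.antidiagonal n, b p.1 * b p.2 :=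
      summable_sum_mul_antidiagonal_of_summable_mul ((hs 0).mul_of_nonneg (hs 0) hb0 hb0)
    have hsb : Summable sb :=
      (summable_nat_add_iff 1).mp ((hS.mul_left |xi ζ|).mul_right convConst)
    have hder : ∀ n, ∀ y ∈ Ioo (-T) T, HasDerivAt (fun t => picard α h n t ζ)
        (Complex.I * omega α ζ * picard α h n y ζ + src n y) y := by
      intro n y _
      cases n with
      | zero =>
        have := NiceDatum.hasDerivAt_picard_zero (α := α) (h := h) y ζ
        simpa [src] using this
      | succ n => exact hh.hasDerivAt_picard_succ hα n y ζ
    have hsrc : ∀ n, ∀ y ∈ Ioo (-T) T, ‖src n y‖ ≤ sb n := by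
      intro n y hy
      cases n with
      | zero => simp [src, sb]
      | succ n =>
        have h1 : ‖∑ p ∈ Finset.HasAntidiagonal.antidiagonal n, conv (picard α h p.1 y) (picard α h p.2 y) ζ‖ ≤
            (∑ p ∈ Finset.HasAntidiagonal.antidiagonal n, b p.1 * b p.2) * convConst := by
          rw [Finset.sum_mul]
          refine norm_sum_le_of_le _ fun p _ => ?_
          exact ((hd 0 p.1 y hy).conv (hd 0 p.2 y hy)).norm_le_const ζ
        change ‖picardSource α h n y ζ‖ ≤
          |xi ζ| * (∑ p ∈ Finset.HasAntidiagonal.antidiagonal n, b p.1 * b p.2) * convConst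
        unfold picardSource
        rw [norm_mul, norm_mul, norm_mul, Complex.norm_I, one_mul, Complex.norm_real,
          Real.norm_eq_abs]
        have h3 : ‖(1 / 2 : ℂ)‖ = 1 / 2 := by norm_num
        rw [h3]
        have h4 := mul_le_mul_of_nonneg_left h1 (abs_nonneg (xi ζ))
        have h5 : 0 ≤ |xi ζ| *
          ‖∑ p ∈ Finset.HasAntidiagonal.antidiagonal n, conv (picard α h p.1 y) (picard α h p.2 y) ζ‖ := by
          positivity
        linarith
    have hsum : Summable fun n => picard α h n t ζ :=
      (summable_of_decay (hs 0) (fun n => hd 0 n t ht) ζ).of_norm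
    have hsumsrc : Summable fun n => src n t :=
      Summable.of_norm_bounded hsb fun n => hsrc n t ht
    have key := hasDerivAt_tsum_of_isPreconnected
      (u := fun n => |omega α ζ| * b n + sb n) (((hs 0).mul_left _).add hsb)
      isOpen_Ioo isPreconnected_Ioo hder (fun n y hy => by
        refine (norm_add_le _ _).trans (add_le_add ?_ (hsrc n y hy))
        rw [norm_mul, norm_mul, Complex.norm_I, one_mul, Complex.norm_real, Real.norm_eq_abs]
        exact mul_le_mul_of_nonneg_left ((hd 0 n y hy).norm_le_const ζ) (abs_nonneg _))
      ht hsum ht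
    refine key.congr_deriv (Eq.symm ?_)
    rw [(hsum.mul_left _).tsum_add hsumsrc, tsum_mul_left]
    unfold rhs
    congr 1
    rw [hsumsrc.tsum_eq_zero_add]
    change _ = 0 + ∑' n, picardSource α h n t ζ
    unfold picardSource series
    rw [conv_tsum (hs 0) (fun n => hd 0 n t ht) (fun n => hc n t), zero_add, tsum_mul_left,
      tsum_mul_left]

/-- The constant in the bound of the remainder of the expansion after the quadratic term. -/
def remainderConst (R : ℝ) (k : ℕ) : ℝ :=
  (1 + ((2 : ℕ) + 1) * R) ^ k * ∑' n : ℕ, ((n : ℝ) + 1) ^ k * (1 / 2) ^ n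

/-- The constant is cubic in the datum, since `B` and the two factors `growth B R` each scale
linearly. Hence it is of order `ε³` for the datum `ε h`. -/
theorem NiceDatum.decay_remainder (hh : NiceDatum B R h) (hα : 0 ≤ α) {T : ℝ}
    (hT : 0 ≤ T) (hρ' : 4 * growth B R * T ≤ 1 / 2) {t : ℝ} (ht : |t| ≤ T) (k : ℕ) :
    Decay k (B * (4 * growth B R * T) ^ 2 * remainderConst R k)
      (fun ζ => series α h t ζ - (picard α h 0 t ζ + picard α h 1 t ζ)) := by
  have hB := hh.decay.nonneg
  have hR := hh.nonneg
  have hK := convConst_nonneg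
  have hg : 0 ≤ growth B R := by unfold growth; positivity
  set ρ := 4 * growth B R * T with hρdef
  have hρ : 0 ≤ ρ := by positivity
  have e : (fun ζ => series α h t ζ - (picard α h 0 t ζ + picard α h 1 t ζ)) =
      fun ζ => ∑' n, picard α h (n + 2) t ζ := by
    funext ζ
    have hsum : Summable fun n => picard α h n t ζ :=
      (summable_of_decay (summable_termBound hB hR hρ hρ' 0)
        (fun n => hh.decay_picard hα ht 0 n) ζ).of_norm
    unfold series
    rw [← hsum.sum_add_tsum_nat_add 2]
    simp [Finset.sum_range_succ]
  rw [e]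
  have := decay_tsum (k := k) ((summable_poly_geometric k).mul_left
      (B * ρ ^ 2 * (1 + ((2 : ℕ) + 1) * R) ^ k))
    (a := fun n => picard α h (n + 2) t)
    (fun n => (hh.decay_picard hα ht k (n + 2)).mono (termBound_add_le hB hR hρ hρ' k 2 n))
  rw [tsum_mul_left] at this
  unfold remainderConst
  rwa [← mul_assoc]

end Expansion

/-! ### Extraction of the quadratic term from the regularity of the flow -/

/-- The derivative is itself differentiable at `0`, so it differs from its value there by at most `C
‖x‖`; the mean value inequality on the ball of radius `‖x‖` concludes. -/
theorem exists_quadratic_bound_of_contDiffAt {E F : Type*} [NormedAddCommGroup E]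
    [NormedSpace ℝ E] [NormedAddCommGroup F] [NormedSpace ℝ F] {f : E → F}
    (hf : ContDiffAt ℝ 2 f 0) :
    ∃ L : E →L[ℝ] F, ∃ C : ℝ, ∀ᶠ x in 𝓝 0, ‖f x - f 0 - L x‖ ≤ C * ‖x‖ ^ 2 := by
  have h1 : ContDiffAt ℝ 1 (fderiv ℝ f) 0 := hf.fderiv_right (by norm_num)
  obtain ⟨C, hC⟩ := ((h1.differentiableAt one_ne_zero).isBigO_sub).bound
  have h2 : ∀ᶠ x in 𝓝 (0 : E), DifferentiableAt ℝ f x :=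
    (hf.eventually (by simp)).mono fun x hx => hx.differentiableAt two_ne_zero
  obtain ⟨δ, hδ, hball⟩ := Metric.eventually_nhds_iff_ball.mp (hC.and h2)
  refine ⟨fderiv ℝ f 0, C, ?_⟩
  filter_upwards [Metric.ball_mem_nhds 0 hδ] with x hx
  have hsub : Metric.closedBall (0 : E) ‖x‖ ⊆ Metric.ball 0 δ :=
    Metric.closedBall_subset_ball (by simpa using hx)
  have hC0 : 0 ≤ C ∨ x = 0 := by
    by_cases hx0 : x = 0
    · exact Or.inr hx0
    · left
      have := (norm_nonneg _).trans (hball x hx).1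
      rw [sub_zero] at this
      exact nonneg_of_mul_nonneg_left this (norm_pos_iff.mpr hx0)
  rcases hC0 with hC0 | rfl
  · have := (convex_closedBall (0 : E) ‖x‖).norm_image_sub_le_of_norm_hasFDerivWithin_le'
      (f := f) (f' := fderiv ℝ f) (φ := fderiv ℝ f 0) (C := C * ‖x‖) (x := 0) (y := x)
      (fun y hy => (hball y (hsub hy)).2.hasFDerivAt.hasFDerivWithinAt)
      (fun y hy => (hball y (hsub hy)).1.trans (by
        rw [sub_zero]
        exact mul_le_mul_of_nonneg_left (by simpa using hy) hC0))
      (by simp) (by simp)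
    rw [sub_zero] at this
    calc _ ≤ C * ‖x‖ * ‖x‖ := this
      _ = _ := by ring
  · simp

/-- Letting `ε` tend to zero kills `c`; dividing by `ε`, then by `ε²`, kills `e` and bounds `b`.
Neither the flow of the zero datum nor the derivative of the flow has to be identified beforehand.
-/
theorem norm_le_of_expansion {E : Type*} [NormedAddCommGroup E] [NormedSpace ℝ E] {c e b : E}
    {P K : ℝ}
    (h : ∀ᶠ ε : ℝ in 𝓝[>] 0, ‖c + ε • e + ε ^ 2 • b‖ ≤ P * ε ^ 2 + K * ε ^ 3) : ‖b‖ ≤ P := by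
  have lim : ∀ {f : ℝ → E} {g : ℝ → ℝ}, Continuous f → Continuous g →
      (∀ᶠ ε : ℝ in 𝓝[>] 0, ‖f ε‖ ≤ g ε) → ‖f 0‖ ≤ g 0 := by
    intro f g hf hg hfg
    exact le_of_tendsto_of_tendsto ((hf.norm.tendsto 0).mono_left nhdsWithin_le_nhds)
      ((hg.tendsto 0).mono_left nhdsWithin_le_nhds) hfg
  have hc : c = 0 := by
    have := lim (f := fun ε => c + ε • e + ε ^ 2 • b) (g := fun ε => P * ε ^ 2 + K * ε ^ 3)
      (by fun_prop) (by fun_prop) h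
    simpa using this
  have he : e = 0 := by
    have := lim (f := fun ε => e + ε • b) (g := fun ε => P * ε + K * ε ^ 2)
      (by fun_prop) (by fun_prop) (by
        filter_upwards [h, self_mem_nhdsWithin] with ε hε hpos
        have hpos' : (0 : ℝ) < ε := hpos
        have e1 : c + ε • e + ε ^ 2 • b = ε • (e + ε • b) := by
          rw [hc, zero_add, smul_add, smul_smul, sq]
        rw [e1, norm_smul, Real.norm_eq_abs, abs_of_pos hpos'] at hε
        refine le_of_mul_le_mul_left ?_ hpos'
        linarith)
    simpa using this
  have := lim (f := fun _ => b) (g := fun ε => P + K * ε)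
    (by fun_prop) (by fun_prop) (by
      filter_upwards [h, self_mem_nhdsWithin] with ε hε hpos
      have hpos' : (0 : ℝ) < ε ^ 2 := pow_pos hpos 2
      have e1 : c + ε • e + ε ^ 2 • b = ε ^ 2 • b := by simp [hc, he]
      rw [e1, norm_smul, Real.norm_eq_abs, abs_of_pos hpos'] at hε
      refine le_of_mul_le_mul_left ?_ hpos'
      linarith)
  simpa using this

theorem ESpace.ext_of_hasFourierFun {α s : ℝ} {f₁ f₂ : ESpace α s} {g : Plane → ℂ}
    (h₁ : HasFourierFun f₁.toDistribution g) (h₂ : HasFourierFun f₂.toDistribution g) :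
    f₁ = f₂ := Subtype.ext (h₁.eq_of_eq h₂)

theorem ESpace.hasFourierFun_add {α s : ℝ} {f₁ f₂ : ESpace α s} {g₁ g₂ : Plane → ℂ}
    (h₁ : HasFourierFun f₁.toDistribution g₁) (h₂ : HasFourierFun f₂.toDistribution g₂) :
    HasFourierFun (f₁ + f₂).toDistribution (g₁ + g₂) := by
  rw [map_add]; exact h₁.add h₂

theorem ESpace.hasFourierFun_smul {α s : ℝ} {f : ESpace α s} {g : Plane → ℂ} (c : ℝ)
    (h : HasFourierFun f.toDistribution g) :
    HasFourierFun (c • f).toDistribution (c • g) := by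
  rw [map_smul]; exact h.smul c

theorem NiceDatum.smul {B R : ℝ} {h : Plane → ℂ} (hh : NiceDatum B R h) {c : ℝ} (hc : 0 ≤ c) :
    NiceDatum (c * B) R (c • h) := by
  refine ⟨hh.cont.const_smul c, fun ζ => ?_, fun ζ => ?_, fun ζ hζ => ?_, hh.nonneg⟩
  · simp [hh.conj_neg]
  · have := hh.decay ζ
    simp only [Pi.smul_apply, norm_smul, Real.norm_eq_abs, abs_of_nonneg hc, pow_zero, one_mul]
      at this ⊢
    rw [mul_assoc]
    exact mul_le_mul_of_nonneg_left this hc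
  · simp [hh.supp ζ hζ]

theorem conv_smul_smul (c d : ℝ) (f g : Plane → ℂ) (ζ : Plane) :
    conv (c • f) (d • g) ζ = ((c * d : ℝ) : ℂ) * conv f g ζ := by
  unfold conv
  rw [← integral_const_mul]
  congr 1
  funext η
  simp
  ring

theorem picard_zero_smul (α : ℝ) (h : Plane → ℂ) (c t : ℝ) :
    picard α (c • h) 0 t = c • picard α h 0 t := by
  funext ζ
  simp only [picard_zero, Pi.smul_apply, Complex.real_smul]
  ring

theorem picard_one (α : ℝ) (h : Plane → ℂ) :
    picard α h 1 = duhamel α fun t ζ => (1 / 2) * (Complex.I * xi ζ *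
      conv (picard α h 0 t) (picard α h 0 t) ζ) := by
  rw [picard_succ]
  congr 1
  funext t ζ
  unfold picardSource
  simp

theorem picard_one_smul (α : ℝ) (h : Plane → ℂ) (c t : ℝ) :
    picard α (c • h) 1 t = c ^ 2 • picard α h 1 t := by
  funext ζ
  simp only [picard_one, Pi.smul_apply, Complex.real_smul, picard_zero_smul, duhamel]
  rw [mul_left_comm, ← intervalIntegral.integral_const_mul ((c ^ 2 : ℝ) : ℂ)]
  congr 1
  refine intervalIntegral.integral_congr fun τ _ => ?_
  rw [conv_smul_smul]
  push_cast
  ring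

theorem NiceDatum.exists_hasFourierFun_picard {α B R : ℝ} {h : Plane → ℂ} (hh : NiceDatum B R h)
    (hα : 0 ≤ α) (hα' : α ≤ 2) (s t : ℝ) (n : ℕ) :
    ∃ a : ESpace α s, HasFourierFun a.toDistribution (picard α h n t) := by
  have hp := hh.picardTerm hα n
  exact exists_hasFourierFun hα hα' s (hp.cont.comp (continuous_const.prodMk continuous_id))
    (hp.conj_neg t) fun k => ⟨_, hh.decay_picard hα le_rfl k n⟩

/-- If the flow map is twice differentiable at the origin at the time `t`, then the quadratic term
of the expansion is bounded by the square of the norm of the datum. -/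
theorem exists_norm_picard_one_le {s α : ℝ} (hα : 0 ≤ α) (hα' : α ≤ 2) {T : ℝ} (hT : 0 < T)
    {X : Set (ℝ → ESpace α s)} {U : Set (ESpace α s)} (hU : U ∈ 𝓝 0)
    {S : ESpace α s → ℝ → ESpace α s}
    (hX : ∀ u, IsSmoothSolution α s T u → u ∈ X)
    (hS : ∀ u₀ ∈ U, ∀ v ∈ X, IsSolution α s T v → v 0 = u₀ → EqOn v (S u₀) (Icc (-T) T))
    {t : ℝ} (ht : t ∈ Icc (-T) T) (hC2 : ContDiffAt ℝ 2 (fun u₀ => S u₀ t) 0) :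
    ∃ C : ℝ, ∀ (B R : ℝ) (h : Plane → ℂ) (f b : ESpace α s), NiceDatum B R h →
      HasFourierFun f.toDistribution h → HasFourierFun b.toDistribution (picard α h 1 t) →
      ‖b‖ ≤ C * ‖f‖ ^ 2 := by
  obtain ⟨L, C, hLC⟩ := exists_quadratic_bound_of_contDiffAt hC2
  refine ⟨C, fun B R h f b hh hf hb => ?_⟩
  obtain ⟨a, ha⟩ := hh.exists_hasFourierFun_picard hα hα' s t 0
  obtain ⟨W, k, hW, hw⟩ := exists_weight_le hα hα' s
  have htend : Tendsto (fun ε : ℝ => ε • f) (𝓝[>] 0) (𝓝 0) := by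
    have : Continuous fun ε : ℝ => ε • f := by fun_prop
    simpa using (this.tendsto 0).mono_left nhdsWithin_le_nhds
  -- Only the range of `ε` depends on the size and the support of the datum; the constant `C` was
  -- fixed before the datum.
  have hsmall : ∀ᶠ ε : ℝ in 𝓝[>] 0, 4 * growth (ε * B) R * (T + 1) < 1 / 2 := by
    have : Continuous fun ε : ℝ => 4 * growth (ε * B) R * (T + 1) := by unfold growth; fun_prop
    refine nhdsWithin_le_nhds (this.continuousAt.eventually_lt continuousAt_const ?_)
    simp [growth]
  have habs : |t| ≤ T + 1 := (abs_le.mpr ht).trans (by linarith)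
  refine norm_le_of_expansion (c := -S 0 t) (e := a - L f)
    (K := W * (B * (4 * growth B R * (T + 1)) ^ 2 * remainderConst R k) * majNorm) ?_
  filter_upwards [htend.eventually hLC, htend.eventually hU, hsmall, self_mem_nhdsWithin]
    with ε h1 h2 h3 hpos
  have hpos' : (0 : ℝ) < ε := hpos
  have hd := hh.smul hpos'.le
  -- The margin `1` makes the closed interval `[-T, T]` interior to the time interval of the series.
  have hsol := hd.fourierSolution hα (T := T + 1) (by linarith) h3.le
  obtain ⟨u, hu, hu'⟩ := hsol.exists_isSmoothSolution hα hα' s hT (by linarith)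
  have hu0 : u 0 = ε • f := by
    refine ESpace.ext_of_hasFourierFun (hu' 0 ⟨by linarith, hT.le⟩) ?_
    rw [series_at_zero]
    exact ESpace.hasFourierFun_smul ε hf
  have hut : u t = S (ε • f) t := hS _ h2 u (hX u hu) hu.1 hu0 ht
  have hrem : ‖u t + (-1 : ℝ) • (ε • a + ε ^ 2 • b)‖ ≤
      W * (ε * B * (4 * growth (ε * B) R * (T + 1)) ^ 2 * remainderConst R k) * majNorm := by
    refine norm_le_of_decay hW hw (ESpace.hasFourierFun_add (hu' t ht)
      (ESpace.hasFourierFun_smul (-1) (ESpace.hasFourierFun_add (ESpace.hasFourierFun_smul ε ha)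
      (ESpace.hasFourierFun_smul (ε ^ 2) hb)))) ?_
    have := hd.decay_remainder hα (T := T + 1) (by linarith) h3.le habs k
    rw [picard_zero_smul, picard_one_smul] at this
    convert this using 1
    funext ζ
    simp
    ring
  have e1 : W * (ε * B * (4 * growth (ε * B) R * (T + 1)) ^ 2 * remainderConst R k) * majNorm =
      W * (B * (4 * growth B R * (T + 1)) ^ 2 * remainderConst R k) * majNorm * ε ^ 3 := by
    unfold growth; ring
  rw [e1] at hrem
  rw [norm_smul, Real.norm_eq_abs, abs_of_pos hpos', ← hut] at h1
  have e2 : -S 0 t + ε • (a - L f) + ε ^ 2 • b =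
      (u t - S 0 t - L (ε • f)) - (u t + (-1 : ℝ) • (ε • a + ε ^ 2 • b)) := by
    rw [map_smul]
    module
  rw [e2]
  refine (norm_sub_le _ _).trans (add_le_add (h1.trans_eq (by ring)) hrem)

/-! ### The resonance -/

theorem abs_le_of_abs_deriv_le {f f' : ℝ → ℝ} {r C : ℝ} {k : ℕ} (hC : 0 ≤ C) (h0 : f 0 = 0)
    (hf : ∀ y, |y| ≤ r → HasDerivAt f (f' y) y) (hf' : ∀ y, |y| ≤ r → |f' y| ≤ C * |y| ^ k)
    {x : ℝ} (hx : |x| ≤ r) : |f x| ≤ C * |x| ^ (k + 1) := by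
  have hmem : ∀ y ∈ Icc (-|x|) |x|, |y| ≤ |x| := fun y hy => abs_le.mpr hy
  have := (convex_Icc (-|x|) |x|).norm_image_sub_le_of_norm_hasDerivWithin_le
    (f := f) (f' := f') (C := C * |x| ^ k) (x := 0) (y := x)
    (fun y hy => (hf y ((hmem y hy).trans hx)).hasDerivWithinAt)
    (fun y hy => (hf' y ((hmem y hy).trans hx)).trans (by
      have := hmem y hy
      gcongr))
    (by simp) ⟨neg_abs_le x, le_abs_self x⟩
  rw [h0, sub_zero, sub_zero, Real.norm_eq_abs, Real.norm_eq_abs] at this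
  rw [pow_succ]
  linarith

theorem abs_one_add_rpow_sub_one_le {r y : ℝ} (hr : 0 ≤ r) (hr' : r ≤ 1) (hy : -1 < y) :
    |(1 + y) ^ r - 1| ≤ |y| := by
  rcases le_total 0 y with h | h
  · have h1 : 1 ≤ (1 + y) ^ r := Real.one_le_rpow (by linarith) hr
    have h2 : (1 + y) ^ r ≤ (1 + y) ^ (1 : ℝ) :=
      Real.rpow_le_rpow_of_exponent_le (by linarith) hr'
    rw [Real.rpow_one] at h2
    rw [abs_of_nonneg (by linarith), abs_of_nonneg h]
    linarith
  · have h1 : (1 + y) ^ r ≤ 1 := Real.rpow_le_one (by linarith) (by linarith) hr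
    have h2 : (1 + y) ^ (1 : ℝ) ≤ (1 + y) ^ r :=
      Real.rpow_le_rpow_of_exponent_ge (by linarith) (by linarith) hr'
    rw [Real.rpow_one] at h2
    rw [abs_of_nonpos (by linarith), abs_of_nonpos h]
    linarith

theorem hasDerivAt_one_add_rpow {q y : ℝ} (hy : -1 < y) :
    HasDerivAt (fun y : ℝ => (1 + y) ^ q) (q * (1 + y) ^ (q - 1)) y := by
  have := ((hasDerivAt_id y).const_add 1).rpow_const (p := q) (Or.inl (by simp; linarith))
  simpa using this

/-- Two integrations of the bound on `(1 + y)^(α - 1) - 1`, whose exponent lies in `[0, 1]`. The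
factors `α ≤ 2` and `α + 1 ≤ 3` produce the `6`. -/
theorem abs_one_add_rpow_taylor_le {α x : ℝ} (hα : 1 ≤ α) (hα' : α ≤ 2) (hx : |x| ≤ 1 / 2) :
    |(1 + x) ^ (α + 1) - (1 + (α + 1) * x + α * (α + 1) / 2 * x ^ 2)| ≤ 6 * |x| ^ 3 := by
  have hlt : ∀ y : ℝ, |y| ≤ 1 / 2 → -1 < y := fun y hy => by linarith [neg_abs_le y]
  have h1 : ∀ y : ℝ, |y| ≤ 1 / 2 → |(1 + y) ^ α - (1 + α * y)| ≤ 2 * |y| ^ (1 + 1) := by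
    intro y hy
    refine abs_le_of_abs_deriv_le (f := fun y => (1 + y) ^ α - (1 + α * y))
      (f' := fun y => α * (1 + y) ^ (α - 1) - α) (by norm_num) (by simp) (fun z hz => ?_)
      (fun z hz => ?_) hy
    · refine (hasDerivAt_one_add_rpow (hlt z hz)).sub ?_
      simpa using ((hasDerivAt_id z).const_mul α).const_add 1
    · have := abs_one_add_rpow_sub_one_le (r := α - 1) (by linarith) (by linarith) (hlt z hz)
      have e : α * (1 + z) ^ (α - 1) - α = α * ((1 + z) ^ (α - 1) - 1) := by ring
      rw [e, abs_mul, abs_of_nonneg (by linarith), pow_one]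
      exact mul_le_mul hα' this (abs_nonneg _) (by norm_num)
  refine abs_le_of_abs_deriv_le (k := 2)
    (f := fun x => (1 + x) ^ (α + 1) - (1 + (α + 1) * x + α * (α + 1) / 2 * x ^ 2))
    (f' := fun y => (α + 1) * (1 + y) ^ α - ((α + 1) + α * (α + 1) * y)) (by norm_num)
    (by simp) (fun z hz => ?_) (fun z hz => ?_) hx
  · have h2 := hasDerivAt_one_add_rpow (q := α + 1) (hlt z hz)
    rw [add_sub_cancel_right] at h2
    refine h2.sub ?_
    have h3 := (((hasDerivAt_id z).const_mul (α + 1)).const_add 1).add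
      ((hasDerivAt_pow 2 z).const_mul (α * (α + 1) / 2))
    refine h3.congr_deriv ?_
    simp
    ring
  · have e : (α + 1) * (1 + z) ^ α - ((α + 1) + α * (α + 1) * z) =
        (α + 1) * ((1 + z) ^ α - (1 + α * z)) := by ring
    rw [e, abs_mul, abs_of_nonneg (by linarith)]
    calc (α + 1) * _ ≤ 3 * (2 * |z| ^ 2) :=
          mul_le_mul (by linarith) (h1 z hz) (abs_nonneg _) (by norm_num)
      _ = _ := by ring

/-- The slopes for which the dispersion relation is affine up to second order along a line. -/
theorem exists_slopes {α : ℝ} (hα : 1 ≤ α) (hα' : α < 2) : ∃ m l : ℝ, 0 < m ∧ 0 < l ∧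
    l ^ 2 - 2 * l * m + α * (α + 1) / 2 = 0 ∧ m ^ 2 - 2 * l * m + (α + 1) = 0 := by
  set A := α * (α + 1) / 2 with hA
  set B := α + 1 with hB
  have hA0 : 0 < A := by positivity
  have hAB : 0 < 2 * B - A := by rw [hA, hB]; nlinarith
  set D := Real.sqrt ((A - 2 * B) ^ 2 + 3 * A ^ 2) with hD
  have hD2 : D ^ 2 = (A - 2 * B) ^ 2 + 3 * A ^ 2 := Real.sq_sqrt (by positivity)
  have hD0 : 0 ≤ D := Real.sqrt_nonneg _
  -- Solving the first equation for `m` gives `m = (l² + A) / (2 l)`, and inserting it in the second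
  -- gives a quadratic equation for `L = l²`. This is its positive root.
  set L := (2 * B - A + D) / 3 with hL
  have hL0 : 0 < L := by rw [hL]; positivity
  have hLq : 3 * L ^ 2 + (2 * A - 4 * B) * L - A ^ 2 = 0 := by
    rw [hL]; linear_combination (1 / 3) * hD2
  have hl0 : 0 < Real.sqrt L := Real.sqrt_pos.mpr hL0
  have hl2 : Real.sqrt L ^ 2 = L := Real.sq_sqrt hL0.le
  have hlm : 2 * Real.sqrt L * ((L + A) / (2 * Real.sqrt L)) = L + A := by field_simp
  refine ⟨(L + A) / (2 * Real.sqrt L), Real.sqrt L, by positivity, hl0, ?_, ?_⟩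
  · rw [hlm, hl2]; ring
  · rw [hlm, div_pow, mul_pow, hl2]
    field_simp
    linear_combination (-1 : ℝ) * hLq

/-- The parameters of the counterexample: a packet at frequency `(N, m P)`, `P² = N^α`,
of size `γ` along the direction `(1, - l P / N)` and `c / (N P)` across it. -/
structure Packet (α : ℝ) where
  (m l γ c N P : ℝ)
  m_pos : 0 < m
  l_pos : 0 < l
  quadratic : l ^ 2 - 2 * l * m + α * (α + 1) / 2 = 0
  linear : m ^ 2 - 2 * l * m + (α + 1) = 0
  γ_pos : 0 < γ
  γ_eq : γ * (1 + (1 + l) ^ 2) = 1 / 4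
  c_pos : 0 < c
  c_eq : c * (2 * (m + l) + 1) = 1 / 64
  N_large : 10 ≤ N
  P_sq : P ^ 2 = N ^ α
  one_le_P : 1 ≤ P
  P_le : P ≤ N
  P_small : (6 + l ^ 2) * (P / N) ^ 2 ≤ 1 / 8

namespace Packet

variable {α : ℝ} (p : Packet α)

/-- The slope of the direction of the packet. -/
def slope : ℝ := p.l * p.P / p.N

/-- The width of the packet. -/
def width : ℝ := p.c / (p.N * p.P)

/-- The linear coordinate across the packet. -/
def across (ζ : Plane) : ℝ := mu ζ + p.slope * xi ζ

/-- The value of `across` at the centre of the packet. -/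
def center : ℝ := (p.m + p.l) * p.P

theorem N_pos : 0 < p.N := by linarith [p.N_large]

theorem P_pos : 0 < p.P := by linarith [p.one_le_P]

theorem slope_pos : 0 < p.slope := by
  have := p.l_pos; have := p.N_pos; have := p.P_pos
  unfold slope; positivity

theorem slope_le : p.slope ≤ p.l := by
  unfold slope
  rw [div_le_iff₀ p.N_pos]
  exact mul_le_mul_of_nonneg_left p.P_le p.l_pos.le

theorem width_pos : 0 < p.width := by
  have := p.c_pos; have := p.N_pos; have := p.P_pos
  unfold width; positivity

theorem c_le : p.c ≤ 1 / 64 := by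
  have := p.c_eq; have := p.c_pos; have := p.m_pos; have := p.l_pos
  nlinarith [mul_pos p.c_pos p.m_pos, mul_pos p.c_pos p.l_pos]

theorem width_le : p.width ≤ 1 / 64 := by
  unfold width
  have h1 : 1 ≤ p.N * p.P := by nlinarith [p.N_large, p.one_le_P]
  exact (div_le_self p.c_pos.le h1).trans p.c_le

theorem γ_le : p.γ ≤ 1 / 8 := by
  have := p.γ_eq; have := p.γ_pos; have := p.l_pos
  nlinarith [mul_pos p.γ_pos p.l_pos, mul_pos (mul_pos p.γ_pos p.l_pos) p.l_pos]

theorem mu_eq (ζ : Plane) : mu ζ = p.across ζ - p.slope * xi ζ := by unfold across; ring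

theorem slope_mul_N : p.slope * p.N = p.l * p.P := by
  have := p.N_pos
  unfold slope; field_simp

theorem xi_rpow {ζ : Plane} {b : ℝ} (hb : |b| ≤ p.N / 2) (hζ : xi ζ = p.N + b) :
    |xi ζ| ^ α = p.P ^ 2 * (1 + b / p.N) ^ α := by
  have hN := p.N_pos
  have hx : |b / p.N| ≤ 1 / 2 := by
    rw [abs_div, abs_of_pos hN, div_le_iff₀ hN]; linarith
  have h1 : 0 < 1 + b / p.N := by linarith [neg_abs_le (b / p.N)]
  have e : xi ζ = p.N * (1 + b / p.N) := by rw [hζ]; field_simp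
  rw [e, abs_of_pos (mul_pos hN h1), Real.mul_rpow hN.le h1.le, p.P_sq]

/-- With `x = (ξ - N) / N`, the relations `quadratic` and `linear` cancel the `x²` and `x` terms of
`ω`. The cubic remainder is at most `1/8` by `P_small`, and the displacement across the packet costs
at most `1/8` by the choice of `c`. -/
theorem abs_omega_sub_le (hα : 1 ≤ α) (hα' : α ≤ 2) {ζ : Plane} (hξ : |xi ζ - p.N| ≤ 4 * p.γ)
    (hη : |p.across ζ - p.center| ≤ 4 * p.width) :
    |omega α ζ - p.N * p.P ^ 2 * (1 + p.m ^ 2)| ≤ 1 / 4 := by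
  have hN := p.N_pos
  have hP := p.P_pos
  set b := xi ζ - p.N with hb
  set e := p.across ζ - p.center with he
  have hb1 : |b| ≤ 1 / 2 := by linarith [p.γ_le]
  have he1 : |e| ≤ 1 := by linarith [p.width_le]
  set x := b / p.N with hx
  have hbx : b = p.N * x := by rw [hx]; field_simp
  have hξb : xi ζ = p.N + b := by rw [hb]; ring
  have hx1 : |x| ≤ 1 / 2 := by
    rw [hx, abs_div, abs_of_pos hN, div_le_iff₀ hN]
    linarith [p.N_large]
  have hx0 : 0 < 1 + x := by linarith [neg_abs_le x]
  have hmu : mu ζ = p.P * (p.m - p.l * x) + e := by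
    have h1 := p.slope_mul_N
    rw [p.mu_eq ζ, hξb, he, hbx]
    unfold center
    linear_combination (-(1 + x)) * h1
  set r := (1 + x) ^ (α + 1) - (1 + (α + 1) * x + α * (α + 1) / 2 * x ^ 2) with hr
  have hrb : |r| ≤ 6 * |x| ^ 3 := abs_one_add_rpow_taylor_le hα hα' hx1
  have hpow : (1 + x) ^ (α + 1) = (1 + x) ^ α * (1 + x) := Real.rpow_add_one hx0.ne' α
  have hom : omega α ζ - p.N * p.P ^ 2 * (1 + p.m ^ 2) =
      p.N * p.P ^ 2 * (p.l ^ 2 * x ^ 3 + r) +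
      (p.N + b) * (2 * (p.P * (p.m - p.l * x)) + e) * e := by
    unfold omega rho
    rw [p.xi_rpow (by linarith [p.N_large]) hξb, hmu, hr, hpow, hξb, ← hx, hbx]
    have h1 := p.quadratic
    have h2 := p.linear
    linear_combination (p.N * p.P ^ 2 * x ^ 2) * h1 + (p.N * p.P ^ 2 * x) * h2
  have t1 : |p.N * p.P ^ 2 * (p.l ^ 2 * x ^ 3 + r)| ≤ 1 / 8 := by
    have h3 : |p.l ^ 2 * x ^ 3 + r| ≤ (6 + p.l ^ 2) * |x| ^ 3 := by
      refine (abs_add_le _ _).trans ?_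
      rw [abs_mul, abs_pow x 3, abs_of_nonneg (sq_nonneg p.l)]
      linarith
    have h4 : |x| = |b| / p.N := by rw [hx, abs_div, abs_of_pos hN]
    rw [abs_mul, abs_of_pos (by positivity : 0 < p.N * p.P ^ 2)]
    have h5 : |b| ^ 3 ≤ 1 := pow_le_one₀ (abs_nonneg _) (by linarith)
    have hl := p.l_pos
    calc p.N * p.P ^ 2 * |p.l ^ 2 * x ^ 3 + r|
        ≤ p.N * p.P ^ 2 * ((6 + p.l ^ 2) * |x| ^ 3) := by gcongr
      _ = (6 + p.l ^ 2) * (p.P / p.N) ^ 2 * |b| ^ 3 := by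
          rw [h4]; field_simp
      _ ≤ (6 + p.l ^ 2) * (p.P / p.N) ^ 2 * 1 := by gcongr
      _ ≤ 1 / 8 := by linarith [p.P_small]
  have t2 : |(p.N + b) * (2 * (p.P * (p.m - p.l * x)) + e) * e| ≤ 1 / 8 := by
    have hm := p.m_pos
    have hl := p.l_pos
    have hc := p.c_pos
    have a1 : |p.N + b| ≤ 2 * p.N := by
      refine (abs_add_le _ _).trans ?_
      rw [abs_of_pos hN]; linarith [p.N_large]
    have a2 : |2 * (p.P * (p.m - p.l * x)) + e| ≤ p.P * (2 * (p.m + p.l) + 1) := by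
      have a3 : |p.m - p.l * x| ≤ p.m + p.l := by
        refine (abs_sub _ _).trans ?_
        rw [abs_of_pos hm, abs_mul, abs_of_pos hl]
        nlinarith
      refine (abs_add_le _ _).trans ?_
      rw [abs_mul, abs_mul, abs_of_pos hP, abs_two]
      nlinarith [p.one_le_P, mul_le_mul_of_nonneg_left a3 hP.le]
    rw [abs_mul, abs_mul]
    calc |p.N + b| * |2 * (p.P * (p.m - p.l * x)) + e| * |e|
        ≤ 2 * p.N * (p.P * (2 * (p.m + p.l) + 1)) * (4 * (p.c / (p.N * p.P))) := by
          have : |e| ≤ 4 * (p.c / (p.N * p.P)) := hη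
          gcongr
      _ = 8 * (p.c * (2 * (p.m + p.l) + 1)) := by field_simp; ring
      _ = 1 / 8 := by rw [p.c_eq]; norm_num
  rw [hom]
  refine (abs_add_le _ _).trans ?_
  linarith

theorem rho_low_le (hα : 1 ≤ α) {ζ : Plane} (hξ : |xi ζ| ≤ 2 * p.γ)
    (hη : |p.across ζ| ≤ 2 * p.width) : rho α ζ ≤ 1 + (1 + p.l) ^ 2 := by
  have hl := p.l_pos
  have hξ1 : |xi ζ| ≤ 1 := by linarith [p.γ_le]
  have h1 : |xi ζ| ^ α ≤ 1 := Real.rpow_le_one (abs_nonneg _) hξ1 (by linarith)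
  have h2 : |mu ζ| ≤ 1 + p.l := by
    rw [p.mu_eq ζ]
    refine (abs_sub _ _).trans ?_
    rw [abs_mul, abs_of_pos p.slope_pos]
    have := mul_le_mul p.slope_le hξ1 (abs_nonneg _) hl.le
    linarith [p.width_le]
  have h3 : mu ζ ^ 2 ≤ (1 + p.l) ^ 2 := by
    rw [← sq_abs]; exact pow_le_pow_left₀ (abs_nonneg _) h2 2
  unfold rho
  linarith

/-- At low frequency `ω` is small only through the factor `ξ`; this is what fixes `γ`. -/
theorem abs_omega_low_le (hα : 1 ≤ α) {ζ : Plane} (hξ : |xi ζ| ≤ 2 * p.γ)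
    (hη : |p.across ζ| ≤ 2 * p.width) : |omega α ζ| ≤ 1 / 2 := by
  unfold omega
  rw [abs_mul, abs_of_nonneg (rho_nonneg α ζ)]
  have h1 := p.rho_low_le hα hξ hη
  have h2 := mul_le_mul hξ h1 (rho_nonneg α ζ) (by linarith [p.γ_pos])
  linarith [p.γ_eq]

theorem rho_high (hα : 1 ≤ α) (hα' : α ≤ 2) {ζ : Plane} (hξ : |xi ζ - p.N| ≤ 4 * p.γ)
    (hη : |p.across ζ - p.center| ≤ 4 * p.width) :
    p.P ^ 2 * (1 / 4) ≤ rho α ζ ∧ rho α ζ ≤ p.P ^ 2 * (4 + (p.m + p.l + 1) ^ 2) := by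
  have hN := p.N_pos
  have hP := p.P_pos
  have hm := p.m_pos
  have hl := p.l_pos
  have hb : |xi ζ - p.N| ≤ 1 / 2 := by linarith [p.γ_le]
  have hx : |(xi ζ - p.N) / p.N| ≤ 1 / 2 := by
    rw [abs_div, abs_of_pos hN, div_le_iff₀ hN]; linarith [p.N_large]
  set x := (xi ζ - p.N) / p.N with hxd
  have hx' := abs_le.mp hx
  have h1 := p.xi_rpow (ζ := ζ) (b := xi ζ - p.N) (by linarith [p.N_large]) (by ring)
  rw [← hxd] at h1
  have h2 : (1 + x) ^ α ≤ 4 := by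
    calc (1 + x) ^ α ≤ 2 ^ α := Real.rpow_le_rpow (by linarith) (by linarith) (by linarith)
      _ ≤ 2 ^ (2 : ℝ) := Real.rpow_le_rpow_of_exponent_le (by norm_num) hα'
      _ = 4 := by norm_num
  have h3 : 1 / 4 ≤ (1 + x) ^ α := by
    calc (1 / 4 : ℝ) = (1 / 2) ^ (2 : ℝ) := by norm_num
      _ ≤ (1 / 2) ^ α :=
        Real.rpow_le_rpow_of_exponent_ge (by norm_num) (by norm_num) hα'
      _ ≤ (1 + x) ^ α := Real.rpow_le_rpow (by norm_num) (by linarith) (by linarith)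
  have h4 : |mu ζ| ≤ p.P * (p.m + p.l + 1) := by
    have e : mu ζ = p.P * p.m - p.slope * (xi ζ - p.N) + (p.across ζ - p.center) := by
      have := p.slope_mul_N
      rw [p.mu_eq ζ]
      unfold center
      linear_combination (-1 : ℝ) * this
    rw [e]
    refine (abs_add_le _ _).trans (((add_le_add_left (abs_sub _ _) _)).trans ?_)
    rw [abs_mul p.slope, abs_of_pos p.slope_pos, abs_of_pos (mul_pos hP hm)]
    have h5 := mul_le_mul p.slope_le (hb.trans (by norm_num : (1 / 2 : ℝ) ≤ 1)) (abs_nonneg _) hl.le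
    nlinarith [p.width_le, p.one_le_P]
  have h6 : mu ζ ^ 2 ≤ (p.P * (p.m + p.l + 1)) ^ 2 := by
    rw [← sq_abs]; exact pow_le_pow_left₀ (abs_nonneg _) h4 2
  unfold rho
  rw [h1]
  constructor
  · nlinarith [mul_le_mul_of_nonneg_left h3 (sq_nonneg p.P), sq_nonneg (mu ζ)]
  · nlinarith [mul_le_mul_of_nonneg_left h2 (sq_nonneg p.P)]

end Packet

theorem rpow_mem_Icc {a b x : ℝ} (s : ℝ) (ha : 0 < a) (hax : a ≤ x) (hxb : x ≤ b) :
    min (a ^ s) (b ^ s) ≤ x ^ s ∧ x ^ s ≤ max (a ^ s) (b ^ s) := by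
  have hx : 0 < x := ha.trans_le hax
  rcases le_total 0 s with hs | hs
  · exact ⟨(min_le_left _ _).trans (Real.rpow_le_rpow ha.le hax hs),
      (Real.rpow_le_rpow hx.le hxb hs).trans (le_max_right _ _)⟩
  · exact ⟨(min_le_right _ _).trans (Real.rpow_le_rpow_of_nonpos hx hxb hs),
      (Real.rpow_le_rpow_of_nonpos ha hax hs).trans (le_max_left _ _)⟩

/-! ### The counterexample -/

/-- The parallelogram of half sizes `a` and `r` around the point with `xi = c` and
`mu + k xi = d`. -/
def box (k c d a r : ℝ) : Set Plane := {ζ | |xi ζ - c| ≤ a ∧ |mu ζ + k * xi ζ - d| ≤ r}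

theorem measurableSet_box (k c d a r : ℝ) : MeasurableSet (box k c d a r) := by
  have h1 := continuous_xi
  have h2 := continuous_mu
  have h3 : IsClosed {ζ : Plane | |xi ζ - c| ≤ a} := isClosed_le (by fun_prop) continuous_const
  have h4 : IsClosed {ζ : Plane | |mu ζ + k * xi ζ - d| ≤ r} :=
    isClosed_le (by fun_prop) continuous_const
  exact (h3.inter h4).measurableSet

/-- A parallelogram is an affine preimage of a fixed square, and the shear by `k` has determinant
one. The value of `V` never matters, only that it is common to all boxes. -/
theorem exists_volume_box : ∃ V : ℝ, 0 < V ∧ ∀ k c d a r : ℝ, 0 < a → 0 < r →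
    volume (box k c d a r) = ENNReal.ofReal (a * r * V) := by
  let Q : Set Plane := {z | |z 0| ≤ 1 ∧ |z 1| ≤ 1}
  have hQpos : 0 < volume Q := by
    refine (Metric.measure_ball_pos volume (0 : Plane) one_pos).trans_le (measure_mono ?_)
    intro z hz
    have hz' : ‖z‖ < 1 := by simpa using hz
    exact ⟨(abs_coord_le z 0).trans hz'.le, (abs_coord_le z 1).trans hz'.le⟩
  have hQfin : volume Q ≠ ⊤ := by
    refine ((measure_mono ?_).trans_lt (measure_closedBall_lt_top (x := (0 : Plane)) (r := 2))).ne
    intro z hz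
    have hz' : |z 0| ≤ 1 ∧ |z 1| ≤ 1 := hz
    rw [mem_closedBall_zero_iff, EuclideanSpace.norm_eq, Real.sqrt_le_left (by norm_num)]
    have h0 : ‖z 0‖ ^ 2 ≤ 1 := pow_le_one₀ (norm_nonneg _) hz'.1
    have h1 : ‖z 1‖ ^ 2 ≤ 1 := pow_le_one₀ (norm_nonneg _) hz'.2
    rw [Fin.sum_univ_two]
    linarith
  have hpi := Real.two_pi_pos
  refine ⟨(volume Q).toReal / (2 * Real.pi) ^ 2, div_pos (ENNReal.toReal_pos hQpos.ne' hQfin)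
    (by positivity), fun k c d a r ha hr => ?_⟩
  let M : Matrix (Fin 2) (Fin 2) ℝ := !![2 * Real.pi / a, 0; 2 * Real.pi * k / r, 2 * Real.pi / r]
  let f : Plane →ₗ[ℝ] Plane := Matrix.toEuclideanLin M
  have hf0 : ∀ z, f z 0 = xi z / a := by
    intro z
    simp [f, M, xi, Matrix.toEuclideanLin, Matrix.mulVec, dotProduct, Fin.sum_univ_two]
    ring
  have hf1 : ∀ z, f z 1 = (mu z + k * xi z) / r := by
    intro z
    simp [f, M, xi, mu, Matrix.toEuclideanLin, Matrix.mulVec, dotProduct, Fin.sum_univ_two]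
    ring
  have hdet : LinearMap.det f = (2 * Real.pi) ^ 2 / (a * r) := by
    simp only [f, LinearMap.det_toLpLin, M, Matrix.det_fin_two_of]
    field_simp
    ring
  have hdet0 : LinearMap.det f ≠ 0 := by rw [hdet]; positivity
  let v : Plane := !₂[c / a, d / r]
  have e : box k c d a r = f ⁻¹' ((fun z => z + -v) ⁻¹' Q) := by
    ext z
    have e0 : f z 0 - c / a = (xi z - c) / a := by rw [hf0]; ring
    have e1 : f z 1 - d / r = (mu z + k * xi z - d) / r := by rw [hf1]; ring
    simp only [box, Q, v, mem_ofPred_eq, mem_preimage, PiLp.add_apply, PiLp.neg_apply]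
    simp only [Matrix.cons_val_zero, Matrix.cons_val_one, ← sub_eq_add_neg]
    rw [e0, e1, abs_div, abs_div, abs_of_pos ha, abs_of_pos hr, div_le_one ha, div_le_one hr]
  rw [e, Measure.addHaar_preimage_linearMap volume hdet0, measure_preimage_add_right, hdet,
    abs_of_pos (by positivity), ← ENNReal.ofReal_toReal hQfin, ← ENNReal.ofReal_mul (by positivity)]
  congr 1
  rw [ENNReal.toReal_ofReal ENNReal.toReal_nonneg]
  field_simp

theorem ESpace.norm_sq_le {α s : ℝ} {f : ESpace α s} {g : Plane → ℂ}
    (hf : HasFourierFun f.toDistribution g) {S : Set Plane} (hS : MeasurableSet S) {K v : ℝ}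
    (hK : 0 ≤ K) (hv : 0 ≤ v) (hSv : volume S ≤ ENNReal.ofReal v)
    (h1 : ∀ ζ, weight α s ζ * ‖g ζ‖ ≤ K) (h0 : ∀ ζ, ζ ∉ S → g ζ = 0) : ‖f‖ ^ 2 ≤ K ^ 2 * v := by
  have h2 : eLpNorm (fun ζ => weight α s ζ • g ζ) 2 volume ≤
      eLpNorm (S.indicator fun _ => K) 2 volume := by
    refine eLpNorm_mono fun ζ => ?_
    by_cases hζ : ζ ∈ S
    · rw [indicator_of_mem hζ, norm_smul, Real.norm_eq_abs, abs_of_pos (ESpace.weight_pos α s ζ),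
        Real.norm_eq_abs, abs_of_nonneg hK]
      exact h1 ζ
    · simp [h0 ζ hζ]
  rw [eLpNorm_indicator_const hS (by norm_num) (by norm_num)] at h2
  have h3 : eLpNorm (fun ζ => weight α s ζ • g ζ) 2 volume ≤
      ENNReal.ofReal (K * v ^ (1 / 2 : ℝ)) := by
    refine h2.trans ?_
    rw [ENNReal.ofReal_mul hK, ← ENNReal.ofReal_rpow_of_nonneg hv (by norm_num)]
    refine mul_le_mul' ?_ ?_
    · rw [Real.enorm_eq_ofReal hK]
    · simpa using ENNReal.rpow_le_rpow hSv (by norm_num : (0 : ℝ) ≤ 1 / 2)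
  have h4 : ‖f‖ ≤ K * v ^ (1 / 2 : ℝ) := by
    rw [ESpace.norm_eq f hf]
    exact ENNReal.toReal_le_of_le_ofReal (by positivity) h3
  calc ‖f‖ ^ 2 ≤ (K * v ^ (1 / 2 : ℝ)) ^ 2 := pow_le_pow_left₀ (norm_nonneg _) h4 2
    _ = K ^ 2 * v := by rw [mul_pow, ← Real.sqrt_eq_rpow, Real.sq_sqrt hv]

theorem ESpace.le_norm_sq {α s : ℝ} {f : ESpace α s} {g : Plane → ℂ}
    (hf : HasFourierFun f.toDistribution g) {S : Set Plane} (hS : MeasurableSet S) {K v : ℝ}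
    (hK : 0 ≤ K) (hv : 0 ≤ v) (hSv : ENNReal.ofReal v ≤ volume S)
    (h1 : ∀ ζ ∈ S, K ≤ weight α s ζ * ‖g ζ‖) : K ^ 2 * v ≤ ‖f‖ ^ 2 := by
  have h2 : eLpNorm (S.indicator fun _ => K) 2 volume ≤
      eLpNorm (fun ζ => weight α s ζ • g ζ) 2 volume := by
    refine eLpNorm_mono fun ζ => ?_
    by_cases hζ : ζ ∈ S
    · rw [indicator_of_mem hζ, norm_smul, Real.norm_eq_abs, abs_of_nonneg hK, Real.norm_eq_abs,
        abs_of_pos (ESpace.weight_pos α s ζ)]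
      exact h1 ζ hζ
    · rw [indicator_of_notMem hζ, norm_zero]
      exact norm_nonneg _
  rw [eLpNorm_indicator_const hS (by norm_num) (by norm_num)] at h2
  have h3 : ENNReal.ofReal (K * v ^ (1 / 2 : ℝ)) ≤
      eLpNorm (fun ζ => weight α s ζ • g ζ) 2 volume := by
    refine le_trans ?_ h2
    rw [ENNReal.ofReal_mul hK, ← ENNReal.ofReal_rpow_of_nonneg hv (by norm_num)]
    refine mul_le_mul' ?_ ?_
    · rw [Real.enorm_eq_ofReal hK]
    · simpa using ENNReal.rpow_le_rpow hSv (by norm_num : (0 : ℝ) ≤ 1 / 2)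
  have hfin : eLpNorm (fun ζ => weight α s ζ • g ζ) 2 volume ≠ ⊤ := by
    rw [eLpNorm_congr_ae (g := fun ζ => weight α s ζ • f.hat ζ)]
    · exact f.memLp_hat.2.ne
    · filter_upwards [hf.ae_eq f.hasFourierFun_hat] with ζ hζ
      rw [hζ]
  have h4 : K * v ^ (1 / 2 : ℝ) ≤ ‖f‖ := by
    rw [ESpace.norm_eq f hf]
    exact (ENNReal.ofReal_le_iff_le_toReal hfin).mp h3
  calc K ^ 2 * v = (K * v ^ (1 / 2 : ℝ)) ^ 2 := by
        rw [mul_pow, ← Real.sqrt_eq_rpow, Real.sq_sqrt hv]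
    _ ≤ ‖f‖ ^ 2 := pow_le_pow_left₀ (by positivity) h4 2

/-! ### Bumps on parallelograms -/

/-- A continuous function which is `1` on `[-1, 1]` and vanishes outside `[-2, 2]`. -/
def tent (r : ℝ) : ℝ := max 0 (min 1 (2 - |r|))

theorem continuous_tent : Continuous tent := by unfold tent; fun_prop

theorem tent_nonneg (r : ℝ) : 0 ≤ tent r := le_max_left _ _

theorem tent_le_one (r : ℝ) : tent r ≤ 1 := max_le zero_le_one (min_le_left _ _)

theorem tent_eq_one {r : ℝ} (h : |r| ≤ 1) : tent r = 1 := by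
  unfold tent
  rw [min_eq_left (by linarith), max_eq_right zero_le_one]

theorem tent_eq_zero {r : ℝ} (h : 2 < |r|) : tent r = 0 := by
  unfold tent
  exact max_eq_left ((min_le_right _ _).trans (by linarith))

theorem tent_neg (r : ℝ) : tent (-r) = tent r := by unfold tent; rw [abs_neg]

/-- A continuous bump on a parallelogram. -/
def bump (k c d a r : ℝ) (ζ : Plane) : ℝ :=
  tent ((xi ζ - c) / a) * tent ((mu ζ + k * xi ζ - d) / r)

section Bump

variable {k c d a r : ℝ}

theorem continuous_bump : Continuous (bump k c d a r) := by
  have h1 := continuous_xi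
  have h2 := continuous_mu
  have h3 := continuous_tent
  unfold bump
  fun_prop

theorem bump_nonneg (ζ : Plane) : 0 ≤ bump k c d a r ζ :=
  mul_nonneg (tent_nonneg _) (tent_nonneg _)

theorem bump_le_one (ζ : Plane) : bump k c d a r ζ ≤ 1 :=
  mul_le_one₀ (tent_le_one _) (tent_nonneg _) (tent_le_one _)

theorem bump_eq_one (ha : 0 < a) (hr : 0 < r) {ζ : Plane} (hζ : ζ ∈ box k c d a r) :
    bump k c d a r ζ = 1 := by
  unfold bump
  rw [tent_eq_one, tent_eq_one, mul_one]
  · rw [abs_div, abs_of_pos hr, div_le_one hr]; exact hζ.2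
  · rw [abs_div, abs_of_pos ha, div_le_one ha]; exact hζ.1

theorem mem_box_of_bump_ne_zero (ha : 0 < a) (hr : 0 < r) {ζ : Plane}
    (hζ : bump k c d a r ζ ≠ 0) : ζ ∈ box k c d (2 * a) (2 * r) := by
  unfold bump at hζ
  constructor
  · by_contra h
    refine hζ (mul_eq_zero_of_left (tent_eq_zero ?_) _)
    rw [abs_div, abs_of_pos ha, lt_div_iff₀ ha]
    exact not_le.mp h
  · by_contra h
    refine hζ (mul_eq_zero_of_right _ (tent_eq_zero ?_))
    rw [abs_div, abs_of_pos hr, lt_div_iff₀ hr]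
    exact not_le.mp h

theorem mu_neg (ζ : Plane) : mu (-ζ) = -mu ζ := by simp [mu]

theorem bump_neg (ζ : Plane) : bump k c d a r (-ζ) = bump k (-c) (-d) a r ζ := by
  unfold bump
  rw [← tent_neg, ← tent_neg ((mu (-ζ) + k * xi (-ζ) - d) / r), xi_neg, mu_neg]
  congr 2 <;> ring

theorem neg_mem_box {ζ : Plane} (hζ : ζ ∈ box k (-c) (-d) a r) : -ζ ∈ box k c d a r := by
  constructor
  · rw [xi_neg, ← abs_neg]; convert hζ.1 using 2; ring
  · rw [xi_neg, mu_neg, ← abs_neg]; convert hζ.2 using 2; ring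

theorem exists_norm_le_of_mem_box (k c d a r : ℝ) :
    ∃ R : ℝ, 0 ≤ R ∧ ∀ ζ ∈ box k c d a r, ‖ζ‖ ≤ R := by
  refine ⟨(|a| + |c|) + ((|r| + |d|) + |k| * (|a| + |c|)), by positivity, fun ζ hζ => ?_⟩
  have h1 : |xi ζ| ≤ |a| + |c| := by
    calc |xi ζ| = |(xi ζ - c) + c| := by ring_nf
      _ ≤ _ := (abs_add_le _ _).trans (by linarith [hζ.1, le_abs_self a])
  have h2 : |mu ζ| ≤ (|r| + |d|) + |k| * (|a| + |c|) := by
    calc |mu ζ| = |(mu ζ + k * xi ζ - d) + d - k * xi ζ| := by ring_nf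
      _ ≤ |mu ζ + k * xi ζ - d| + |d| + |k * xi ζ| :=
        (abs_sub _ _).trans (by linarith [abs_add_le (mu ζ + k * xi ζ - d) d])
      _ ≤ _ := by
        rw [abs_mul]
        have := mul_le_mul_of_nonneg_left h1 (abs_nonneg k)
        linarith [hζ.2, le_abs_self r]
  have hpi : 1 ≤ 2 * Real.pi := by linarith [Real.pi_gt_three]
  have h3 : |ζ 0| ≤ |xi ζ| := by
    unfold xi
    rw [abs_mul, abs_of_pos (by positivity : 0 < 2 * Real.pi)]
    exact le_mul_of_one_le_left (abs_nonneg _) hpi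
  have h4 : |ζ 1| ≤ |mu ζ| := by
    unfold mu
    rw [abs_mul, abs_of_pos (by positivity : 0 < 2 * Real.pi)]
    exact le_mul_of_one_le_left (abs_nonneg _) hpi
  have h5 : ‖ζ‖ ≤ |ζ 0| + |ζ 1| := by
    rw [EuclideanSpace.norm_eq, Real.sqrt_le_left (by positivity), Fin.sum_univ_two,
      Real.norm_eq_abs, Real.norm_eq_abs]
    nlinarith [mul_nonneg (abs_nonneg (ζ 0)) (abs_nonneg (ζ 1))]
  linarith

end Bump

theorem exists_niceDatum {g : Plane → ℝ} {D R : ℝ} (hg : Continuous g) (heven : ∀ ζ, g (-ζ) = g ζ)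
    (hg0 : ∀ ζ, 0 ≤ g ζ) (hgD : ∀ ζ, g ζ ≤ D) (hR : 0 ≤ R) (hsupp : ∀ ζ, g ζ ≠ 0 → ‖ζ‖ ≤ R) :
    ∃ B, NiceDatum B R fun ζ => (g ζ : ℂ) := by
  have hD : 0 ≤ D := (hg0 0).trans (hgD 0)
  refine ⟨D * (1 + R) ^ 4, by fun_prop, fun ζ => ?_, fun ζ => ?_, fun ζ hζ => ?_, hR⟩
  · rw [heven, Complex.conj_ofReal]
  · rw [pow_zero, one_mul, Complex.norm_real, Real.norm_eq_abs, abs_of_nonneg (hg0 ζ)]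
    by_cases h : g ζ = 0
    · rw [h]
      have := maj_nonneg ζ
      positivity
    · have h1 := hsupp ζ h
      unfold maj
      rw [mul_assoc, ← div_eq_mul_inv]
      refine (hgD ζ).trans (le_mul_of_one_le_right hD ?_)
      rw [one_le_div (by positivity)]
      gcongr
  · by_contra h
    exact absurd (hsupp ζ (fun h' => h (by simp [h']))) (not_le.mpr hζ)

/-! ### Lower bound of the quadratic term -/

/-- Without oscillation, the quadratic term of the expansion is as large as possible. -/
theorem le_norm_picard_one {α : ℝ} (hα : 0 ≤ α) {g : Plane → ℝ} {B R : ℝ}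
    (hg : NiceDatum B R fun ζ => (g ζ : ℂ)) (hg0 : ∀ ζ, 0 ≤ g ζ) {t : ℝ} (ht : 0 ≤ t)
    (ht1 : t ≤ 1) {ζ : Plane}
    (hres : ∀ η, g η ≠ 0 → g (ζ - η) ≠ 0 → |omega α ζ - omega α η - omega α (ζ - η)| ≤ 1) :
    1 / 4 * |xi ζ| * t * ∫ η, g η * g (ζ - η) ≤ ‖picard α (fun ζ => (g ζ : ℂ)) 1 t ζ‖ := by
  set h : Plane → ℂ := fun ζ => (g ζ : ℂ) with hh
  let J : ℝ → ℂ := fun τ => phase α (-τ) ζ * conv (picard α h 0 τ) (picard α h 0 τ) ζ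
  have hp := hg.picardTerm hα 0
  have hJc : Continuous J := by
    have h1 : Continuous (Function.uncurry fun τ ζ => conv (picard α h 0 τ) (picard α h 0 τ) ζ) :=
      continuous_uncurry_conv hp.cont hp.cont (by fun_prop) (by fun_prop) hp.decay hp.decay
    exact (continuous_phase hα continuous_neg continuous_const).mul
      (h1.comp (continuous_id.prodMk continuous_const))
  have hgi : Integrable fun η => g η * g (ζ - η) := by
    have := (hg.decay.conv_integrable hg.decay hg.cont hg.cont ζ).re
    simpa [hh, ← Complex.ofReal_mul] using this
  have hJre : ∀ τ, 0 ≤ τ → τ ≤ t → 1 / 2 * ∫ η, g η * g (ζ - η) ≤ (J τ).re := by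
    intro τ h0 h1
    have e : J τ = ∫ η, phase α (-τ) ζ * (picard α h 0 τ η * picard α h 0 τ (ζ - η)) := by
      simp only [J, conv]
      rw [integral_const_mul]
    have hint : Integrable fun η =>
        phase α (-τ) ζ * (picard α h 0 τ η * picard α h 0 τ (ζ - η)) := by
      have hc : Continuous (picard α h 0 τ) :=
        hp.cont.comp (continuous_const.prodMk continuous_id)
      exact ((hp.decay τ).conv_integrable (hp.decay τ) hc hc ζ).const_mul _
    have e2 : (J τ).re =
        ∫ η, (phase α (-τ) ζ * (picard α h 0 τ η * picard α h 0 τ (ζ - η))).re := by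
      rw [e]; exact (integral_re hint).symm
    rw [e2, ← integral_const_mul]
    refine integral_mono (hgi.const_mul _) hint.re fun η => ?_
    have e3 : phase α (-τ) ζ * (picard α h 0 τ η * picard α h 0 τ (ζ - η)) =
        ((g η * g (ζ - η) : ℝ) : ℂ) * Complex.exp
          (((-(τ * (omega α ζ - omega α η - omega α (ζ - η))) : ℝ) : ℂ) * Complex.I) := by
      simp only [picard_zero, phase, hh]
      rw [mul_mul_mul_comm (Complex.exp _), ← Complex.exp_add, ← mul_assoc (Complex.exp _),
        ← Complex.exp_add, mul_comm, ← Complex.ofReal_mul]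
      congr 2
      push_cast
      ring
    change 1 / 2 * (g η * g (ζ - η)) ≤ _
    rw [e3, Complex.re_ofReal_mul, Complex.exp_ofReal_mul_I_re, mul_comm]
    by_cases hz : g η = 0 ∨ g (ζ - η) = 0
    · rcases hz with hz | hz <;> simp [hz]
    · push Not at hz
      refine mul_le_mul_of_nonneg_left ?_ (mul_nonneg (hg0 _) (hg0 _))
      -- The accumulated phase is at most `1`, so its cosine is at least `1/2`. As the datum is
      -- nonnegative on the Fourier side, the contributions add up without cancellation.
      have h2 := Real.one_sub_sq_div_two_le_cos
        (x := -(τ * (omega α ζ - omega α η - omega α (ζ - η))))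
      have h3 : (-(τ * (omega α ζ - omega α η - omega α (ζ - η)))) ^ 2 ≤ 1 := by
        rw [← sq_abs, abs_neg, abs_mul, abs_of_nonneg h0]
        refine pow_le_one₀ (by positivity) ?_
        exact mul_le_one₀ (h1.trans ht1) (abs_nonneg _) (hres η hz.1 hz.2)
      linarith
  have hI : 1 / 2 * t * ∫ η, g η * g (ζ - η) ≤ ‖∫ τ in (0 : ℝ)..t, J τ‖ := by
    refine le_trans ?_ (Complex.re_le_norm _)
    have e : (∫ τ in (0 : ℝ)..t, J τ).re = ∫ τ in (0 : ℝ)..t, (J τ).re := by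
      have := Complex.reCLM.intervalIntegral_comp_comm (hJc.intervalIntegrable 0 t (μ := volume))
      exact this.symm
    rw [e]
    calc 1 / 2 * t * ∫ η, g η * g (ζ - η)
        = ∫ τ in (0 : ℝ)..t, 1 / 2 * ∫ η, g η * g (ζ - η) := by
          rw [intervalIntegral.integral_const, smul_eq_mul]; ring
      _ ≤ _ := intervalIntegral.integral_mono_on ht (by simp)
          ((Complex.continuous_re.comp hJc).intervalIntegrable _ _) fun τ hτ => hJre τ hτ.1 hτ.2
  have e : picard α h 1 t ζ = phase α t ζ * ((1 / 2) * (Complex.I * xi ζ) *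
      ∫ τ in (0 : ℝ)..t, J τ) := by
    rw [picard_one]
    unfold duhamel
    rw [← intervalIntegral.integral_const_mul ((1 / 2) * (Complex.I * xi ζ))]
    congr 1
    refine intervalIntegral.integral_congr fun τ _ => ?_
    simp only [J]
    ring
  rw [e, norm_mul, norm_phase, one_mul, norm_mul, norm_mul, norm_mul, Complex.norm_I, one_mul,
    Complex.norm_real, Real.norm_eq_abs]
  have h3 : ‖(1 / 2 : ℂ)‖ = 1 / 2 := by norm_num
  rw [h3]
  have := mul_le_mul_of_nonneg_left hI (by positivity : 0 ≤ 1 / 2 * |xi ζ|)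
  linarith

/-- An upper bound of the weight at the low frequencies of a packet. -/
def weightLow (l s : ℝ) : ℝ := max (1 ^ s) ((2 + (1 + l) ^ 2) ^ s)

/-- An upper bound of the normalized weight at the high frequencies of a packet. -/
def weightHigh (m l s : ℝ) : ℝ := max ((1 / 4) ^ s) ((5 + (m + l + 1) ^ 2) ^ s)

/-- A lower bound of the normalized weight at the high frequencies of a packet. -/
def weightHighMin (m l s : ℝ) : ℝ := min ((1 / 4) ^ s) ((5 + (m + l + 1) ^ 2) ^ s)

theorem weightHighMin_pos (m l s : ℝ) : 0 < weightHighMin m l s :=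
  lt_min (by positivity) (by positivity)

theorem weightLow_nonneg (l s : ℝ) : 0 ≤ weightLow l s :=
  (by positivity : (0 : ℝ) ≤ 1 ^ s).trans (le_max_left _ _)

theorem weightHigh_nonneg (m l s : ℝ) : 0 ≤ weightHigh m l s :=
  (by positivity : (0 : ℝ) ≤ (1 / 4) ^ s).trans (le_max_left _ _)

theorem weight_neg (α s : ℝ) (ζ : Plane) : weight α s (-ζ) = weight α s ζ := by
  unfold weight
  rw [xi_neg, mu_neg, abs_neg, neg_sq]

/-! ### The datum and its interactions -/

namespace Packet

variable {α : ℝ} (p : Packet α)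

/-- The amplitude of the high frequencies of the datum. -/
def amp (s : ℝ) : ℝ := (p.P ^ 2) ^ (-s)

theorem amp_pos (s : ℝ) : 0 < p.amp s := Real.rpow_pos_of_pos (pow_pos p.P_pos 2) _

/-- The Fourier transform of the datum: a low frequency bump and a pair of high frequency
bumps. -/
def datum (s : ℝ) (ζ : Plane) : ℝ :=
  bump p.slope 0 0 p.γ p.width ζ +
    p.amp s * (bump p.slope p.N p.center (2 * p.γ) (2 * p.width) ζ +
      bump p.slope (-p.N) (-p.center) (2 * p.γ) (2 * p.width) ζ)

theorem weight_low_le (hα : 1 ≤ α) (s : ℝ) {ζ : Plane}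
    (hζ : ζ ∈ box p.slope 0 0 (2 * p.γ) (2 * p.width)) : weight α s ζ ≤ weightLow p.l s := by
  have h := p.rho_low_le hα (by simpa using hζ.1) (by simpa [across] using hζ.2)
  have h1 : 1 ≤ Real.sqrt (1 + rho α ζ ^ 2) := by
    rw [Real.one_le_sqrt]; nlinarith [sq_nonneg (rho α ζ)]
  have h2 := sqrt_one_add_sq_le (rho_nonneg α ζ)
  exact (rpow_mem_Icc s one_pos h1 (by linarith)).2

/-- There `|ξ|^α + μ²` is comparable to `P²`, with constants depending on `m` and `l` only, so the
amplitude cancels the weight for every `s` of either sign. -/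
theorem weight_high (hα : 1 ≤ α) (hα' : α ≤ 2) (s : ℝ) {ζ : Plane}
    (hζ : ζ ∈ box p.slope p.N p.center (4 * p.γ) (4 * p.width)) :
    weightHighMin p.m p.l s ≤ weight α s ζ * p.amp s ∧
      weight α s ζ * p.amp s ≤ weightHigh p.m p.l s := by
  have hP : 0 < p.P ^ 2 := pow_pos p.P_pos 2
  have hP1 : 1 ≤ p.P ^ 2 := one_le_pow₀ p.one_le_P
  obtain ⟨h1, h2⟩ := p.rho_high hα hα' hζ.1 hζ.2
  have h3 : rho α ζ ≤ Real.sqrt (1 + rho α ζ ^ 2) := Real.le_sqrt_of_sq_le (by linarith)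
  have h4 := sqrt_one_add_sq_le (rho_nonneg α ζ)
  have e : weight α s ζ * p.amp s = (Real.sqrt (1 + rho α ζ ^ 2) / p.P ^ 2) ^ s := by
    rw [Real.div_rpow (Real.sqrt_nonneg _) hP.le, weight_eq, amp, Real.rpow_neg hP.le,
      div_eq_mul_inv]
  rw [e]
  refine rpow_mem_Icc s (by norm_num) ?_ ?_
  · rw [le_div_iff₀ hP]; linarith
  · rw [div_le_iff₀ hP]; nlinarith

theorem continuous_datum (s : ℝ) : Continuous (p.datum s) :=
  continuous_bump.add (continuous_const.mul (continuous_bump.add continuous_bump))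

theorem datum_neg (s : ℝ) (ζ : Plane) : p.datum s (-ζ) = p.datum s ζ := by
  unfold datum
  rw [bump_neg, bump_neg, bump_neg, neg_neg, neg_neg, neg_zero, add_comm (bump _ (-p.N) _ _ _ _)]

theorem datum_nonneg (s : ℝ) (ζ : Plane) : 0 ≤ p.datum s ζ :=
  add_nonneg (bump_nonneg _)
    (mul_nonneg (p.amp_pos s).le (add_nonneg (bump_nonneg _) (bump_nonneg _)))

theorem datum_le (s : ℝ) (ζ : Plane) : p.datum s ζ ≤ 1 + p.amp s * 2 := by
  unfold datum
  have h1 := (p.amp_pos s).le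
  have h2 := bump_le_one (k := p.slope) (c := p.N) (d := p.center) (a := 2 * p.γ)
    (r := 2 * p.width) ζ
  have h3 := bump_le_one (k := p.slope) (c := -p.N) (d := -p.center) (a := 2 * p.γ)
    (r := 2 * p.width) ζ
  exact add_le_add (bump_le_one ζ) (mul_le_mul_of_nonneg_left (by linarith) h1)

/-- The support of the datum. -/
def region : Set Plane := box p.slope 0 0 (2 * p.γ) (2 * p.width) ∪
  (box p.slope p.N p.center (4 * p.γ) (4 * p.width) ∪
    box p.slope (-p.N) (-p.center) (4 * p.γ) (4 * p.width))

theorem mem_high_of_bump_ne_zero {c d : ℝ} {ζ : Plane}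
    (h : bump p.slope c d (2 * p.γ) (2 * p.width) ζ ≠ 0) :
    ζ ∈ box p.slope c d (4 * p.γ) (4 * p.width) := by
  have := mem_box_of_bump_ne_zero (by linarith [p.γ_pos]) (by linarith [p.width_pos]) h
  convert this using 1; ring_nf

theorem mem_region {s : ℝ} {ζ : Plane} (h : p.datum s ζ ≠ 0) : ζ ∈ p.region := by
  by_contra hn
  simp only [region, mem_union, not_or] at hn
  refine h ?_
  have h1 : bump p.slope 0 0 p.γ p.width ζ = 0 := by
    by_contra h'
    exact hn.1 (mem_box_of_bump_ne_zero p.γ_pos p.width_pos h')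
  have h2 : bump p.slope p.N p.center (2 * p.γ) (2 * p.width) ζ = 0 := by
    by_contra h'
    exact hn.2.1 (p.mem_high_of_bump_ne_zero h')
  have h3 : bump p.slope (-p.N) (-p.center) (2 * p.γ) (2 * p.width) ζ = 0 := by
    by_contra h'
    exact hn.2.2 (p.mem_high_of_bump_ne_zero h')
  simp [datum, h1, h2, h3]

theorem weight_mul_datum_le (hα : 1 ≤ α) (hα' : α ≤ 2) (s : ℝ) (ζ : Plane) :
    weight α s ζ * p.datum s ζ ≤ weightLow p.l s + 2 * weightHigh p.m p.l s := by
  have hw := (ESpace.weight_pos α s ζ).le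
  have ha := (p.amp_pos s).le
  have hH := weightHigh_nonneg p.m p.l s
  have h1 : weight α s ζ * bump p.slope 0 0 p.γ p.width ζ ≤ weightLow p.l s := by
    by_cases h : bump p.slope 0 0 p.γ p.width ζ = 0
    · rw [h, mul_zero]; exact weightLow_nonneg _ _
    · exact (mul_le_of_le_one_right hw (bump_le_one _)).trans
        (p.weight_low_le hα s (mem_box_of_bump_ne_zero p.γ_pos p.width_pos h))
  have h2 : weight α s ζ * p.amp s * bump p.slope p.N p.center (2 * p.γ) (2 * p.width) ζ ≤
      weightHigh p.m p.l s := by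
    by_cases h : bump p.slope p.N p.center (2 * p.γ) (2 * p.width) ζ = 0
    · rw [h, mul_zero]; exact hH
    · exact (mul_le_of_le_one_right (mul_nonneg hw ha) (bump_le_one _)).trans
        (p.weight_high hα hα' s (p.mem_high_of_bump_ne_zero h)).2
  have h3 : weight α s ζ * p.amp s *
      bump p.slope (-p.N) (-p.center) (2 * p.γ) (2 * p.width) ζ ≤ weightHigh p.m p.l s := by
    by_cases h : bump p.slope (-p.N) (-p.center) (2 * p.γ) (2 * p.width) ζ = 0
    · rw [h, mul_zero]; exact hH
    · refine (mul_le_of_le_one_right (mul_nonneg hw ha) (bump_le_one _)).trans ?_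
      rw [← weight_neg]
      exact (p.weight_high hα hα' s (neg_mem_box (p.mem_high_of_bump_ne_zero h))).2
  unfold datum
  linarith

theorem exists_niceDatum_datum (s : ℝ) :
    ∃ B R, NiceDatum B R fun ζ => (p.datum s ζ : ℂ) := by
  obtain ⟨R₁, hR₁, h₁⟩ := exists_norm_le_of_mem_box p.slope 0 0 (2 * p.γ) (2 * p.width)
  obtain ⟨R₂, hR₂, h₂⟩ := exists_norm_le_of_mem_box p.slope p.N p.center (4 * p.γ) (4 * p.width)
  obtain ⟨R₃, hR₃, h₃⟩ :=
    exists_norm_le_of_mem_box p.slope (-p.N) (-p.center) (4 * p.γ) (4 * p.width)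
  obtain ⟨B, hB⟩ := exists_niceDatum (R := R₁ + R₂ + R₃) (p.continuous_datum s) (p.datum_neg s)
    (p.datum_nonneg s) (p.datum_le s) (by positivity) (fun ζ hζ => by
      rcases p.mem_region hζ with h | h | h
      · linarith [h₁ ζ h]
      · linarith [h₂ ζ h]
      · linarith [h₃ ζ h])
  exact ⟨B, _, hB⟩

/-- The low and high frequencies of the datum interact without oscillation. -/
theorem resonance (hα : 1 ≤ α) (hα' : α ≤ 2) {s : ℝ} {ζ η : Plane}
    (hζ : ζ ∈ box p.slope p.N p.center p.γ p.width) (h1 : p.datum s η ≠ 0)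
    (h2 : p.datum s (ζ - η) ≠ 0) : |omega α ζ - omega α η - omega α (ζ - η)| ≤ 1 := by
  have hγ := p.γ_pos
  have hγ' := p.γ_le
  have hw := p.width_pos
  have hN := p.N_large
  have hζ0 := p.abs_omega_sub_le hα hα' (ζ := ζ) (by linarith [hζ.1])
    ((show |p.across ζ - p.center| ≤ p.width from hζ.2).trans (by linarith))
  have key : ∀ ζ₁ ζ₂ : Plane, ζ₁ ∈ box p.slope 0 0 (2 * p.γ) (2 * p.width) →
      ζ₂ ∈ box p.slope p.N p.center (4 * p.γ) (4 * p.width) →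
      |omega α ζ - omega α ζ₁ - omega α ζ₂| ≤ 1 := by
    intro ζ₁ ζ₂ hl hh
    have a1 := p.abs_omega_low_le hα (ζ := ζ₁) (by simpa using hl.1)
      (by simpa [across] using hl.2)
    have a2 := p.abs_omega_sub_le hα hα' (ζ := ζ₂) hh.1 hh.2
    rw [abs_le] at hζ0 a1 a2 ⊢
    constructor <;> linarith
  have hξ : xi (ζ - η) = xi ζ - xi η := by simp [xi, mul_sub]
  have b0 := abs_le.mp hζ.1
  -- The first frequency coordinates must add up to about `N`. As `N ≥ 10` and `γ ≤ 1/8`, seven of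
  -- the nine pairs are impossible, and the two others are the low-high interaction in either order.
  rcases p.mem_region h1 with h1 | h1 | h1 <;> rcases p.mem_region h2 with h2 | h2 | h2
  case inr.inl.inl =>
    have := key _ _ h2 h1
    rwa [sub_right_comm]
  case inl.inr.inl => exact key _ _ h1 h2
  all_goals
    exfalso
    have b1 := abs_le.mp h1.1
    have b2 := abs_le.mp h2.1
    rw [hξ] at b2
    linarith

/-- The high bumps are twice as large as the low one, so that `ζ - η` is still in the set where the
high bump equals `1` for all `ζ` and `η` in the smaller boxes. -/
theorem le_integral_datum (s : ℝ) {V : ℝ} (hV0 : 0 < V)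
    (hV : ∀ k c d a r : ℝ, 0 < a → 0 < r → volume (box k c d a r) = ENNReal.ofReal (a * r * V))
    {ζ : Plane} (hζ : ζ ∈ box p.slope p.N p.center p.γ p.width) :
    p.amp s * (p.γ * p.width * V) ≤ ∫ η, p.datum s η * p.datum s (ζ - η) := by
  obtain ⟨B, R, hB⟩ := p.exists_niceDatum_datum s
  have hγ := p.γ_pos
  have hw := p.width_pos
  have ha := (p.amp_pos s).le
  have hi : Integrable fun η => p.datum s η * p.datum s (ζ - η) := by
    have := (hB.decay.conv_integrable hB.decay hB.cont hB.cont ζ).re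
    simpa [← Complex.ofReal_mul] using this
  set A := box p.slope 0 0 p.γ p.width with hA
  have hvol : volume A = ENNReal.ofReal (p.γ * p.width * V) := hV _ _ _ _ _ hγ hw
  have e : ∫ η, A.indicator (fun _ => p.amp s) η = p.amp s * (p.γ * p.width * V) := by
    rw [integral_indicator_const _ (measurableSet_box _ _ _ _ _), measureReal_def, hvol,
      ENNReal.toReal_ofReal (by positivity), smul_eq_mul, mul_comm]
  rw [← e]
  refine integral_mono ((integrable_indicator_iff (measurableSet_box _ _ _ _ _)).mpr
    (integrableOn_const (by rw [← hA, hvol]; exact ENNReal.ofReal_ne_top))) hi fun η => ?_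
  by_cases hη : η ∈ A
  · rw [indicator_of_mem hη]
    have h1 : 1 ≤ p.datum s η := by
      unfold datum
      rw [bump_eq_one hγ hw hη]
      exact le_add_of_nonneg_right
        (mul_nonneg ha (add_nonneg (bump_nonneg _) (bump_nonneg _)))
    have h2 : p.amp s ≤ p.datum s (ζ - η) := by
      have hm : ζ - η ∈ box p.slope p.N p.center (2 * p.γ) (2 * p.width) := by
        have e1 : xi (ζ - η) = xi ζ - xi η := by simp [xi, mul_sub]
        have e2 : mu (ζ - η) = mu ζ - mu η := by simp [mu, mul_sub]
        have a1 := abs_le.mp hζ.1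
        have a2 := abs_le.mp hζ.2
        have a3 := abs_le.mp hη.1
        have a4 := abs_le.mp hη.2
        refine ⟨?_, ?_⟩
        · rw [e1, abs_le]; constructor <;> linarith
        · rw [e1, e2, abs_le]; constructor <;> linarith
      unfold datum
      rw [bump_eq_one (by linarith) (by linarith) hm]
      have b1 := bump_nonneg (k := p.slope) (c := 0) (d := 0) (a := p.γ) (r := p.width) (ζ - η)
      have b2 := bump_nonneg (k := p.slope) (c := -p.N) (d := -p.center) (a := 2 * p.γ)
        (r := 2 * p.width) (ζ - η)
      nlinarith [mul_nonneg ha b2]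
    calc p.amp s = 1 * p.amp s := (one_mul _).symm
      _ ≤ _ := mul_le_mul h1 h2 ha (p.datum_nonneg s η)
  · rw [indicator_of_notMem hη]
    exact mul_nonneg (p.datum_nonneg _ _) (p.datum_nonneg _ _)

/-- The weighted datum is bounded independently of `N`, and its support has area at most `4 + 16 +
16 = 36` times that of the basic box. -/
theorem norm_sq_le (hα : 1 ≤ α) (hα' : α ≤ 2) {s V : ℝ} (hV0 : 0 < V)
    (hV : ∀ k c d a r : ℝ, 0 < a → 0 < r → volume (box k c d a r) = ENNReal.ofReal (a * r * V))
    {f : ESpace α s} (hf : HasFourierFun f.toDistribution fun ζ => (p.datum s ζ : ℂ)) :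
    ‖f‖ ^ 2 ≤ (weightLow p.l s + 2 * weightHigh p.m p.l s) ^ 2 *
      (36 * (p.γ * p.width * V)) := by
  have hγ := p.γ_pos
  have hw := p.width_pos
  refine ESpace.norm_sq_le hf (S := p.region)
    ((measurableSet_box _ _ _ _ _).union
      ((measurableSet_box _ _ _ _ _).union (measurableSet_box _ _ _ _ _)))
    (add_nonneg (weightLow_nonneg _ _) (mul_nonneg (by norm_num) (weightHigh_nonneg _ _ _)))
    (by positivity) ?_ (fun ζ => ?_) (fun ζ hζ => ?_)
  · refine (measure_union_le _ _).trans ((add_le_add_right (measure_union_le _ _) _).trans ?_)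
    rw [hV _ _ _ _ _ (by positivity) (by positivity), hV _ _ _ _ _ (by positivity) (by positivity),
      hV _ _ _ _ _ (by positivity) (by positivity), ← ENNReal.ofReal_add (by positivity)
      (by positivity), ← ENNReal.ofReal_add (by positivity) (by positivity)]
    exact ENNReal.ofReal_le_ofReal (by linarith)
  · rw [Complex.norm_real, Real.norm_eq_abs, abs_of_nonneg (p.datum_nonneg s ζ)]
    exact p.weight_mul_datum_le hα hα' s ζ
  · by_contra h
    exact hζ (p.mem_region (s := s) fun h' => h (by simp [h']))

theorem le_norm_sq (hα : 1 ≤ α) (hα' : α ≤ 2) {s V : ℝ} (hV0 : 0 < V)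
    (hV : ∀ k c d a r : ℝ, 0 < a → 0 < r → volume (box k c d a r) = ENNReal.ofReal (a * r * V))
    {t : ℝ} (ht : 0 ≤ t) (ht1 : t ≤ 1) {b : ESpace α s}
    (hb : HasFourierFun b.toDistribution (picard α (fun ζ => (p.datum s ζ : ℂ)) 1 t)) :
    (weightHighMin p.m p.l s * (1 / 8 * p.N * t * (p.γ * p.width * V))) ^ 2 *
      (p.γ * p.width * V) ≤ ‖b‖ ^ 2 := by
  have hγ := p.γ_pos
  have hw := p.width_pos
  have hN := p.N_pos
  have hk := weightHighMin_pos p.m p.l s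
  obtain ⟨B, R, hB⟩ := p.exists_niceDatum_datum s
  refine ESpace.le_norm_sq hb (S := box p.slope p.N p.center p.γ p.width)
    (measurableSet_box _ _ _ _ _) (by positivity) (by positivity)
    (hV _ _ _ _ _ hγ hw).ge (fun ζ hζ => ?_)
  have h1 := le_norm_picard_one (by linarith) hB (p.datum_nonneg s) ht ht1 (ζ := ζ)
    (fun η h1 h2 => p.resonance hα hα' hζ h1 h2)
  have h2 := p.le_integral_datum s hV0 hV hζ
  have h3 : p.N / 2 ≤ |xi ζ| := by
    have := (abs_le.mp hζ.1).1
    linarith [le_abs_self (xi ζ), p.γ_le, p.N_large]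
  have h4 := (p.weight_high hα hα' s (ζ := ζ)
    ⟨hζ.1.trans (by linarith), hζ.2.trans (by linarith)⟩).1
  have ha := p.amp_pos s
  have hwt := ESpace.weight_pos α s ζ
  calc weightHighMin p.m p.l s * (1 / 8 * p.N * t * (p.γ * p.width * V))
      ≤ weight α s ζ * p.amp s * (1 / 8 * p.N * t * (p.γ * p.width * V)) :=
        mul_le_mul_of_nonneg_right h4 (by positivity)
    _ = weight α s ζ * (1 / 4 * (p.N / 2) * t * (p.amp s * (p.γ * p.width * V))) := by ring
    _ ≤ weight α s ζ * (1 / 4 * |xi ζ| * t *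
          ∫ η, p.datum s η * p.datum s (ζ - η)) := by gcongr
    _ ≤ _ := mul_le_mul_of_nonneg_left h1 hwt.le

end Packet

/-! ### Growth along the packets and conclusion -/

/-- With `P = N^(α/2)` the ratio `N / P = N^(1 - α/2)` tends to infinity because `α < 2`. The shape
parameters are chosen before `N`, so all constants are uniform along the family. -/
theorem exists_packets {α : ℝ} (hα : 1 ≤ α) (hα' : α < 2) :
    ∃ m l γ c : ℝ, 0 < γ ∧ 0 < c ∧ ∀ Z : ℝ, ∃ p : Packet α,
      p.m = m ∧ p.l = l ∧ p.γ = γ ∧ p.c = c ∧ Z < p.N / p.P := by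
  obtain ⟨m, l, hm, hl, h1, h2⟩ := exists_slopes hα hα'
  have hg : (0 : ℝ) < 1 + (1 + l) ^ 2 := by positivity
  have hc : (0 : ℝ) < 2 * (m + l) + 1 := by positivity
  refine ⟨m, l, 1 / 4 / (1 + (1 + l) ^ 2), 1 / 64 / (2 * (m + l) + 1), by positivity, by positivity,
    fun Z => ?_⟩
  have t1 : Tendsto (fun N : ℝ => N ^ (1 - α / 2)) atTop atTop :=
    tendsto_rpow_atTop (by linarith)
  have t2 : Tendsto (fun N : ℝ => (6 + l ^ 2) * (N ^ (-(1 - α / 2))) ^ 2) atTop (𝓝 0) := by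
    have := ((tendsto_rpow_neg_atTop (y := 1 - α / 2) (by linarith)).pow 2).const_mul (6 + l ^ 2)
    simpa using this
  obtain ⟨N, hN, hZ, hs⟩ := ((eventually_ge_atTop (10 : ℝ)).and ((t1.eventually_gt_atTop Z).and
    (t2.eventually_le_const (by norm_num : (0 : ℝ) < 1 / 8)))).exists
  have hN0 : 0 < N := by linarith
  have hP0 : 0 < N ^ (α / 2) := Real.rpow_pos_of_pos hN0 _
  have e1 : N / N ^ (α / 2) = N ^ (1 - α / 2) := by
    rw [Real.rpow_sub hN0, Real.rpow_one]
  have e2 : N ^ (α / 2) / N = N ^ (-(1 - α / 2)) := by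
    rw [neg_sub, Real.rpow_sub hN0, Real.rpow_one]
  refine ⟨⟨m, l, 1 / 4 / (1 + (1 + l) ^ 2), 1 / 64 / (2 * (m + l) + 1), N, N ^ (α / 2), hm, hl, h1,
    h2, by positivity, by field_simp, by positivity, by field_simp, hN, ?_, ?_, ?_, ?_⟩,
    rfl, rfl, rfl, rfl, ?_⟩
  · rw [← Real.rpow_natCast, ← Real.rpow_mul hN0.le]; congr 1; push_cast; ring
  · exact Real.one_le_rpow (by linarith) (by linarith)
  · calc N ^ (α / 2) ≤ N ^ (1 : ℝ) :=
          Real.rpow_le_rpow_of_exponent_le (by linarith) (by linarith)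
      _ = N := Real.rpow_one N
  · rw [e2]; exact hs
  · rw [e1]; exact hZ

/-- The quadratic term of the expansion is not bounded by the square of the norm of the datum. -/
theorem not_exists_norm_picard_one_le {s α : ℝ} (hα : 1 ≤ α) (hα' : α < 2) {t : ℝ} (ht : 0 < t)
    (ht1 : t ≤ 1) :
    ¬ ∃ C : ℝ, ∀ (B R : ℝ) (h : Plane → ℂ) (f b : ESpace α s), NiceDatum B R h →
      HasFourierFun f.toDistribution h → HasFourierFun b.toDistribution (picard α h 1 t) →
      ‖b‖ ≤ C * ‖f‖ ^ 2 := by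
  rintro ⟨C, hC⟩
  obtain ⟨V, hV0, hV⟩ := exists_volume_box
  obtain ⟨m, l, γ, c, hγ, hc, hp⟩ := exists_packets hα hα'
  set k := weightHighMin m l s with hk
  set K := weightLow l s + 2 * weightHigh m l s with hK
  have hk0 : 0 < k := weightHighMin_pos m l s
  obtain ⟨p, rfl, rfl, rfl, rfl, hZ⟩ := hp (C ^ 2 * (K ^ 2 * 36) ^ 2 /
    ((k * (1 / 8 * t)) ^ 2 * (γ * c * V)))
  obtain ⟨B, R, hB⟩ := p.exists_niceDatum_datum s
  have hα0 : 0 ≤ α := by linarith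
  -- The datum is the zeroth term of the expansion at time `0`, from which its decay of every order
  -- is read off.
  obtain ⟨f, hf⟩ := exists_hasFourierFun hα0 hα'.le s hB.cont hB.conj_neg fun n => by
    have := hB.decay_picard hα0 (t := 0) (T := 0) (by simp) n 0
    rw [picard_zero] at this
    exact ⟨_, by simpa [phase_zero] using this⟩
  obtain ⟨b, hb⟩ := hB.exists_hasFourierFun_picard hα0 hα'.le s t 1
  have h1 := hC B R _ f b hB hf hb
  have h2 := p.norm_sq_le hα hα'.le hV0 hV hf
  have h3 := p.le_norm_sq hα hα'.le hV0 hV ht.le ht1 hb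
  set q := p.γ * p.width * V with hq
  have hq0 : 0 < q := by have := p.γ_pos; have := p.width_pos; positivity
  have h4 : ‖b‖ ^ 2 ≤ C ^ 2 * (K ^ 2 * (36 * q)) ^ 2 := by
    calc ‖b‖ ^ 2 ≤ (C * ‖f‖ ^ 2) ^ 2 := pow_le_pow_left₀ (norm_nonneg _) h1 2
      _ = C ^ 2 * (‖f‖ ^ 2) ^ 2 := mul_pow _ _ _
      _ ≤ _ := by gcongr
  have h5 : (k * (1 / 8 * t)) ^ 2 * (p.N ^ 2 * q) ≤ C ^ 2 * (K ^ 2 * 36) ^ 2 := by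
    refine le_of_mul_le_mul_right ?_ (pow_pos hq0 2)
    calc _ = (k * (1 / 8 * p.N * t * q)) ^ 2 * q := by ring
      _ ≤ _ := h3.trans h4
      _ = _ := by ring
  -- The width is `c / (N P)`, so the left side of `h5` grows like `N / P`; the threshold passed to
  -- `hp` was chosen to contradict this.
  have h6 : p.N ^ 2 * q = p.N / p.P * (p.γ * p.c * V) := by
    have := p.N_pos
    have := p.P_pos
    rw [hq]
    unfold Packet.width
    field_simp
  rw [h6] at h5
  rw [div_lt_iff₀ (by have := p.γ_pos; have := p.c_pos; positivity)] at hZ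
  nlinarith

end BOZK

end

theorem theorem1p3 (s α : ℝ) (hα₁ : 1 ≤ α) (hα₂ : α < 2) :
    ¬ ∃ T : ℝ, 0 < T ∧
      ∃ X : Set (ℝ → BOZK.ESpace α s),
      ∃ U ∈ 𝓝 (0 : BOZK.ESpace α s),
      ∃ S : BOZK.ESpace α s → ℝ → BOZK.ESpace α s,
        (∀ u, BOZK.IsSmoothSolution α s T u → u ∈ X) ∧
        (∀ u₀ ∈ U,
          S u₀ ∈ X ∧ BOZK.IsSolution α s T (S u₀) ∧ S u₀ 0 = u₀ ∧
          ∀ v ∈ X, BOZK.IsSolution α s T v → v 0 = u₀ → EqOn v (S u₀) (Icc (-T) T)) ∧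
        ∀ t ∈ Icc (-T) T, ContDiffAt ℝ 2 (fun u₀ => S u₀ t) 0 := by
  rintro ⟨T, hT, X, U, hU, S, hX, hS, hC2⟩
  -- The phases are controlled only up to time `1`; regularity of the flow at this single positive
  -- time is already contradictory.
  have hmem : min T 1 ∈ Icc (-T) T :=
    ⟨by linarith [lt_min hT one_pos], min_le_left _ _⟩
  exact BOZK.not_exists_norm_picard_one_le hα₁ hα₂ (lt_min hT one_pos) (min_le_right _ _)
    (BOZK.exists_norm_picard_one_le (by linarith) hα₂.le hT hU hX
      (fun u₀ hu₀ => (hS u₀ hu₀).2.2.2) hmem (hC2 _ hmem))
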